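/- **Definitions.** A *labeled weighted bi-colored plane tree* is a finite tree embedded in the oriented plane, with its vertices properly colored black and white, a positive integer weight on each edge, and a label on each vertex. Two such trees are the same if they differ by an orientation-preserving homeomorphism of the plane that respects colors, weights and labels; that is, the embedding is recorded by the counterclockwise cyclic order of the edges at each vertex, and two trees are the same if there is an isomorphism of trees that preserves colors, these cyclic orders, weights and labels. The weight of a vertex is the sum of the weights of its edges. A *labeled passport* $\Xi=(\Xi^+,\Xi^-)$ is a pair of finite multisets of labeled weights $K_k$ ($K$ a positive integer, $k$ a label), written in power notation; a passport without labels is one in which all labels are equal. It is the passport of a tree if $\Xi^+$ (resp. $\Xi^-$) is the multiset of the pairs (weight, label) of the black (resp. white) vertices. The *filling* $\mathrm{Fill}(\Xi)$ replaces the $c$ copies of each labeled weight $K_k$ occurring $c$ times by $K_{(k,1)},\dots,K_{(k,c)}$. Let $\mathrm{FTree}(\Xi)$ be the set of trees (up to being the same) with passport $\mathrm{Fill}(\Xi)$, and let $p(\Xi)$ be the product of the factorials of the multiplicities of the labeled weights in $\Xi^+$ and in $\Xi^-$. For $d>1$, the *divided passport* $\Xi/d$ exists if some labeled weight $K_k$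 of one of the two parts of $\Xi$ satisfies: $d\mid K$, $d\mid\lambda-1$ where $\lambda$ is its multiplicity in that part, and $d$ divides all other multiplicities in both parts. Then $\Xi/d$ arises from $\Xi$ by removing one copy of $K_k$, dividing all multiplicities by $d$, and adding to that part one copy of $K/d$ with a new label $*$. It is unique when it exists, and we put $$G(d)=\frac{\#\mathrm{FTree}(\Xi/d)}{d\,p(\Xi/d)} .$$ **Proposition.** Let $p>q\ge 1$ be integers, let $\Xi=(q^p,p^q)$ (unlabeled), and put $g_0=\gcd(p,q)$, $g_1=\gcd(p-1,q)$, $g_2=\gcd(p,q-1)$. Let $d>1$ be an integer such that $\Xi/d$ exists. Then $\mathrm{FTree}(\Xi/d)$ is finite and $$G(d)=\sum_{(s,n_1,\dots,n_{g_0})\in S_d}\mathcal C_d(s,n_1,\dots,n_{g_0}),$$ where $$S_d=\Bigl\{(s,n_1,\dots,n_{g_0})\in\mathbb Z_{\ge0}^{g_0+1} : s+\sum_{j=1}^{g_0}j\,n_j=\Bigl\lfloor\frac{g_0}{d}\Bigr\rfloor\Bigr\}$$ and, with $n=1+\sum_{j=1}^{g_0}n_j$ and $\{x\}$ the fractional part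 of $x$, $$\mathcal C_d(s,n_1,\dots,n_{g_0})=(-1)^{n-1}\frac{(p+q-1)^{n-2}}{d^{\,n-1}}\binom{\bigl(s+\{\frac{g_0}{d}\}\bigr)\frac{p+q}{g_0}-\frac1d}{\bigl(s+\{\frac{g_0}{d}\}\bigr)\frac{r}{g_0}}\prod_{j=1}^{g_0}\frac1{n_j!}\left[\frac{\bigl(\frac{j(p+q)}{g_0}-1\bigr)!}{\bigl(\frac{jp}{g_0}\bigr)!\,\bigl(\frac{jq}{g_0}\bigr)!}\right]^{n_j},$$ with $r=q$ if $d\mid g_1$ and $r=p$ if $d\mid g_2$ (exactly one of the two holds; the entries of the binomial coefficient are non-negative integers). -/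

import Mathlib

open scoped Nat

noncomputable section

/-! ## Labeled passports -/

/-- A labeled passport with labels in `S`: two multisets of labeled weights `(K, k)`, where
`K` is a positive integer (the weight) and `k : S` is the label. -/
@[ext]
structure LabeledPassport (S : Type) where
  black : Multiset (ℕ × S)
  white : Multiset (ℕ × S)
  black_pos : ∀ x ∈ black, 0 < x.1
  white_pos : ∀ x ∈ white, 0 < x.1

/-- The filling of a multiset of labeled weights: the `c` copies of `(K, k)` become
`(K, (k, 1)), …, (K, (k, c))`. -/
def fillMultiset {S : Type} (A : Multiset (ℕ × S)) : Multiset (ℕ × (S × ℕ)) :=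
  open Classical in
  A.toEnumFinset.val.map fun y => (y.1.1, (y.1.2, y.2 + 1))

lemma fst_pos_of_mem_fillMultiset {S : Type} {A : Multiset (ℕ × S)} (hA : ∀ x ∈ A, 0 < x.1) :
    ∀ x ∈ fillMultiset A, 0 < x.1 := by
  classical
  intro x hx
  simp only [fillMultiset, Multiset.mem_map, Finset.mem_val] at hx
  obtain ⟨y, hy, rfl⟩ := hx
  exact hA _ (Multiset.mem_of_mem_toEnumFinset hy)

/-- The filling of a labeled passport. Its labels are double labels `(k, s)`. -/
def LabeledPassport.fill {S : Type} (Ξ : LabeledPassport S) : LabeledPassport (S × ℕ) where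
  black := fillMultiset Ξ.black
  white := fillMultiset Ξ.white
  black_pos := fst_pos_of_mem_fillMultiset Ξ.black_pos
  white_pos := fst_pos_of_mem_fillMultiset Ξ.white_pos

/-- `p(Ξ)`: the product of the factorials of all the multiplicities in `Ξ`. -/
def LabeledPassport.multFactorial {S : Type} (Ξ : LabeledPassport S) : ℕ :=
  open Classical in
  (∏ x ∈ Ξ.black.toFinset, (Ξ.black.count x)!) * ∏ y ∈ Ξ.white.toFinset, (Ξ.white.count y)!

/-! ## Divided passports

The labels of `Ξ / d` are the labels `some k` with `k` a label of `Ξ`, and the star label `none`,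
which therefore does not occur in `Ξ`. -/

/-- `(K, k) ↦ (K, k)`, where the new set of labels also contains the star. -/
def addStar {S : Type} (x : ℕ × S) : ℕ × Option S := (x.1, some x.2)

/-- The multiset with every multiplicity divided by `d`. -/
def divMult {α : Type} (d : ℕ) (A : Multiset α) : Multiset α :=
  open Classical in
  ∑ y ∈ A.toFinset, (A.count y / d) • ({y} : Multiset α)

/-- The divisibility conditions for `x`, a labeled weight in the part `A` of the
passport with parts `A` and `B`, to give rise to a symmetric center. -/
def DividesAt {S : Type} (d : ℕ) (A B : Multiset (ℕ × S)) (x : ℕ × S) : Prop :=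
  open Classical in
  x ∈ A ∧ d ∣ x.1 ∧ d ∣ A.count x - 1 ∧ (∀ y ∈ A, y ≠ x → d ∣ A.count y) ∧
    ∀ z ∈ B, d ∣ B.count z

/-- The divided part that contains the symmetric center: one copy of `x = (K, k)` is replaced by
`(K / d, *)`, and the multiplicities of everything else are divided by `d`. -/
def centerPart {S : Type} (d : ℕ) (A : Multiset (ℕ × S)) (x : ℕ × S) :
    Multiset (ℕ × Option S) :=
  open Classical in
  (x.1 / d, none) ::ₘ (divMult d (A.erase x)).map addStar

/-- The divided part without the symmetric center. -/
def plainPart {S : Type} (d : ℕ) (A : Multiset (ℕ × S)) : Multiset (ℕ × Option S) :=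
  (divMult d A).map addStar

/-- `Ξ'` is the divided passport `Ξ / d`. -/
def LabeledPassport.IsDivided {S : Type} (Ξ : LabeledPassport S) (d : ℕ)
    (Ξ' : LabeledPassport (Option S)) : Prop :=
  (d = 1 ∧ Ξ'.black = Ξ.black.map addStar ∧ Ξ'.white = Ξ.white.map addStar) ∨
  (1 < d ∧ ∃ x, DividesAt d Ξ.black Ξ.white x ∧
    Ξ'.black = centerPart d Ξ.black x ∧ Ξ'.white = plainPart d Ξ.white) ∨
  (1 < d ∧ ∃ x, DividesAt d Ξ.white Ξ.black x ∧
    Ξ'.black = plainPart d Ξ.black ∧ Ξ'.white = centerPart d Ξ.white x)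

/-- `Ξ / d` exists. -/
def LabeledPassport.HasDivided {S : Type} (Ξ : LabeledPassport S) (d : ℕ) : Prop :=
  ∃ Ξ', Ξ.IsDivided d Ξ'

open Classical in
/-- The divided passport `Ξ / d` (the empty passport if `Ξ / d` does not exist). -/
def LabeledPassport.divided {S : Type} (Ξ : LabeledPassport S) (d : ℕ) :
    LabeledPassport (Option S) :=
  if h : Ξ.HasDivided d then h.choose else ⟨0, 0, by simp, by simp⟩

lemma DividesAt.eq_of_dvd {S : Type} {d : ℕ} (hd : 1 < d) {A B : Multiset (ℕ × S)} {x : ℕ × S}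
    (h : DividesAt d A B x) (h' : open Classical in d ∣ A.count x) : False := by
  classical
  obtain ⟨h1, -, h2, -⟩ := h
  have h3 : 0 < A.count x := Multiset.count_pos.2 h1
  have h4 : d ∣ A.count x - 1 := by convert h2
  have h5 : d ∣ A.count x := by convert h'
  have h6 : d ∣ A.count x - (A.count x - 1) := Nat.dvd_sub h5 h4
  have h7 : A.count x - (A.count x - 1) = 1 := by omega
  rw [h7] at h6
  have := Nat.le_of_dvd one_pos h6
  omega

/-- The divided passport is unique. -/
theorem LabeledPassport.IsDivided.unique {S : Type} {Ξ : LabeledPassport S} {d : ℕ}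
    {Ξ₁ Ξ₂ : LabeledPassport (Option S)} (h₁ : Ξ.IsDivided d Ξ₁) (h₂ : Ξ.IsDivided d Ξ₂) :
    Ξ₁ = Ξ₂ := by
  classical
  have key : ∀ {A B : Multiset (ℕ × S)} {x y : ℕ × S}, 1 < d → DividesAt d A B x →
      DividesAt d A B y → x = y := by
    intro A B x y hd hx hy
    by_contra hne
    exact hx.eq_of_dvd hd (hy.2.2.2.1 x hx.1 hne)
  have key' : ∀ {A B : Multiset (ℕ × S)} {x y : ℕ × S}, 1 < d → DividesAt d A B x →
      DividesAt d B A y → False := by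
    intro A B x y hd hx hy
    exact hx.eq_of_dvd hd (hy.2.2.2.2 x hx.1)
  rcases h₁ with ⟨hd, hb, hw⟩ | ⟨hd, x, hx, hb, hw⟩ | ⟨hd, x, hx, hb, hw⟩ <;>
    rcases h₂ with ⟨hd', hb', hw'⟩ | ⟨hd', y, hy, hb', hw'⟩ | ⟨hd', y, hy, hb', hw'⟩ <;>
    first
    | (exfalso; omega)
    | exact (key' hd hx hy).elim
    | (have hxy := key hd hx hy
       subst hxy
       exact LabeledPassport.ext (hb.trans hb'.symm) (hw.trans hw'.symm))
    | exact LabeledPassport.ext (hb.trans hb'.symm) (hw.trans hw'.symm)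

theorem LabeledPassport.IsDivided.divided_eq {S : Type} {Ξ : LabeledPassport S} {d : ℕ}
    {Ξ' : LabeledPassport (Option S)} (h : Ξ.IsDivided d Ξ') : Ξ.divided d = Ξ' := by
  have h0 : Ξ.HasDivided d := ⟨Ξ', h⟩
  have h1 : Ξ.divided d = h0.choose := by
    unfold LabeledPassport.divided
    exact dif_pos h0
  rw [h1]
  exact h0.choose_spec.unique h

/-! ## Labeled weighted bi-colored plane trees -/

/-- The (uncolored, unweighted) graph with black vertices `B`, white vertices `W` and edges `E`,
where the edge `e` joins `src e` and `tgt e`. -/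
def bicoloredGraph {B W E : Type} (src : E → B) (tgt : E → W) : SimpleGraph (B ⊕ W) :=
  SimpleGraph.fromRel fun x y => ∃ e, x = Sum.inl (src e) ∧ y = Sum.inr (tgt e)

/-- A weighted bi-colored plane tree: a finite tree with a proper coloring of the vertices in black
and white, a positive integral weight on each edge, and, for each vertex, a cyclic
(counterclockwise) order on the edges at that vertex, which records the embedding in the oriented
plane. The permutation `rotBlack` sends each edge to the next one around its black end, and
`rotWhite` to the next one around its white end. -/
structure WBPTree where
  /-- black vertices -/
  B : Type
  /-- white vertices -/
  W : Type
  /-- edges -/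
  E : Type
  [fintypeB : Fintype B]
  [fintypeW : Fintype W]
  [fintypeE : Fintype E]
  /-- the black end of an edge -/
  src : E → B
  /-- the white end of an edge -/
  tgt : E → W
  /-- there are no multiple edges -/
  ends_injective : Function.Injective fun e => (src e, tgt e)
  isTree : (bicoloredGraph src tgt).IsTree
  rotBlack : Equiv.Perm E
  rotWhite : Equiv.Perm E
  /-- the orbits of `rotBlack` are the sets of edges at the black vertices -/
  rotBlack_sameCycle : ∀ e e', rotBlack.SameCycle e e' ↔ src e = src e'
  /-- the orbits of `rotWhite` are the sets of edges at the white vertices -/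
  rotWhite_sameCycle : ∀ e e', rotWhite.SameCycle e e' ↔ tgt e = tgt e'
  weight : E → ℕ
  weight_pos : ∀ e, 0 < weight e

attribute [instance] WBPTree.fintypeB WBPTree.fintypeW WBPTree.fintypeE

open Classical in
/-- The weight of a black vertex: the sum of the weights of its edges. -/
def WBPTree.wtBlack (T : WBPTree) (b : T.B) : ℕ := ∑ e with T.src e = b, T.weight e

open Classical in
/-- The weight of a white vertex: the sum of the weights of its edges. -/
def WBPTree.wtWhite (T : WBPTree) (w : T.W) : ℕ := ∑ e with T.tgt e = w, T.weight e

/-- A weighted bi-colored plane tree with labels in `S` at the vertices. -/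
structure LWBPTree (S : Type) extends WBPTree where
  labBlack : B → S
  labWhite : W → S

/-- `Ξ` is the labeled passport of `T`: the maps `v ↦ (wt v, label of v)` are
bijections from the sets of black and white vertices onto the multisets `Ξ⁺` and `Ξ⁻`. -/
def LWBPTree.HasPassport {S : Type} (T : LWBPTree S) (Ξ : LabeledPassport S) : Prop :=
  (Finset.univ.val.map fun b => (T.wtBlack b, T.labBlack b)) = Ξ.black ∧
  (Finset.univ.val.map fun w => (T.wtWhite w, T.labWhite w)) = Ξ.white

/-- An isomorphism of labeled weighted bi-colored plane trees: it preserves colors, incidence, the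
cyclic orders at the vertices, weights and labels. -/
structure LWBPTree.Iso {S : Type} (T T' : LWBPTree S) where
  onB : T.B ≃ T'.B
  onW : T.W ≃ T'.W
  onE : T.E ≃ T'.E
  src_onE : ∀ e, T'.src (onE e) = onB (T.src e)
  tgt_onE : ∀ e, T'.tgt (onE e) = onW (T.tgt e)
  rotBlack_onE : ∀ e, T'.rotBlack (onE e) = onE (T.rotBlack e)
  rotWhite_onE : ∀ e, T'.rotWhite (onE e) = onE (T.rotWhite e)
  weight_onE : ∀ e, T'.weight (onE e) = T.weight e
  labBlack_onB : ∀ b, T'.labBlack (onB b) = T.labBlack b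
  labWhite_onW : ∀ w, T'.labWhite (onW w) = T.labWhite w

def LWBPTree.Iso.refl {S : Type} (T : LWBPTree S) : T.Iso T :=
  ⟨Equiv.refl _, Equiv.refl _, Equiv.refl _, by simp, by simp, by simp, by simp, by simp,
    by simp, by simp⟩

def LWBPTree.Iso.symm {S : Type} {T T' : LWBPTree S} (f : T.Iso T') : T'.Iso T where
  onB := f.onB.symm
  onW := f.onW.symm
  onE := f.onE.symm
  src_onE e := by rw [Equiv.eq_symm_apply, ← f.src_onE, Equiv.apply_symm_apply]
  tgt_onE e := by rw [Equiv.eq_symm_apply, ← f.tgt_onE, Equiv.apply_symm_apply]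
  rotBlack_onE e := by rw [Equiv.eq_symm_apply, ← f.rotBlack_onE, Equiv.apply_symm_apply]
  rotWhite_onE e := by rw [Equiv.eq_symm_apply, ← f.rotWhite_onE, Equiv.apply_symm_apply]
  weight_onE e := by rw [← f.weight_onE, Equiv.apply_symm_apply]
  labBlack_onB b := by rw [← f.labBlack_onB, Equiv.apply_symm_apply]
  labWhite_onW w := by rw [← f.labWhite_onW, Equiv.apply_symm_apply]

def LWBPTree.Iso.trans {S : Type} {T T' T'' : LWBPTree S} (f : T.Iso T') (g : T'.Iso T'') :
    T.Iso T'' where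
  onB := f.onB.trans g.onB
  onW := f.onW.trans g.onW
  onE := f.onE.trans g.onE
  src_onE e := by simp [g.src_onE, f.src_onE]
  tgt_onE e := by simp [g.tgt_onE, f.tgt_onE]
  rotBlack_onE e := by simp [g.rotBlack_onE, f.rotBlack_onE]
  rotWhite_onE e := by simp [g.rotWhite_onE, f.rotWhite_onE]
  weight_onE e := by simp [g.weight_onE, f.weight_onE]
  labBlack_onB b := by simp [g.labBlack_onB, f.labBlack_onB]
  labWhite_onW w := by simp [g.labWhite_onW, f.labWhite_onW]

/-- Two trees with passport `Ξ` are the same if they are isomorphic. -/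
def sameTree {S : Type} (Ξ : LabeledPassport S) : Setoid {T : LWBPTree S // T.HasPassport Ξ} where
  r T T' := Nonempty (T.1.Iso T'.1)
  iseqv :=
    { refl := fun T => ⟨.refl T.1⟩
      symm := fun ⟨f⟩ => ⟨f.symm⟩
      trans := fun ⟨f⟩ ⟨g⟩ => ⟨f.trans g⟩ }

/-- The set of the labeled weighted bi-colored plane trees with passport `Ξ`, where isomorphic trees are identified. -/
def TreesWith {S : Type} (Ξ : LabeledPassport S) : Type 1 := Quotient (sameTree Ξ)

/-- `FTree(Ξ)`: the trees whose passport is the filling of `Ξ`. -/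
def FTree {S : Type} (Ξ : LabeledPassport S) : Type 1 := TreesWith Ξ.fill

/-- `G(d) = #FTree(Ξ / d) / (d p(Ξ / d))`. -/
def treeG {S : Type} (Ξ : LabeledPassport S) (d : ℕ) : ℚ :=
  (Nat.card (FTree (Ξ.divided d)) : ℚ) / (d * (Ξ.divided d).multFactorial)

/-! ## The passport `(q^p, p^q)` and the terms of the formula -/

/-- The unlabeled passport `(q^p, p^q)`: `p` black vertices of weight `q` and `q` white vertices of
weight `p`. Being unlabeled means that all labels are equal. -/
def pqPassport (p q : ℕ) (hp : 1 ≤ p) (hq : 1 ≤ q) : LabeledPassport Unit where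
  black := Multiset.replicate p (q, ())
  white := Multiset.replicate q (p, ())
  black_pos := by
    intro x hx
    rw [Multiset.eq_of_mem_replicate hx]
    exact hq
  white_pos := by
    intro x hx
    rw [Multiset.eq_of_mem_replicate hx]
    exact hp

/-- The set `S_d` of the types `(s, n_1, …, n_g)`, where `g = gcd(p, q)`, with
`s + ∑ j n_j = ⌊g / d⌋`. The number `n_j` is `t.2 i` for `i = j - 1`. -/
def typeSet (p q d : ℕ) : Finset (ℕ × (Fin (p.gcd q) → ℕ)) :=
  (Finset.range (p.gcd q / d + 1) ×ˢ
      Fintype.piFinset fun _ => Finset.range (p.gcd q / d + 1)).filter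
    fun t => t.1 + ∑ i : Fin (p.gcd q), ((i : ℕ) + 1) * t.2 i = p.gcd q / d

/-- The bounds in `typeSet` are no restriction. -/
theorem mem_typeSet (p q d : ℕ) (t : ℕ × (Fin (p.gcd q) → ℕ)) :
    t ∈ typeSet p q d ↔ t.1 + ∑ i : Fin (p.gcd q), ((i : ℕ) + 1) * t.2 i = p.gcd q / d := by
  simp only [typeSet, Finset.mem_filter, Finset.mem_product, Finset.mem_range,
    Fintype.mem_piFinset, and_iff_right_iff_imp]
  intro h
  refine ⟨by omega, fun i => ?_⟩
  have h1 : ((i : ℕ) + 1) * t.2 i ≤ ∑ i : Fin (p.gcd q), ((i : ℕ) + 1) * t.2 i :=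
    Finset.single_le_sum (f := fun i : Fin (p.gcd q) => ((i : ℕ) + 1) * t.2 i)
      (fun _ _ => Nat.zero_le _) (Finset.mem_univ i)
  have h2 : t.2 i ≤ ((i : ℕ) + 1) * t.2 i := Nat.le_mul_of_pos_left _ (Nat.succ_pos _)
  omega

/-- `s + {g / d}`, where `g = gcd(p, q)` and `{·}` is the fractional part. -/
def shifted (p q d s : ℕ) : ℚ := s + Int.fract ((p.gcd q : ℚ) / d)

/-- The binomial coefficient of the block that contains the symmetric center. Here `r = q` or
`r = p`. Both entries are integers in the relevant cases, so that the floors do nothing there. -/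
def centerBinom (p q d s r : ℕ) : ℕ :=
  Nat.choose ⌊shifted p q d s * ((p + q : ℚ) / p.gcd q) - 1 / d⌋₊
    ⌊shifted p q d s * ((r : ℚ) / p.gcd q)⌋₊

/-- The factor `∏_j (1 / n_j!) [(j(p+q)/g - 1)! / ((jp/g)! (jq/g)!)]^{n_j}` with
`g = gcd(p, q)`; the quotients `j(p+q)/g`, `jp/g`, `jq/g` are exact. -/
def blockProd (p q : ℕ) (n : Fin (p.gcd q) → ℕ) : ℚ :=
  ∏ i : Fin (p.gcd q), (1 / ((n i)! : ℚ)) *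
    (((((i : ℕ) + 1) * (p + q) / p.gcd q - 1)! : ℚ) /
      (((((i : ℕ) + 1) * p / p.gcd q)! : ℚ) * ((((i : ℕ) + 1) * q / p.gcd q)! : ℚ))) ^ n i

/-- The number of blocks `1 + ∑ n_j`. -/
def numBlocks {g : ℕ} (n : Fin g → ℕ) : ℕ := 1 + ∑ i, n i

/-- The sign and the powers `(-1)^(n-1) (p+q-1)^(n-2) / d^(n-1)`. -/
def prefactor (p q d n : ℕ) : ℚ :=
  (-1) ^ (n - 1) * (((p : ℚ) + q - 1) ^ ((n : ℤ) - 2) / (d : ℚ) ^ (n - 1))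

/-- The term `C_d(s, n_1, …, n_g)`, for `1 < d ∣ gcd(p - 1, q)` and for `1 < d ∣ gcd(p, q - 1)`. -/
def termC (p q d s : ℕ) (n : Fin (p.gcd q) → ℕ) : ℚ :=
  if d ∣ (p - 1).gcd q then
    prefactor p q d (numBlocks n) * centerBinom p q d s q * blockProd p q n
  else if d ∣ p.gcd (q - 1) then
    prefactor p q d (numBlocks n) * centerBinom p q d s p * blockProd p q n
  else 0

end

/-! ## Trees as sets of directed edges -/

/-! After filling, the vertices of Ξ/d are pairwise distinguishable: one star, P black vertices of
weight q and Q white vertices of weight p. There are M = P + Q edges, and d M = p + q - 1. Count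
black weights positively and white ones negatively. A weighted tree is then a tree with a positive
flow whose outflow is the signed weight `s`. Such a flow is unique, and a vertex of degree k admits
(k - 1)! cyclic orders, so #FTree(Ξ/d) is the sum over trees of ∏ (deg v - 1)! (`card_treesWith`,
`planeTreeSum`).

Marking an edge multiplies this number by M. Cutting the marked edge leaves two planted trees with
excess of opposite signs, and a planted tree of nonzero excess is a single vertex or again an
edge-rooted tree. Hence the recursion `rootedSum_eq`: A(U) = [|U| = 1] + ∑ A(U₁) A(U₂), over U = U₁
⊔ U₂ with s(U₁) > 0 > s(U₂).

Encode functions of vertex sets by power series in X (cardinality) over Laurent polynomials in T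
(weight), with a variable x_v of square zero for each vertex. For the parts p₀, z₀, n₀ of positive,
zero and negative weight, the recursion becomes the Wiener-Hopf factorization (1 - p₀)(1 - n₀) = 1 +
z₀ - X η with η = ∑ x_v T^(s v). The star, of weight h, occurs at most once and is a first order
deformation: p₁ + z₁ + n₁ = T^h + p₁ n₀ + p₀ n₁. After division by the factorization, the positive
and the negative parts become one-sided in T and vanish in degree zero. This expresses z₁ by K = (1
+ z₀ - X η)⁻¹ (`zeroPart_of_factorization`), and an argument of Lagrange inversion type extracts
coefficients without knowing z₀ (`exists_lagrange_coeffs`).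

With only the two weights g q' and -g p' in η, only powers of η with exponent divisible by p' + q'
have a part of degree zero. The recursion is then solved by the coefficients of exp(-M ∑ b_j X^j)
with b_j = (j(p'+q') - 1)! / ((j p')! (j q')!) (`rootedSum_univ_eq`, `card_FTree_of_star`).
Expanding the exponential over partitions (`expCoeff_eq_sum_partMults`) produces the n_j. The
remaining binomial coefficient is that of the block with the center. -/

section Trees

variable {V : Type} [DecidableEq V]

/-- `TreeOn U T`: the edges in `T`, with directions forgotten, form a tree with vertex set `U`. -/
inductive TreeOn : Finset V → Finset (V × V) → Prop
  | single (v : V) : TreeOn {v} ∅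
  | join {U₁ U₂ : Finset V} {T₁ T₂ : Finset (V × V)} {b w : V} :
      TreeOn U₁ T₁ → TreeOn U₂ T₂ → Disjoint U₁ U₂ → b ∈ U₁ → w ∈ U₂ →
      TreeOn (U₁ ∪ U₂) (insert (b, w) (T₁ ∪ T₂))

/-- A decomposition of the tree `T` on `U` into the two trees that remain when the edge `e` is
removed. -/
structure IsCut (U : Finset V) (T : Finset (V × V)) (e : V × V)
    (U₁ U₂ : Finset V) (T₁ T₂ : Finset (V × V)) : Prop where
  left : TreeOn U₁ T₁
  right : TreeOn U₂ T₂
  disj : Disjoint U₁ U₂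
  fst_mem : e.1 ∈ U₁
  snd_mem : e.2 ∈ U₂
  verts : U = U₁ ∪ U₂
  edges : T = insert e (T₁ ∪ T₂)

namespace TreeOn

lemma nonempty {U : Finset V} {T : Finset (V × V)} (h : TreeOn U T) : U.Nonempty := by
  induction h with
  | single v => exact ⟨v, by simp⟩
  | join _ _ _ hb => exact ⟨_, Finset.mem_union_left _ hb⟩

lemma mem_verts {U : Finset V} {T : Finset (V × V)} (h : TreeOn U T) :
    ∀ e ∈ T, e.1 ∈ U ∧ e.2 ∈ U := by
  induction h with
  | single v => simp
  | join h₁ h₂ hd hb hw ih₁ ih₂ =>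
    intro e he
    simp only [Finset.mem_insert, Finset.mem_union] at he ⊢
    rcases he with rfl | he | he
    · exact ⟨.inl hb, .inr hw⟩
    · exact ⟨.inl (ih₁ e he).1, .inl (ih₁ e he).2⟩
    · exact ⟨.inr (ih₂ e he).1, .inr (ih₂ e he).2⟩

/-- A set of vertices that is a union of connected components contains everything as soon as it
meets `U`. -/
lemma subset_of_closed {U : Finset V} {T : Finset (V × V)} (h : TreeOn U T) (S : Set V)
    (hS : ∀ e ∈ T, e.1 ∈ S ↔ e.2 ∈ S) {u : V} (hu : u ∈ U) (huS : u ∈ S) :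
    ∀ v ∈ U, v ∈ S := by
  induction h generalizing u with
  | single v => simp_all
  | @join U₁ U₂ T₁ T₂ b w h₁ h₂ hd hb hw ih₁ ih₂ =>
    have e₁ : ∀ e ∈ T₁, e.1 ∈ S ↔ e.2 ∈ S := fun e he => hS e (by simp [he])
    have e₂ : ∀ e ∈ T₂, e.1 ∈ S ↔ e.2 ∈ S := fun e he => hS e (by simp [he])
    have e₃ : b ∈ S ↔ w ∈ S := hS (b, w) (by simp)
    have hbS : b ∈ S := by
      rcases Finset.mem_union.1 hu with hu | hu
      · exact ih₁ e₁ hu huS b hb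
      · exact e₃.2 (ih₂ e₂ hu huS w hw)
    intro v hv
    rcases Finset.mem_union.1 hv with hv | hv
    · exact ih₁ e₁ hb hbS v hv
    · exact ih₂ e₂ hw (e₃.1 hbS) v hv

end TreeOn

namespace IsCut

variable {U U₁ U₂ U₁' U₂' : Finset V} {T T₁ T₂ T₁' T₂' : Finset (V × V)} {e : V × V}

lemma treeOn (h : IsCut U T e U₁ U₂ T₁ T₂) : TreeOn U T := by
  rw [h.verts, h.edges]
  exact TreeOn.join h.left h.right h.disj h.fst_mem h.snd_mem

lemma notMem_left (h : IsCut U T e U₁ U₂ T₁ T₂) : e ∉ T₁ := fun he =>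
  Finset.disjoint_left.1 h.disj (h.left.mem_verts e he).2 h.snd_mem

lemma notMem_right (h : IsCut U T e U₁ U₂ T₁ T₂) : e ∉ T₂ := fun he =>
  Finset.disjoint_left.1 h.disj h.fst_mem (h.right.mem_verts e he).1

lemma disj_edges (h : IsCut U T e U₁ U₂ T₁ T₂) : Disjoint T₁ T₂ :=
  Finset.disjoint_left.2 fun x h₁ h₂ =>
    Finset.disjoint_left.1 h.disj (h.left.mem_verts x h₁).1 (h.right.mem_verts x h₂).1

lemma notMem (h : IsCut U T e U₁ U₂ T₁ T₂) : e ∉ T₁ ∪ T₂ := by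
  simp [h.notMem_left, h.notMem_right]

lemma union_edges (h : IsCut U T e U₁ U₂ T₁ T₂) : T₁ ∪ T₂ = T.erase e := by
  rw [h.edges, Finset.erase_insert h.notMem]

lemma left_edges (h : IsCut U T e U₁ U₂ T₁ T₂) : T₁ = (T.erase e).filter fun x => x.1 ∈ U₁ := by
  rw [← h.union_edges]
  ext x
  simp only [Finset.mem_filter, Finset.mem_union]
  constructor
  · exact fun hx => ⟨.inl hx, (h.left.mem_verts x hx).1⟩
  · rintro ⟨hx | hx, hx'⟩
    · exact hx
    · exact absurd (h.right.mem_verts x hx).1 (Finset.disjoint_left.1 h.disj hx')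

lemma right_edges (h : IsCut U T e U₁ U₂ T₁ T₂) : T₂ = (T.erase e).filter fun x => x.1 ∉ U₁ := by
  rw [← h.union_edges]
  ext x
  simp only [Finset.mem_filter, Finset.mem_union]
  constructor
  · exact fun hx =>
      ⟨.inr hx, fun hx' => Finset.disjoint_left.1 h.disj hx' (h.right.mem_verts x hx).1⟩
  · rintro ⟨hx | hx, hx'⟩
    · exact absurd (h.left.mem_verts x hx).1 hx'
    · exact hx

lemma right_verts (h : IsCut U T e U₁ U₂ T₁ T₂) : U₂ = U \ U₁ := by
  rw [h.verts, Finset.union_sdiff_cancel_left h.disj]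

/-- Every edge other than `e` stays within `U₁` or within `U₂`, while `T₁'` connects all of `U₁'` to
`e.1`, which lies in `U₁`. -/
lemma left_subset (h : IsCut U T e U₁ U₂ T₁ T₂) (h' : IsCut U T e U₁' U₂' T₁' T₂') :
    U₁' ⊆ U₁ := by
  refine h'.left.subset_of_closed (U₁ : Set V) ?_ h'.fst_mem h.fst_mem
  intro x hx
  have hx' : x ∈ T₁ ∪ T₂ := by
    rw [h.union_edges, ← h'.union_edges]
    exact Finset.mem_union_left _ hx
  rcases Finset.mem_union.1 hx' with hx | hx
  · exact iff_of_true (h.left.mem_verts x hx).1 (h.left.mem_verts x hx).2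
  · exact iff_of_false
      (fun h₁ => Finset.disjoint_left.1 h.disj h₁ (h.right.mem_verts x hx).1)
      (fun h₁ => Finset.disjoint_left.1 h.disj h₁ (h.right.mem_verts x hx).2)

/-- Needed for the injectivity of cutting at the root edge in `edgeRootedSum_eq`. -/
lemma unique (h : IsCut U T e U₁ U₂ T₁ T₂) (h' : IsCut U T e U₁' U₂' T₁' T₂') :
    U₁ = U₁' ∧ T₁ = T₁' ∧ T₂ = T₂' := by
  have hU : U₁ = U₁' := (h'.left_subset h).antisymm (h.left_subset h')
  subst hU
  exact ⟨rfl, h.left_edges.trans h'.left_edges.symm, h.right_edges.trans h'.right_edges.symm⟩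

end IsCut

/-- Induction on the construction of the tree. If `e` lies in one of the two joined trees, that tree
is cut, and the other one stays attached to whichever piece contains the end of the joining edge. -/
lemma TreeOn.exists_cut {U : Finset V} {T : Finset (V × V)} (h : TreeOn U T) {e : V × V}
    (he : e ∈ T) : ∃ U₁ U₂ T₁ T₂, IsCut U T e U₁ U₂ T₁ T₂ := by
  induction h with
  | single v => simp at he
  | @join U₁ U₂ T₁ T₂ b w h₁ h₂ hd hb hw ih₁ ih₂ =>
    simp only [Finset.mem_insert, Finset.mem_union] at he
    rcases he with rfl | he | he
    · exact ⟨U₁, U₂, T₁, T₂, h₁, h₂, hd, hb, hw, rfl, rfl⟩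
    · obtain ⟨A, B, S, R, hc⟩ := ih₁ he
      have hb' := hb
      have hd' := hd
      rw [hc.verts, Finset.disjoint_union_left] at hd'
      rw [hc.verts, Finset.mem_union] at hb'
      rcases hb' with hbA | hbB
      · refine ⟨A ∪ U₂, B, insert (b, w) (S ∪ T₂), R, .join hc.left h₂ hd'.1 hbA hw, hc.right,
          ?_, Finset.mem_union_left _ hc.fst_mem, hc.snd_mem, ?_, ?_⟩
        · exact Finset.disjoint_union_left.2 ⟨hc.disj, hd'.2.symm⟩
        · rw [hc.verts]; ext; simp; tauto
        · rw [hc.edges]; ext; simp; tauto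
      · refine ⟨A, B ∪ U₂, S, insert (b, w) (R ∪ T₂), hc.left, .join hc.right h₂ hd'.2 hbB hw,
          ?_, hc.fst_mem, Finset.mem_union_left _ hc.snd_mem, ?_, ?_⟩
        · exact Finset.disjoint_union_right.2 ⟨hc.disj, hd'.1⟩
        · rw [hc.verts]; ext; simp
        · rw [hc.edges]; ext; simp; tauto
    · obtain ⟨A, B, S, R, hc⟩ := ih₂ he
      have hw' := hw
      have hd' := hd
      rw [hc.verts, Finset.disjoint_union_right] at hd'
      rw [hc.verts, Finset.mem_union] at hw'
      rcases hw' with hwA | hwB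
      · refine ⟨U₁ ∪ A, B, insert (b, w) (T₁ ∪ S), R, .join h₁ hc.left hd'.1 hb hwA, hc.right,
          ?_, Finset.mem_union_right _ hc.fst_mem, hc.snd_mem, ?_, ?_⟩
        · exact Finset.disjoint_union_left.2 ⟨hd'.2, hc.disj⟩
        · rw [hc.verts]; ext; simp
        · rw [hc.edges]; ext; simp; tauto
      · refine ⟨A, U₁ ∪ B, S, insert (b, w) (T₁ ∪ R), hc.left, .join h₁ hc.right hd'.2 hb hwB,
          ?_, hc.fst_mem, Finset.mem_union_right _ hc.snd_mem, ?_, ?_⟩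
        · exact Finset.disjoint_union_right.2 ⟨hd'.1.symm, hc.disj⟩
        · rw [hc.verts]; ext; simp; tauto
        · rw [hc.edges]; ext; simp; tauto

lemma TreeOn.card {U : Finset V} {T : Finset (V × V)} (h : TreeOn U T) : T.card + 1 = U.card := by
  induction h with
  | single v => simp
  | @join U₁ U₂ T₁ T₂ b w h₁ h₂ hd hb hw ih₁ ih₂ =>
    have hc : IsCut (U₁ ∪ U₂) (insert (b, w) (T₁ ∪ T₂)) (b, w) U₁ U₂ T₁ T₂ :=
      ⟨h₁, h₂, hd, hb, hw, rfl, rfl⟩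
    rw [Finset.card_insert_of_notMem hc.notMem, Finset.card_union_of_disjoint hc.disj_edges,
      Finset.card_union_of_disjoint hd]
    omega

/-! ## Flows on trees -/

/-- The net outflow at `v` of the flow `f` along the edges in `T`. -/
def netFlow (T : Finset (V × V)) (f : V × V → ℤ) (v : V) : ℤ :=
  ∑ e ∈ T, ((if e.1 = v then f e else 0) - if e.2 = v then f e else 0)

/-- There is a positive flow along the edges in `T` with net outflow `g` at the vertices in `U`. -/
def HasFlow (U : Finset V) (T : Finset (V × V)) (g : V → ℤ) : Prop :=
  ∃ f : V × V → ℤ, (∀ e ∈ T, 0 < f e) ∧ ∀ v ∈ U, netFlow T f v = g v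

lemma sum_netFlow {U : Finset V} {T : Finset (V × V)} (f : V × V → ℤ)
    (h : ∀ e ∈ T, e.1 ∈ U ∧ e.2 ∈ U) : ∑ v ∈ U, netFlow T f v = 0 := by
  unfold netFlow
  rw [Finset.sum_comm]
  refine Finset.sum_eq_zero fun e he => ?_
  rw [Finset.sum_sub_distrib, Finset.sum_ite_eq, Finset.sum_ite_eq, if_pos (h e he).1,
    if_pos (h e he).2, sub_self]

lemma netFlow_eq_zero {U : Finset V} {T : Finset (V × V)} (f : V × V → ℤ)
    (h : ∀ e ∈ T, e.1 ∈ U ∧ e.2 ∈ U) {v : V} (hv : v ∉ U) : netFlow T f v = 0 := by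
  refine Finset.sum_eq_zero fun e he => ?_
  rw [if_neg (fun h' : e.1 = v => hv (h' ▸ (h e he).1)),
    if_neg (fun h' : e.2 = v => hv (h' ▸ (h e he).2)), sub_self]

lemma netFlow_congr {T : Finset (V × V)} {f f' : V × V → ℤ} (h : ∀ e ∈ T, f e = f' e) (v : V) :
    netFlow T f v = netFlow T f' v :=
  Finset.sum_congr rfl fun e he => by rw [h e he]

namespace IsCut

variable {U U₁ U₂ : Finset V} {T T₁ T₂ : Finset (V × V)} {e : V × V}

lemma netFlow_eq (h : IsCut U T e U₁ U₂ T₁ T₂) (f : V × V → ℤ) (v : V) :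
    netFlow T f v = netFlow T₁ f v + netFlow T₂ f v +
      ((if e.1 = v then f e else 0) - if e.2 = v then f e else 0) := by
  unfold netFlow
  rw [h.edges, Finset.sum_insert h.notMem, Finset.sum_union h.disj_edges]
  ring

lemma netFlow_left (h : IsCut U T e U₁ U₂ T₁ T₂) (f : V × V → ℤ) {v : V} (hv : v ∈ U₁) :
    netFlow T f v = netFlow T₁ f v + if e.1 = v then f e else 0 := by
  have hv₂ := Finset.disjoint_left.1 h.disj hv
  rw [h.netFlow_eq, netFlow_eq_zero f h.right.mem_verts hv₂,
    if_neg fun h' : e.2 = v => hv₂ (h' ▸ h.snd_mem)]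
  ring

lemma netFlow_right (h : IsCut U T e U₁ U₂ T₁ T₂) (f : V × V → ℤ) {v : V} (hv : v ∈ U₂) :
    netFlow T f v = netFlow T₂ f v - if e.2 = v then f e else 0 := by
  have hv₁ := Finset.disjoint_right.1 h.disj hv
  rw [h.netFlow_eq, netFlow_eq_zero f h.left.mem_verts hv₁,
    if_neg fun h' : e.1 = v => hv₁ (h' ▸ h.fst_mem)]
  ring

/-- The edges within `U₁` cancel in the sum, and `e` is the only edge between the two sides. -/
lemma sum_netFlow_left (h : IsCut U T e U₁ U₂ T₁ T₂) (f : V × V → ℤ) :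
    ∑ v ∈ U₁, netFlow T f v = f e := by
  rw [Finset.sum_congr rfl fun v hv => h.netFlow_left f hv, Finset.sum_add_distrib,
    sum_netFlow f h.left.mem_verts, Finset.sum_ite_eq, if_pos h.fst_mem, zero_add]

/-- The flow through `e` is forced to be the total outflow of `U₁`. Removing `e` charges this amount
to its two ends; conversely, flows on the two sides are glued with this value on `e`. -/
lemma hasFlow_iff (h : IsCut U T e U₁ U₂ T₁ T₂) (g : V → ℤ) :
    HasFlow U T g ↔ 0 < ∑ v ∈ U₁, g v ∧
      HasFlow U₁ T₁ (fun v => g v - if e.1 = v then ∑ v ∈ U₁, g v else 0) ∧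
      HasFlow U₂ T₂ (fun v => g v + if e.2 = v then ∑ v ∈ U₁, g v else 0) := by
  have sub₁ : U₁ ⊆ U := h.verts ▸ Finset.subset_union_left
  have sub₂ : U₂ ⊆ U := h.verts ▸ Finset.subset_union_right
  have eT : e ∈ T := by rw [h.edges]; simp
  have tsub₁ : T₁ ⊆ T := by rw [h.edges]; intro; simp; tauto
  have tsub₂ : T₂ ⊆ T := by rw [h.edges]; intro; simp; tauto
  constructor
  · rintro ⟨f, hf, hg⟩
    have hm : ∑ v ∈ U₁, g v = f e := by
      rw [← h.sum_netFlow_left f]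
      exact Finset.sum_congr rfl fun v hv => (hg v (sub₁ hv)).symm
    rw [hm]
    refine ⟨hf e eT, ⟨f, fun x hx => hf x (tsub₁ hx), fun v hv => ?_⟩,
      ⟨f, fun x hx => hf x (tsub₂ hx), fun v hv => ?_⟩⟩
    · simp only [← hg v (sub₁ hv), h.netFlow_left f hv]; ring
    · simp only [← hg v (sub₂ hv), h.netFlow_right f hv]; ring
  · rintro ⟨hm, ⟨f₁, hf₁, hg₁⟩, ⟨f₂, hf₂, hg₂⟩⟩
    set m := ∑ v ∈ U₁, g v
    let f : V × V → ℤ := fun x => if x = e then m else if x ∈ T₁ then f₁ x else f₂ x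
    have c₁ : ∀ x ∈ T₁, f x = f₁ x := fun x hx => by
      have : x ≠ e := fun h' => h.notMem_left (h' ▸ hx)
      simp [f, this, hx]
    have c₂ : ∀ x ∈ T₂, f x = f₂ x := fun x hx => by
      have h₁ : x ≠ e := fun h' => h.notMem_right (h' ▸ hx)
      have h₂ : x ∉ T₁ := Finset.disjoint_right.1 h.disj_edges hx
      simp [f, h₁, h₂]
    have ce : f e = m := by simp [f]
    refine ⟨f, fun x hx => ?_, fun v hv => ?_⟩
    · rw [h.edges, Finset.mem_insert, Finset.mem_union] at hx
      rcases hx with rfl | hx | hx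
      · rw [ce]; exact hm
      · rw [c₁ x hx]; exact hf₁ x hx
      · rw [c₂ x hx]; exact hf₂ x hx
    · rw [h.verts, Finset.mem_union] at hv
      rcases hv with hv | hv
      · rw [h.netFlow_left f hv, netFlow_congr c₁, hg₁ v hv, ce]; ring
      · rw [h.netFlow_right f hv, netFlow_congr c₂, hg₂ v hv, ce]; ring

end IsCut

/-- A flow along a tree is determined by its net outflows. -/
lemma TreeOn.flow_eq_zero {U : Finset V} {T : Finset (V × V)} (h : TreeOn U T) {f : V × V → ℤ}
    (hf : ∀ v ∈ U, netFlow T f v = 0) : ∀ e ∈ T, f e = 0 := by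
  intro e he
  obtain ⟨U₁, U₂, T₁, T₂, hc⟩ := h.exists_cut he
  rw [← hc.sum_netFlow_left f]
  exact Finset.sum_eq_zero fun v hv => hf v (hc.verts ▸ Finset.mem_union_left _ hv)

/-- Consequently the edge weights carry no information beyond the tree and the weights of its
vertices. -/
lemma TreeOn.flow_unique {U : Finset V} {T : Finset (V × V)} (h : TreeOn U T) {f f' : V × V → ℤ}
    (hf : ∀ v ∈ U, netFlow T f v = netFlow T f' v) : ∀ e ∈ T, f e = f' e := by
  intro e he
  refine sub_eq_zero.1 (h.flow_eq_zero (f := fun e => f e - f' e) (fun v hv => ?_) e he)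
  rw [← sub_eq_zero.2 (hf v hv)]
  unfold netFlow
  rw [← Finset.sum_sub_distrib]
  refine Finset.sum_congr rfl fun e _ => ?_
  split_ifs <;> ring

end Trees

/-! ## Sums over rooted trees -/

section RootedTrees

variable {V : Type} [DecidableEq V]

/-- The number of edges in `T` at the vertex `v`. -/
def edgeDeg (T : Finset (V × V)) (v : V) : ℕ := (T.filter fun e => e.1 = v ∨ e.2 = v).card

/-- All edges of `T` go from vertices with positive to vertices with negative value of `s`. -/
def Colored (s : V → ℤ) (T : Finset (V × V)) : Prop := ∀ e ∈ T, 0 < s e.1 ∧ s e.2 < 0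

lemma HasFlow.congr {U : Finset V} {T : Finset (V × V)} {g g' : V → ℤ}
    (h : ∀ v ∈ U, g v = g' v) : HasFlow U T g ↔ HasFlow U T g' := by
  unfold HasFlow
  refine exists_congr fun f => and_congr_right fun _ => forall₂_congr fun v hv => ?_
  rw [h v hv]

lemma TreeOn.edgeDeg_pos {U : Finset V} {T : Finset (V × V)} (h : TreeOn U T) (hU : U.card ≠ 1)
    {r : V} (hr : r ∈ U) : 0 < edgeDeg T r := by
  by_contra h0
  have h1 : ∀ e ∈ T, ¬ (e.1 = r ∨ e.2 = r) := by
    have := Finset.card_eq_zero.1 (Nat.eq_zero_of_not_pos h0)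
    exact Finset.filter_eq_empty_iff.1 this
  refine hU (Finset.card_eq_one.2 ⟨r, Finset.eq_singleton_iff_unique_mem.2 ⟨hr, ?_⟩⟩)
  refine h.subset_of_closed {v | v = r} (fun e he => ?_) hr rfl
  have := h1 e he
  simp only [Set.mem_ofPred_eq]
  tauto

namespace IsCut

variable {U U₁ U₂ : Finset V} {T T₁ T₂ : Finset (V × V)} {e : V × V}

lemma edgeDeg_eq (h : IsCut U T e U₁ U₂ T₁ T₂) (v : V) :
    edgeDeg T v = edgeDeg T₁ v + edgeDeg T₂ v + if e.1 = v ∨ e.2 = v then 1 else 0 := by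
  unfold edgeDeg
  simp only [Finset.card_filter]
  rw [h.edges, Finset.sum_insert h.notMem, Finset.sum_union h.disj_edges]
  ring

lemma edgeDeg_left (h : IsCut U T e U₁ U₂ T₁ T₂) {v : V} (hv : v ∈ U₁) :
    edgeDeg T v = edgeDeg T₁ v + if e.1 = v then 1 else 0 := by
  have hv₂ := Finset.disjoint_left.1 h.disj hv
  have h0 : edgeDeg T₂ v = 0 := Finset.card_eq_zero.2 <| Finset.filter_eq_empty_iff.2 fun x hx => by
    rintro (rfl | rfl)
    · exact hv₂ (h.right.mem_verts x hx).1
    · exact hv₂ (h.right.mem_verts x hx).2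
  have h1 : e.2 ≠ v := fun h' => hv₂ (h' ▸ h.snd_mem)
  rw [h.edgeDeg_eq, h0]
  simp [h1]

lemma edgeDeg_right (h : IsCut U T e U₁ U₂ T₁ T₂) {v : V} (hv : v ∈ U₂) :
    edgeDeg T v = edgeDeg T₂ v + if e.2 = v then 1 else 0 := by
  have hv₁ := Finset.disjoint_right.1 h.disj hv
  have h0 : edgeDeg T₁ v = 0 := Finset.card_eq_zero.2 <| Finset.filter_eq_empty_iff.2 fun x hx => by
    rintro (rfl | rfl)
    · exact hv₁ (h.left.mem_verts x hx).1
    · exact hv₁ (h.left.mem_verts x hx).2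
  have h1 : e.1 ≠ v := fun h' => hv₁ (h' ▸ h.fst_mem)
  rw [h.edgeDeg_eq, h0]
  simp [h1]

/-- A removed edge marks a starting point in the cyclic order at each of its ends. So the (deg - 1)!
cyclic orders there become the linear orders of the remaining edges, whose number is the factorial
of the new degree. -/
lemma prod_factorial (h : IsCut U T e U₁ U₂ T₁ T₂) :
    ∏ v ∈ U, (edgeDeg T v - 1)! =
      ((edgeDeg T₁ e.1)! * ∏ v ∈ U₁.erase e.1, (edgeDeg T₁ v - 1)!) *
      ((edgeDeg T₂ e.2)! * ∏ v ∈ U₂.erase e.2, (edgeDeg T₂ v - 1)!) := by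
  rw [h.verts, Finset.prod_union h.disj, ← Finset.mul_prod_erase _ _ h.fst_mem,
    ← Finset.mul_prod_erase _ _ h.snd_mem, h.edgeDeg_left h.fst_mem, h.edgeDeg_right h.snd_mem,
    if_pos rfl, if_pos rfl, Nat.add_sub_cancel, Nat.add_sub_cancel]
  congr 2
  · refine Finset.prod_congr rfl fun v hv => ?_
    rw [Finset.mem_erase] at hv
    rw [h.edgeDeg_left hv.2, if_neg (Ne.symm hv.1), Nat.add_zero]
  · refine Finset.prod_congr rfl fun v hv => ?_
    rw [Finset.mem_erase] at hv
    rw [h.edgeDeg_right hv.2, if_neg (Ne.symm hv.1), Nat.add_zero]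

lemma colored_iff (h : IsCut U T e U₁ U₂ T₁ T₂) (s : V → ℤ) :
    Colored s T ↔ (0 < s e.1 ∧ s e.2 < 0) ∧ Colored s T₁ ∧ Colored s T₂ := by
  unfold Colored
  rw [h.edges, Finset.forall_mem_insert, Finset.forall_mem_union]

end IsCut

lemma TreeOn.eq_empty {v : V} {T : Finset (V × V)} (h : TreeOn {v} T) : T = ∅ := by
  have := h.card
  rw [Finset.card_singleton] at this
  exact Finset.card_eq_zero.1 (by omega)

/-- The color of the root is prescribed by the sign of the excess, so that an edge at the root
determines which of its ends the root is. -/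
lemma Colored.root_eq {s : V → ℤ} {T : Finset (V × V)} (hc : Colored s T) {e : V × V} (he : e ∈ T)
    {σ : ℤ} {r : V} (hr : 0 < s r * σ) (her : e.1 = r ∨ e.2 = r) :
    r = if 0 < σ then e.1 else e.2 := by
  have h := hc e he
  split_ifs with hσ
  · have : 0 < s r := pos_of_mul_pos_left hr hσ.le
    rcases her with rfl | rfl
    · rfl
    · omega
  · have : s r < 0 := neg_of_mul_pos_left hr (not_lt.1 hσ)
    rcases her with rfl | rfl
    · omega
    · rfl

variable [Fintype V]

open Classical in
/-- The pairs `(r, T)` of a tree `T` on `U` with positive edge weights and a root `r`, where the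
outflow is `s` except at the root. The root has the color that fits the sign of the excess. -/
noncomputable def plantedTrees (s : V → ℤ) (U : Finset V) : Finset (V × Finset (V × V)) :=
  Finset.univ.filter fun x => x.1 ∈ U ∧ 0 < s x.1 * ∑ v ∈ U, s v ∧ TreeOn U x.2 ∧ Colored s x.2 ∧
    HasFlow U x.2 fun v => s v - if x.1 = v then ∑ v ∈ U, s v else 0

/-- The number of planted plane trees: there are `deg!` orders at the root and
`(deg - 1)!` cyclic orders at the other vertices. -/
noncomputable def plantedSum (s : V → ℤ) (U : Finset V) : ℕ :=
  ∑ x ∈ plantedTrees s U, (edgeDeg x.2 x.1)! * ∏ v ∈ U.erase x.1, (edgeDeg x.2 v - 1)!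

open Classical in
/-- The pairs `(T, e)` of a tree `T` on `U` with positive edge weights and one of its edges `e`,
where the outflow is `s` except at the end of `e` that has the color that fits the sign of the
excess. -/
noncomputable def edgeRootedTrees (s : V → ℤ) (U : Finset V) : Finset (Finset (V × V) × (V × V)) :=
  Finset.univ.filter fun x => x.2 ∈ x.1 ∧ TreeOn U x.1 ∧ Colored s x.1 ∧
    HasFlow U x.1 fun v => s v - (if x.2.1 = v then max (∑ v ∈ U, s v) 0 else 0) -
      if x.2.2 = v then min (∑ v ∈ U, s v) 0 else 0

/-- The number of edge-rooted plane trees. -/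
noncomputable def edgeRootedSum (s : V → ℤ) (U : Finset V) : ℕ :=
  ∑ x ∈ edgeRootedTrees s U, ∏ v ∈ U, (edgeDeg x.1 v - 1)!

lemma mem_plantedTrees {s : V → ℤ} {U : Finset V} {x : V × Finset (V × V)} :
    x ∈ plantedTrees s U ↔ x.1 ∈ U ∧ 0 < s x.1 * ∑ v ∈ U, s v ∧ TreeOn U x.2 ∧ Colored s x.2 ∧
      HasFlow U x.2 fun v => s v - if x.1 = v then ∑ v ∈ U, s v else 0 := by
  simp [plantedTrees]

lemma mem_edgeRootedTrees {s : V → ℤ} {U : Finset V} {x : Finset (V × V) × (V × V)} :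
    x ∈ edgeRootedTrees s U ↔ x.2 ∈ x.1 ∧ TreeOn U x.1 ∧ Colored s x.1 ∧
      HasFlow U x.1 fun v => s v - (if x.2.1 = v then max (∑ v ∈ U, s v) 0 else 0) -
        if x.2.2 = v then min (∑ v ∈ U, s v) 0 else 0 := by
  simp [edgeRootedTrees]

/-- Let a and b be the sums of `s` over the two sides. The excess a + b is absorbed at the black end
of `e` if positive and at the white end if negative, so `e` carries a - max(a + b, 0) = min(a, -b).
This is positive exactly if a > 0 > b. What remains on the two sides is a pair of planted trees that
absorb a and b at their roots. -/
lemma IsCut.mem_edgeRootedTrees_iff {U U₁ U₂ : Finset V} {T T₁ T₂ : Finset (V × V)} {e : V × V}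
    (h : IsCut U T e U₁ U₂ T₁ T₂) (s : V → ℤ) :
    (T, e) ∈ edgeRootedTrees s U ↔ (0 < ∑ v ∈ U₁, s v ∧ ∑ v ∈ U₂, s v < 0) ∧
      (e.1, T₁) ∈ plantedTrees s U₁ ∧ (e.2, T₂) ∈ plantedTrees s U₂ := by
  have hσ : ∑ v ∈ U, s v = ∑ v ∈ U₁, s v + ∑ v ∈ U₂, s v := by
    rw [h.verts, Finset.sum_union h.disj]
  have e₂ : e.2 ∉ U₁ := Finset.disjoint_right.1 h.disj h.snd_mem
  have e₁ : e.1 ∉ U₂ := Finset.disjoint_left.1 h.disj h.fst_mem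
  have eT : e ∈ T := by rw [h.edges]; simp
  rw [mem_edgeRootedTrees, mem_plantedTrees, mem_plantedTrees, hσ, h.hasFlow_iff, h.colored_iff]
  simp only
  set a := ∑ v ∈ U₁, s v with ha
  set b := ∑ v ∈ U₂, s v with hb
  have hm : ∑ v ∈ U₁, ((s v - if e.1 = v then max (a + b) 0 else 0) -
      if e.2 = v then min (a + b) 0 else 0) = a - max (a + b) 0 := by
    rw [Finset.sum_sub_distrib, Finset.sum_sub_distrib, Finset.sum_ite_eq, Finset.sum_ite_eq,
      if_pos h.fst_mem, if_neg e₂, ← ha]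
    ring
  rw [hm]
  have f₁ : HasFlow U₁ T₁ (fun v => (s v - (if e.1 = v then max (a + b) 0 else 0) -
      if e.2 = v then min (a + b) 0 else 0) - if e.1 = v then a - max (a + b) 0 else 0) ↔
      HasFlow U₁ T₁ fun v => s v - if e.1 = v then a else 0 := by
    refine HasFlow.congr fun v hv => ?_
    rw [if_neg fun h' : e.2 = v => e₂ (h' ▸ hv)]
    split_ifs <;> ring
  have f₂ : HasFlow U₂ T₂ (fun v => (s v - (if e.1 = v then max (a + b) 0 else 0) -
      if e.2 = v then min (a + b) 0 else 0) + if e.2 = v then a - max (a + b) 0 else 0) ↔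
      HasFlow U₂ T₂ fun v => s v - if e.2 = v then b else 0 := by
    refine HasFlow.congr fun v hv => ?_
    rw [if_neg fun h' : e.1 = v => e₁ (h' ▸ hv)]
    split_ifs
    · omega
    · ring
  rw [f₁, f₂]
  constructor
  · rintro ⟨-, -, ⟨⟨c₁, c₂⟩, c₃, c₄⟩, hpos, g₁, g₂⟩
    have ha' : 0 < a := by omega
    have hb' : b < 0 := by omega
    exact ⟨⟨ha', hb'⟩, ⟨h.fst_mem, mul_pos c₁ ha', h.left, c₃, g₁⟩,
      h.snd_mem, mul_pos_of_neg_of_neg c₂ hb', h.right, c₄, g₂⟩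
  · rintro ⟨⟨ha', hb'⟩, ⟨-, c₁, -, c₃, g₁⟩, -, c₂, -, c₄, g₂⟩
    refine ⟨eT, h.treeOn, ⟨⟨pos_of_mul_pos_left c₁ ha'.le, ?_⟩, c₃, c₄⟩, by omega, g₁, g₂⟩
    exact neg_of_mul_pos_left c₂ hb'.le

/-- Removing the root edge of an edge-rooted tree yields two planted trees. -/
theorem edgeRootedSum_eq (s : V → ℤ) (U : Finset V) :
    edgeRootedSum s U = ∑ U₁ ∈ U.powerset, if 0 < ∑ v ∈ U₁, s v ∧ ∑ v ∈ U \ U₁, s v < 0 then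
      plantedSum s U₁ * plantedSum s (U \ U₁) else 0 := by
  rw [← Finset.sum_filter]
  unfold plantedSum
  simp only [Finset.sum_mul_sum, ← Finset.sum_product']
  rw [Finset.sum_sigma']
  symm
  have key : ∀ z : (_ : Finset V) × ((V × Finset (V × V)) × (V × Finset (V × V))),
      -- Joining the two roots by an edge yields a tree on `U`, and the given pair is its cut at
      -- that edge.
      z ∈ (U.powerset.filter fun U₁ => 0 < ∑ v ∈ U₁, s v ∧ ∑ v ∈ U \ U₁, s v < 0).sigma
        (fun U₁ => plantedTrees s U₁ ×ˢ plantedTrees s (U \ U₁)) →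
      IsCut U (insert (z.2.1.1, z.2.2.1) (z.2.1.2 ∪ z.2.2.2)) (z.2.1.1, z.2.2.1) z.1 (U \ z.1)
        z.2.1.2 z.2.2.2 := by
    intro z hz
    simp only [Finset.mem_sigma, Finset.mem_filter, Finset.mem_powerset, Finset.mem_product] at hz
    obtain ⟨⟨hU, -⟩, h₁, h₂⟩ := hz
    rw [mem_plantedTrees] at h₁ h₂
    exact ⟨h₁.2.2.1, h₂.2.2.1, Finset.disjoint_sdiff, h₁.1, h₂.1,
      (Finset.union_sdiff_of_subset hU).symm, rfl⟩
  refine Finset.sum_bij (fun z _ => (insert (z.2.1.1, z.2.2.1) (z.2.1.2 ∪ z.2.2.2),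
    (z.2.1.1, z.2.2.1))) ?_ ?_ ?_ ?_
  · intro z hz
    refine ((key z hz).mem_edgeRootedTrees_iff s).2 ?_
    simp only [Finset.mem_sigma, Finset.mem_filter, Finset.mem_product] at hz
    exact ⟨hz.1.2, hz.2⟩
  · rintro ⟨A, ⟨r₁, S₁⟩, ⟨r₂, S₂⟩⟩ hz ⟨B, ⟨r₁', S₁'⟩, ⟨r₂', S₂'⟩⟩ hz' heq
    have c := key _ hz
    have c' := key _ hz'
    simp only [Prod.mk.injEq] at heq c c'
    obtain ⟨hT, rfl, rfl⟩ := heq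
    rw [← hT] at c'
    obtain ⟨rfl, rfl, rfl⟩ := c.unique c'
    rfl
  · rintro ⟨T, e⟩ hx
    obtain ⟨he, hT, -⟩ := mem_edgeRootedTrees.1 hx
    obtain ⟨U₁, U₂, T₁, T₂, hc⟩ := hT.exists_cut he
    obtain ⟨h₁, h₂⟩ := (hc.mem_edgeRootedTrees_iff s).1 hx
    rw [hc.right_verts] at h₁ h₂
    refine ⟨⟨U₁, (e.1, T₁), (e.2, T₂)⟩, ?_, ?_⟩
    · simp only [Finset.mem_sigma, Finset.mem_filter, Finset.mem_product, Finset.mem_powerset]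
      exact ⟨⟨hc.verts ▸ Finset.subset_union_left, h₁⟩, h₂⟩
    · exact Prod.ext hc.edges.symm rfl
  · intro z hz
    exact ((key z hz).prod_factorial).symm

lemma plantedSum_singleton {s : V → ℤ} {v : V} (hv : s v ≠ 0) : plantedSum s {v} = 1 := by
  have : plantedTrees s {v} = {(v, ∅)} := by
    ext ⟨r, T⟩
    rw [mem_plantedTrees]
    simp only [Finset.mem_singleton, Prod.mk.injEq, Finset.sum_singleton]
    constructor
    · exact fun h => ⟨h.1, h.2.2.1.eq_empty⟩
    · rintro ⟨rfl, rfl⟩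
      refine ⟨rfl, mul_self_pos.2 hv, .single _, by simp [Colored], 0, by simp, ?_⟩
      simp [netFlow]
  rw [plantedSum, this]
  simp [edgeDeg]

lemma edgeRootedSum_singleton (s : V → ℤ) (v : V) : edgeRootedSum s {v} = 0 := by
  refine Finset.sum_eq_zero fun x hx => ?_
  obtain ⟨he, hT, -⟩ := mem_edgeRootedTrees.1 hx
  rw [hT.eq_empty] at he
  simp at he

/-- For a nonzero excess, a planted tree is a vertex or has a distinguished edge at the root. -/
theorem plantedSum_eq {s : V → ℤ} (hs : ∀ v, s v ≠ 0) {U : Finset V} (hU : ∑ v ∈ U, s v ≠ 0) :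
    plantedSum s U = (if U.card = 1 then 1 else 0) + edgeRootedSum s U := by
  by_cases h1 : U.card = 1
  · obtain ⟨v, rfl⟩ := Finset.card_eq_one.1 h1
    rw [plantedSum_singleton (hs v), edgeRootedSum_singleton, if_pos h1]
  rw [if_neg h1, zero_add]
  -- deg! = deg · (deg - 1)!: a linear order at the root is a cyclic order with a distinguished
  -- first edge.
  have step : plantedSum s U = ∑ x ∈ plantedTrees s U,
      ∑ _e ∈ x.2.filter (fun e => e.1 = x.1 ∨ e.2 = x.1), ∏ v ∈ U, (edgeDeg x.2 v - 1)! := by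
    refine Finset.sum_congr rfl fun x hx => ?_
    obtain ⟨hr, -, hT, -⟩ := mem_plantedTrees.1 hx
    rw [Finset.sum_const, ← Finset.mul_prod_erase _ _ hr, smul_eq_mul, ← mul_assoc]
    congr 1
    exact (Nat.mul_factorial_pred (hT.edgeDeg_pos h1 hr).ne').symm
  rw [step, Finset.sum_sigma']
  -- Only one of the `max` and `min` terms is nonzero; which one depends on the sign of the excess.
  have demand : ∀ (T : Finset (V × V)) (e : V × V),
      HasFlow U T (fun v => s v - (if e.1 = v then max (∑ v ∈ U, s v) 0 else 0) -
        if e.2 = v then min (∑ v ∈ U, s v) 0 else 0) ↔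
      HasFlow U T (fun v => s v - if (if 0 < ∑ v ∈ U, s v then e.1 else e.2) = v then
        ∑ v ∈ U, s v else 0) := by
    intro T e
    refine HasFlow.congr fun v _ => ?_
    rcases lt_or_gt_of_ne hU with h | h
    · rw [if_neg h.not_gt, max_eq_right h.le, min_eq_left h.le, ite_self]
      ring
    · rw [if_pos h, max_eq_left h.le, min_eq_right h.le, ite_self]
      ring
  refine Finset.sum_bij (fun z _ => (z.1.2, z.2)) ?_ ?_ ?_ ?_
  · rintro ⟨⟨r, T⟩, e⟩ hz
    simp only [Finset.mem_sigma, Finset.mem_filter] at hz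
    obtain ⟨hx, he, her⟩ := hz
    obtain ⟨hr, hpos, hT, hc, hf⟩ := mem_plantedTrees.1 hx
    rw [mem_edgeRootedTrees]
    refine ⟨he, hT, hc, (demand _ _).2 ?_⟩
    rw [← hc.root_eq he hpos her]
    exact hf
  · rintro ⟨⟨r, T⟩, e⟩ hz ⟨⟨r', T'⟩, e'⟩ hz' heq
    simp only [Finset.mem_sigma, Finset.mem_filter, Prod.mk.injEq] at hz hz' heq
    obtain ⟨rfl, rfl⟩ := heq
    obtain ⟨hx, he, her⟩ := hz
    obtain ⟨hx', he', her'⟩ := hz'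
    obtain ⟨-, hpos, -, hc, -⟩ := mem_plantedTrees.1 hx
    obtain ⟨-, hpos', -, hc', -⟩ := mem_plantedTrees.1 hx'
    obtain rfl := (hc.root_eq he hpos her).trans (hc'.root_eq he' hpos' her').symm
    rfl
  · rintro ⟨T, e⟩ hx
    obtain ⟨he, hT, hc, hf⟩ := mem_edgeRootedTrees.1 hx
    refine ⟨⟨(if 0 < ∑ v ∈ U, s v then e.1 else e.2, T), e⟩, ?_, rfl⟩
    simp only [Finset.mem_sigma, Finset.mem_filter]
    refine ⟨mem_plantedTrees.2 ⟨?_, ?_, hT, hc, (demand _ _).1 hf⟩, he, ?_⟩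
    · split_ifs
      exacts [(hT.mem_verts e he).1, (hT.mem_verts e he).2]
    · have := hc e he
      rcases lt_or_gt_of_ne hU with h | h
      · simp only [if_neg h.not_gt]
        exact mul_pos_of_neg_of_neg this.2 h
      · simp only [if_pos h]
        exact mul_pos this.1 h
    · split_ifs <;> simp
  · intro z _
    rfl

/-- The number of edge-rooted plane trees, or one for a single vertex. -/
noncomputable def rootedSum (s : V → ℤ) (U : Finset V) : ℚ :=
  (if U.card = 1 then 1 else 0) + edgeRootedSum s U

/-- Both factors on the right have nonzero excess, so by `plantedSum_eq` the planted sums in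
`edgeRootedSum_eq` can be replaced by rooted sums. This closes the recursion. -/
theorem rootedSum_eq {s : V → ℤ} (hs : ∀ v, s v ≠ 0) (U : Finset V) :
    rootedSum s U = (if U.card = 1 then 1 else 0) +
      ∑ U₁ ∈ U.powerset, if 0 < ∑ v ∈ U₁, s v ∧ ∑ v ∈ U \ U₁, s v < 0 then
        rootedSum s U₁ * rootedSum s (U \ U₁) else 0 := by
  rw [rootedSum, edgeRootedSum_eq]
  congr 1
  push_cast
  refine Finset.sum_congr rfl fun U₁ _ => ?_
  split_ifs with h
  · rw [rootedSum, rootedSum, plantedSum_eq hs h.1.ne', plantedSum_eq hs h.2.ne]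
    push_cast
    rfl
  · rfl

open Classical in
/-- The sum over all trees with positive edge weights and outflow `s` of the number of plane
embeddings. -/
noncomputable def planeTreeSum (s : V → ℤ) : ℕ :=
  ∑ T : Finset (V × V) with TreeOn Finset.univ T ∧ Colored s T ∧ HasFlow Finset.univ T s,
    ∏ v, (edgeDeg T v - 1)!

/-- Without excess no end of the root edge absorbs anything, so each of the |V| - 1 edges of a tree
can be the root edge. -/
theorem edgeRootedSum_univ {s : V → ℤ} (hs : ∑ v, s v = 0) :
    edgeRootedSum s Finset.univ = (Fintype.card V - 1) * planeTreeSum s := by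
  classical
  have h : edgeRootedSum s Finset.univ = ∑ z ∈ (Finset.univ.filter fun T : Finset (V × V) =>
      TreeOn Finset.univ T ∧ Colored s T ∧ HasFlow Finset.univ T s).sigma (fun T => T),
      ∏ v, (edgeDeg z.1 v - 1)! := by
    refine Finset.sum_bij' (fun x _ => ⟨x.1, x.2⟩) (fun z _ => (z.1, z.2)) ?_ ?_ ?_ ?_ ?_
    · intro x hx
      rw [mem_edgeRootedTrees, hs] at hx
      simpa [and_assoc, and_comm, and_left_comm] using hx
    · intro z hz
      rw [mem_edgeRootedTrees, hs]
      simpa [and_assoc, and_comm, and_left_comm] using hz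
    · intros; rfl
    · intros; rfl
    · intros; rfl
  rw [h, Finset.sum_sigma, planeTreeSum, Finset.mul_sum]
  refine Finset.sum_congr (by congr) fun T hT => ?_
  have hT := (Finset.mem_filter.1 hT).2.1.card
  simp only [Finset.sum_const, smul_eq_mul]
  rw [← Finset.card_univ, ← hT, Nat.add_sub_cancel]

end RootedTrees

/-! ## A Wiener-Hopf factorization and Lagrange inversion -/

section WienerHopf

open PowerSeries LaurentPolynomial

variable {R : Type} [CommRing R]

/-- All exponents of the Laurent variable that occur in `F` lie in `S`. -/
def LaurentSupportedIn (S : Set ℤ) (F : R[T;T⁻¹]⟦X⟧) : Prop :=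
  ∀ n c, c ∉ S → (coeff n F).coeff c = 0

/-- The part of degree zero in the Laurent variable. -/
noncomputable def zeroPart (F : R[T;T⁻¹]⟦X⟧) : R⟦X⟧ := PowerSeries.mk fun n => (coeff n F).coeff 0

lemma coeff_zeroPart (n : ℕ) (F : R[T;T⁻¹]⟦X⟧) : coeff n (zeroPart F) = (coeff n F).coeff 0 :=
  coeff_mk _ _

lemma zeroPart_add (F G : R[T;T⁻¹]⟦X⟧) : zeroPart (F + G) = zeroPart F + zeroPart G := by
  ext n
  simp [coeff_zeroPart]

lemma zeroPart_sub (F G : R[T;T⁻¹]⟦X⟧) : zeroPart (F - G) = zeroPart F - zeroPart G := by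
  ext n
  simp [coeff_zeroPart]

lemma zeroPart_sum {ι : Type} (s : Finset ι) (F : ι → R[T;T⁻¹]⟦X⟧) :
    zeroPart (∑ i ∈ s, F i) = ∑ i ∈ s, zeroPart (F i) := by
  classical
  induction s using Finset.induction_on with
  | empty => ext; simp [coeff_zeroPart]
  | insert a s ha ih => rw [Finset.sum_insert ha, Finset.sum_insert ha, zeroPart_add, ih]

lemma LaurentPolynomial.coeff_zero_C_mul (r : R) (f : R[T;T⁻¹]) :
    (LaurentPolynomial.C r * f).coeff 0 = r * f.coeff 0 := by
  rw [← single_eq_C]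
  simp [-single_eq_C_mul_T]

lemma zeroPart_map_mul (y : R⟦X⟧) (F : R[T;T⁻¹]⟦X⟧) :
    zeroPart (PowerSeries.map LaurentPolynomial.C y * F) = y * zeroPart F := by
  ext n
  rw [coeff_zeroPart, PowerSeries.coeff_mul, PowerSeries.coeff_mul]
  simp only [PowerSeries.coeff_map, coeff_zeroPart, ← LaurentPolynomial.coeff_zero_C_mul]
  simp [Finsupp.finsetSum_apply]

lemma zeroPart_C_mul_map (f : R[T;T⁻¹]) (y : R⟦X⟧) :
    zeroPart (PowerSeries.C f * PowerSeries.map LaurentPolynomial.C y) =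
      PowerSeries.C (f.coeff 0) * y := by
  ext n
  rw [coeff_zeroPart, PowerSeries.coeff_C_mul, PowerSeries.coeff_C_mul, PowerSeries.coeff_map,
    mul_comm, LaurentPolynomial.coeff_zero_C_mul, mul_comm]

lemma LaurentSupportedIn.zeroPart_eq {S : Set ℤ} (hS : (0 : ℤ) ∉ S) {F : R[T;T⁻¹]⟦X⟧}
    (h : LaurentSupportedIn S F) : zeroPart F = 0 := by
  ext n
  rw [coeff_zeroPart, h n 0 hS, map_zero]

lemma LaurentPolynomial.coeff_mul_eq_zero {S S' : Set ℤ} {f g : R[T;T⁻¹]}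
    (hf : ∀ c, c ∉ S → f.coeff c = 0) (hg : ∀ c, c ∉ S' → g.coeff c = 0) {c : ℤ}
    (hc : ∀ a ∈ S, ∀ b ∈ S', a + b ≠ c) : (f * g).coeff c = 0 := by
  classical
  by_contra h
  have h1 := AddMonoidAlgebra.support_coeff_mul_subset f g (Finsupp.mem_support_iff.2 h)
  obtain ⟨a, ha, b, hb, hab⟩ := Finset.mem_add.1 h1
  refine hc a ?_ b ?_ hab
  · by_contra h2
    exact Finsupp.mem_support_iff.1 ha (hf a h2)
  · by_contra h2
    exact Finsupp.mem_support_iff.1 hb (hg b h2)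

lemma LaurentSupportedIn.mul {S S' S'' : Set ℤ} {F G : R[T;T⁻¹]⟦X⟧}
    (hF : LaurentSupportedIn S F) (hG : LaurentSupportedIn S' G)
    (h : ∀ a ∈ S, ∀ b ∈ S', a + b ∈ S'') : LaurentSupportedIn S'' (F * G) := by
  intro n c hc
  rw [PowerSeries.coeff_mul, AddMonoidAlgebra.coeff_sum, Finsupp.finsetSum_apply]
  refine Finset.sum_eq_zero fun x _ => LaurentPolynomial.coeff_mul_eq_zero (hF x.1) (hG x.2) ?_
  exact fun a ha b hb hab => hc (hab ▸ h a ha b hb)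

lemma LaurentSupportedIn.derivative {S : Set ℤ} {F : R[T;T⁻¹]⟦X⟧} (hF : LaurentSupportedIn S F) :
    LaurentSupportedIn S (d⁄dX _ F) := by
  intro n c hc
  have h := hF (n + 1) c hc
  rw [PowerSeries.coeff_derivative]
  have h2 : ((n : R[T;T⁻¹]) + 1) = LaurentPolynomial.C ((n : R) + 1) := by simp
  rw [h2, mul_comm]
  refine LaurentPolynomial.coeff_mul_eq_zero (S := {0}) (S' := S) ?_ (hF (n + 1)) ?_
  · intro c hc
    rw [LaurentPolynomial.C_apply, if_neg (by simpa using hc)]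
  · rintro a rfl b hb rfl
    exact hc (by simpa using hb)

/-- The inverse of `1 - F` is supported in the monoid `S` if `F` is. -/
lemma LaurentSupportedIn.inv {S : AddSubmonoid ℤ} {F K : R[T;T⁻¹]⟦X⟧}
    (hF : LaurentSupportedIn S F) (h0 : constantCoeff F = 0) (hK : K * (1 - F) = 1) :
    LaurentSupportedIn S K := by
  have hK' : K = 1 + K * F := by linear_combination hK
  intro n
  induction n using Nat.strong_induction_on with
  | _ n ih =>
    intro c hc
    rw [hK', map_add, PowerSeries.coeff_mul, AddMonoidAlgebra.coeff_add, Finsupp.add_apply,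
      AddMonoidAlgebra.coeff_sum, Finsupp.finsetSum_apply, Finset.sum_eq_zero, add_zero,
      PowerSeries.coeff_one]
    · split_ifs
      · rw [← map_one LaurentPolynomial.C, LaurentPolynomial.C_apply, if_neg]
        rintro rfl
        exact hc S.zero_mem
      · simp
    · rintro ⟨a, b⟩ hab
      rw [Finset.HasAntidiagonal.mem_antidiagonal] at hab
      simp only at hab ⊢
      rcases Nat.eq_zero_or_pos b with rfl | hb
      · rw [PowerSeries.coeff_zero_eq_constantCoeff_apply, h0, mul_zero]
        simp
      · refine LaurentPolynomial.coeff_mul_eq_zero (ih a (by omega)) (hF b) ?_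
        exact fun x hx y hy hxy => hc (hxy ▸ S.add_mem hx hy)

/-- The logarithmic derivative of `1 - F` and similar series have no part of degree zero if the
Laurent variable only occurs with positive exponents. -/
lemma zeroPart_mul_inv_of_pos {F G K : R[T;T⁻¹]⟦X⟧} (hF : LaurentSupportedIn (Set.Ioi 0) F)
    (h0 : constantCoeff F = 0) (hK : K * (1 - F) = 1) (hG : LaurentSupportedIn (Set.Ioi 0) G) :
    zeroPart (G * K) = 0 := by
  have hK' : LaurentSupportedIn (AddSubmonoid.nonneg ℤ : Set ℤ) K := by
    refine LaurentSupportedIn.inv (fun n c hc => hF n c fun h => hc ?_) h0 hK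
    exact (Set.mem_Ioi.1 h).le
  refine (hG.mul hK' (S'' := Set.Ioi 0) fun a ha b hb => ?_).zeroPart_eq (by simp)
  exact add_pos_of_pos_of_nonneg (Set.mem_Ioi.1 ha) (AddSubmonoid.mem_nonneg.1 hb)

lemma zeroPart_mul_inv_of_neg {F G K : R[T;T⁻¹]⟦X⟧} (hF : LaurentSupportedIn (Set.Iio 0) F)
    (h0 : constantCoeff F = 0) (hK : K * (1 - F) = 1) (hG : LaurentSupportedIn (Set.Iio 0) G) :
    zeroPart (G * K) = 0 := by
  let N : AddSubmonoid ℤ := ⟨⟨Set.Iic 0, fun {a b} ha hb => Set.mem_Iic.2 (add_nonpos (Set.mem_Iic.1 ha) (Set.mem_Iic.1 hb))⟩, by simp⟩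
  have hK' : LaurentSupportedIn (N : Set ℤ) K := by
    refine LaurentSupportedIn.inv (fun n c hc => hF n c fun h => hc ?_) h0 hK
    exact (Set.mem_Iio.1 h).le
  refine (hG.mul hK' (S'' := Set.Iio 0) fun a ha b hb => ?_).zeroPart_eq (by simp)
  exact add_neg_of_neg_of_nonpos (Set.mem_Iio.1 ha) (Set.mem_Iic.1 hb)

lemma PowerSeries.exists_inv_of_constantCoeff_eq_one {A : Type} [CommRing A] {F : A⟦X⟧}
    (h : constantCoeff F = 1) : ∃ K, K * F = 1 :=
  ⟨invOfUnit F 1, invOfUnit_mul F 1 h⟩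

/-- If `Y - X η` and its first order deformation factor into a part with positive and a part with
negative exponents, then the parts of degree zero are determined by `(Y - X η)⁻¹`. -/
theorem zeroPart_of_factorization {η ζ : R[T;T⁻¹]} {p₀ n₀ p₁ n₁ K : R[T;T⁻¹]⟦X⟧} {z₀ z₁ : R⟦X⟧}
    (hp₀ : LaurentSupportedIn (Set.Ioi 0) p₀) (hn₀ : LaurentSupportedIn (Set.Iio 0) n₀)
    (hp₁ : LaurentSupportedIn (Set.Ioi 0) p₁) (hn₁ : LaurentSupportedIn (Set.Iio 0) n₁)
    (cp₀ : constantCoeff p₀ = 0) (cn₀ : constantCoeff n₀ = 0)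
    (h₀ : p₀ + PowerSeries.map LaurentPolynomial.C z₀ + n₀ = X * PowerSeries.C η + p₀ * n₀)
    (h₁ : p₁ + PowerSeries.map LaurentPolynomial.C z₁ + n₁ =
      PowerSeries.C ζ + p₁ * n₀ + p₀ * n₁)
    (hK : K * (PowerSeries.map LaurentPolynomial.C (1 + z₀) - X * PowerSeries.C η) = 1) :
    (1 + z₀ - X * d⁄dX R z₀) * zeroPart K = 1 ∧
      z₁ = (1 + z₀ - X * d⁄dX R z₀) * zeroPart (PowerSeries.C ζ * K) := by
  obtain ⟨Kp, hKp⟩ : ∃ Kp, Kp * (1 - p₀) = 1 :=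
    exists_inv_of_constantCoeff_eq_one (by rw [map_sub, map_one, cp₀, sub_zero])
  obtain ⟨Kn, hKn⟩ : ∃ Kn, Kn * (1 - n₀) = 1 :=
    exists_inv_of_constantCoeff_eq_one (by rw [map_sub, map_one, cn₀, sub_zero])
  rw [map_add, map_one] at hK
  set Z₀ := PowerSeries.map (LaurentPolynomial.C (R := R)) z₀ with hZ₀
  set Z₁ := PowerSeries.map (LaurentPolynomial.C (R := R)) z₁ with hZ₁
  -- The Wiener-Hopf factorization.
  have hfac : 1 + Z₀ - X * PowerSeries.C η = (1 - p₀) * (1 - n₀) := by linear_combination h₀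
  have hKeq : K = Kp * Kn := by
    rw [hfac] at hK
    linear_combination (-K * Kn * (1 - n₀)) * hKp + (-K) * hKn + (Kp * Kn) * hK
  -- The deformed equation says z₁ - ζ = -p₁ (1 - n₀) - n₁ (1 - p₀). Multiplication by K cancels one
  -- factor in each summand and leaves a series with positive and a series with negative exponents
  -- only.
  have e₁ : zeroPart ((Z₁ - PowerSeries.C ζ) * K) = 0 := by
    have : (Z₁ - PowerSeries.C ζ) * K = (0 - p₁ * Kp) - n₁ * Kn := by
      rw [hKeq]
      linear_combination (Kp * Kn) * h₁ - p₁ * Kp * hKn - n₁ * Kn * hKp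
    rw [this, zeroPart_sub, zeroPart_sub, zeroPart_mul_inv_of_pos hp₀ cp₀ hKp hp₁,
      zeroPart_mul_inv_of_neg hn₀ cn₀ hKn hn₁]
    ext
    simp [coeff_zeroPart]
  have hd : d⁄dX _ Z₀ - PowerSeries.C η = - d⁄dX _ p₀ * (1 - n₀) - (1 - p₀) * d⁄dX _ n₀ := by
    have := congrArg (d⁄dX R[T;T⁻¹]) hfac
    simp only [map_sub, map_add, Derivation.leibniz, derivative_X, derivative_C,
      Derivation.map_one_eq_zero, smul_eq_mul] at this
    linear_combination this
  -- The same argument for the derivative of the factorization with respect to X.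
  have e₂ : zeroPart ((d⁄dX _ Z₀ - PowerSeries.C η) * K) = 0 := by
    have : (d⁄dX _ Z₀ - PowerSeries.C η) * K = (0 - d⁄dX _ p₀ * Kp) - d⁄dX _ n₀ * Kn := by
      rw [hd, hKeq]
      linear_combination -(d⁄dX _ p₀) * Kp * hKn - (d⁄dX _ n₀) * Kn * hKp
    rw [this, zeroPart_sub, zeroPart_sub, zeroPart_mul_inv_of_pos hp₀ cp₀ hKp hp₀.derivative,
      zeroPart_mul_inv_of_neg hn₀ cn₀ hKn hn₀.derivative]
    ext
    simp [coeff_zeroPart]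
  have hdZ : d⁄dX _ Z₀ = PowerSeries.map LaurentPolynomial.C (d⁄dX R z₀) := by
    ext1 n
    simp [hZ₀, PowerSeries.coeff_derivative]
  -- Since (1 + z₀ - X η) K = 1, exchanging X η for X z₀' changes the product by X (z₀' - η) K,
  -- whose part of degree zero vanishes by `e₂`.
  have e₃ : (1 + z₀ - X * d⁄dX R z₀) * zeroPart K = 1 := by
    have h3 : PowerSeries.map LaurentPolynomial.C (1 + z₀ - X * d⁄dX R z₀) * K =
        1 - PowerSeries.map LaurentPolynomial.C X * ((d⁄dX _ Z₀ - PowerSeries.C η) * K) := by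
      rw [map_sub, map_add, map_one, map_mul, ← hdZ, ← hZ₀, PowerSeries.map_X]
      linear_combination hK
    rw [← zeroPart_map_mul, h3, zeroPart_sub, zeroPart_map_mul, e₂, mul_zero, sub_zero]
    ext n
    rw [coeff_zeroPart, PowerSeries.coeff_one, PowerSeries.coeff_one]
    split_ifs
    · rw [← map_one LaurentPolynomial.C, LaurentPolynomial.C_apply, if_pos rfl]
    · simp
  refine ⟨e₃, ?_⟩
  rw [sub_mul, zeroPart_sub, hZ₁, zeroPart_map_mul, sub_eq_zero] at e₁
  rw [← e₁, mul_left_comm, e₃, mul_one]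

/-- Finite form of K = V / (1 - V E). For E divisible by X the remainder does not affect the
coefficients below X^m. -/
lemma eq_geom_sum_of_mul_sub_eq_one {A : Type} [CommRing A] {K V Y E : A} (hV : V * Y = 1)
    (hK : K * (Y - E) = 1) (m : ℕ) :
    K = ∑ j ∈ Finset.range m, (V * E) ^ j * V + (V * E) ^ m * K := by
  have hK1 : K = V + V * E * K := by linear_combination V * hK - K * hV
  induction m with
  | zero => simp
  | succ m ih =>
    rw [Finset.sum_range_succ]
    linear_combination ih + (V * E) ^ m * hK1

lemma mul_geom_sum_rearrange {A : Type} [CommRing A] {K V x η ζ : A} {m : ℕ}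
    (h : K = ∑ j ∈ Finset.range m, (V * (x * η)) ^ j * V + (V * (x * η)) ^ m * K) :
    ζ * K = ∑ j ∈ Finset.range m, ζ * η ^ j * (x ^ j * V ^ (j + 1)) +
      x ^ m * V ^ m * (ζ * η ^ m * K) := by
  conv_lhs => rw [h]
  rw [mul_add, Finset.mul_sum]
  congr 1
  · exact Finset.sum_congr rfl fun j _ => by ring
  · ring

/-- Expand K as ∑ v^(j+1) X^j η^j. The coefficients in X have degree zero in T, so that taking parts
of degree zero only affects ζ η^j; the remainder is a multiple of X^(N+1). -/
lemma coeff_mul_zeroPart_inv {η ζ : R[T;T⁻¹]} {K : R[T;T⁻¹]⟦X⟧} {Y v D : R⟦X⟧}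
    (hv : v * Y = 1)
    (hK : K * (PowerSeries.map LaurentPolynomial.C Y - X * PowerSeries.C η) = 1) (n N : ℕ) :
    coeff N (v ^ n * (D * zeroPart (PowerSeries.C ζ * K))) =
      ∑ j ∈ Finset.range (N + 1), (ζ * η ^ j).coeff 0 * coeff (N - j) (v ^ (n + j) * (D * v)) := by
  set V := PowerSeries.map (LaurentPolynomial.C (R := R)) v with hV
  have hVY : V * PowerSeries.map LaurentPolynomial.C Y = 1 := by
    rw [hV, ← map_mul, hv, map_one]
  have hexp := eq_geom_sum_of_mul_sub_eq_one hVY hK (N + 1)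
  have hz : zeroPart (PowerSeries.C ζ * K) =
      ∑ j ∈ Finset.range (N + 1), PowerSeries.C ((ζ * η ^ j).coeff 0) * (X ^ j * v ^ (j + 1)) +
      X ^ (N + 1) * (v ^ (N + 1) * zeroPart (PowerSeries.C (ζ * η ^ (N + 1)) * K)) := by
    have h1 : PowerSeries.C ζ * K = ∑ j ∈ Finset.range (N + 1), PowerSeries.C (ζ * η ^ j) *
        PowerSeries.map LaurentPolynomial.C (X ^ j * v ^ (j + 1)) +
        PowerSeries.map LaurentPolynomial.C (X ^ (N + 1) * v ^ (N + 1)) *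
          (PowerSeries.C (ζ * η ^ (N + 1)) * K) := by
      simp only [map_mul, map_pow, PowerSeries.map_X, ← hV]
      exact mul_geom_sum_rearrange hexp
    rw [h1, zeroPart_add, zeroPart_sum, zeroPart_map_mul, mul_assoc]
    exact congrArg (· + _) (Finset.sum_congr rfl fun j _ => zeroPart_C_mul_map _ _)
  rw [hz, mul_add, mul_add, map_add, Finset.mul_sum, Finset.mul_sum, map_sum]
  have hrem : coeff N (v ^ n * (D * (X ^ (N + 1) *
      (v ^ (N + 1) * zeroPart (PowerSeries.C (ζ * η ^ (N + 1)) * K))))) = 0 := by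
    rw [show ∀ a : R⟦X⟧, v ^ n * (D * (X ^ (N + 1) * a)) = X ^ (N + 1) * (v ^ n * (D * a)) from
      fun a => by ring, PowerSeries.coeff_X_pow_mul', if_neg (by omega)]
  rw [hrem, add_zero]
  refine Finset.sum_congr rfl fun j hj => ?_
  rw [show v ^ n * (D * (PowerSeries.C ((ζ * η ^ j).coeff 0) * (X ^ j * v ^ (j + 1)))) =
    PowerSeries.C ((ζ * η ^ j).coeff 0) * (X ^ j * (v ^ (n + j) * (D * v))) by ring,
    PowerSeries.coeff_C_mul, PowerSeries.coeff_X_pow_mul', if_pos]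
  have := Finset.mem_range.1 hj
  omega

/-- The coefficients in Lagrange inversion satisfy a recursion. -/
lemma coeff_inv_pow_mul {Y v : R⟦X⟧} (hv : v * Y = 1) {n N : ℕ} (hn : n ≤ N) :
    (n : R) * coeff (N - n) (v ^ n * ((Y - X * d⁄dX R Y) * v)) = N * coeff (N - n) (v ^ n) := by
  have hd : d⁄dX R Y * v = - (Y * d⁄dX R v) := by
    have := congrArg (d⁄dX R) hv
    simp only [Derivation.leibniz, Derivation.map_one_eq_zero, smul_eq_mul] at this
    linear_combination this
  -- From Y v = 1 one has (Y - X Y') v = 1 + X Y v', and n v^n Y v' = n v^(n-1) v' = (v^n)'.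
  have h1 : PowerSeries.C (n : R) * (v ^ n * ((Y - X * d⁄dX R Y) * v)) =
      PowerSeries.C (n : R) * v ^ n + X * d⁄dX R (v ^ n) := by
    rcases n with _ | n
    · simp
    · rw [PowerSeries.derivative_pow, map_natCast, Nat.add_sub_cancel]
      linear_combination ((n + 1 : ℕ) : R⟦X⟧) * v ^ (n + 1) * hv +
        ((n + 1 : ℕ) : R⟦X⟧) * (-v ^ (n + 1) * X) * hd +
        ((n + 1 : ℕ) : R⟦X⟧) * (v ^ n * X * d⁄dX R v) * hv
  rw [← PowerSeries.coeff_C_mul, h1, map_add, PowerSeries.coeff_C_mul]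
  obtain ⟨k, rfl⟩ := Nat.exists_eq_add_of_le hn
  rw [Nat.add_sub_cancel_left]
  have h2 : coeff k (X * d⁄dX R (v ^ n)) = k * coeff k (v ^ n) := by
    rcases k with _ | k
    · simp
    · rw [PowerSeries.coeff_succ_X_mul, PowerSeries.coeff_derivative]
      push_cast
      ring
  rw [h2]
  push_cast
  ring

/-- The coefficient of `X ^ N` of the part `z₁` of degree zero is the sum of the `(ζ * η ^ n)₀ H n`,
where the numbers `H n` are determined by a recursion in terms of the `(η ^ j)₀`. -/
theorem exists_lagrange_coeffs {η ζ : R[T;T⁻¹]} {p₀ n₀ p₁ n₁ : R[T;T⁻¹]⟦X⟧} {z₀ z₁ : R⟦X⟧}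
    (hp₀ : LaurentSupportedIn (Set.Ioi 0) p₀) (hn₀ : LaurentSupportedIn (Set.Iio 0) n₀)
    (hp₁ : LaurentSupportedIn (Set.Ioi 0) p₁) (hn₁ : LaurentSupportedIn (Set.Iio 0) n₁)
    (cp₀ : constantCoeff p₀ = 0) (cn₀ : constantCoeff n₀ = 0) (cz₀ : constantCoeff z₀ = 0)
    (h₀ : p₀ + PowerSeries.map LaurentPolynomial.C z₀ + n₀ = X * PowerSeries.C η + p₀ * n₀)
    (h₁ : p₁ + PowerSeries.map LaurentPolynomial.C z₁ + n₁ =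
      PowerSeries.C ζ + p₁ * n₀ + p₀ * n₁) (N : ℕ) :
    ∃ H : ℕ → R, H N = 1 ∧
      (∀ n ≤ N, (n : R) * H n =
        N * ∑ j ∈ Finset.range (N - n + 1), (η ^ j).coeff 0 * H (n + j)) ∧
      coeff N z₁ = ∑ n ∈ Finset.range (N + 1), (ζ * η ^ n).coeff 0 * H n := by
  obtain ⟨v, hv⟩ : ∃ v, v * (1 + z₀) = 1 :=
    exists_inv_of_constantCoeff_eq_one (by rw [map_add, map_one, cz₀, add_zero])
  obtain ⟨K, hK⟩ : ∃ K, K * (PowerSeries.map LaurentPolynomial.C (1 + z₀) -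
      X * PowerSeries.C η) = 1 := by
    refine exists_inv_of_constantCoeff_eq_one ?_
    rw [← PowerSeries.coeff_zero_eq_constantCoeff_apply, map_sub, PowerSeries.coeff_map,
      PowerSeries.coeff_zero_eq_constantCoeff_apply, PowerSeries.coeff_zero_X_mul, map_add,
      cz₀, map_one, add_zero, map_one, sub_zero]
  obtain ⟨hz, hz₁⟩ := zeroPart_of_factorization hp₀ hn₀ hp₁ hn₁ cp₀ cn₀ h₀ h₁ hK
  set D := 1 + z₀ - X * d⁄dX R z₀ with hD
  have hD' : D = (1 + z₀) - X * d⁄dX R (1 + z₀) := by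
    rw [hD, map_add, Derivation.map_one_eq_zero, zero_add]
  have cv : constantCoeff v = 1 := by
    have := congrArg constantCoeff hv
    rwa [map_mul, map_add, map_one, cz₀, add_zero, mul_one] at this
  -- With D = Y - X Y', the number H n is the coefficient that multiplies (ζ η^n)₀ in the expansion
  -- of D · (ζ K)₀ = z₁.
  refine ⟨fun n => coeff (N - n) (v ^ n * (D * v)), ?_, fun n hn => ?_, ?_⟩
  · simp only [Nat.sub_self, PowerSeries.coeff_zero_eq_constantCoeff_apply]
    simp [hD, cv, cz₀]
  · simp only
    rw [hD', coeff_inv_pow_mul hv hn, ← hD']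
    congr 1
    -- For ζ = 1 the factor D · K₀ is 1, so the expansion computes the coefficients of v^n itself;
    -- `coeff_inv_pow_mul` relates these to H n.
    have := coeff_mul_zeroPart_inv (ζ := 1) (D := D) hv hK n (N - n)
    rw [map_one, one_mul, hz, mul_one] at this
    rw [this]
    refine Finset.sum_congr rfl fun j _ => ?_
    rw [one_mul, Nat.sub_sub]
  · have := coeff_mul_zeroPart_inv (ζ := ζ) (D := D) hv hK 0 N
    rw [pow_zero, one_mul, ← hz₁] at this
    rw [this]
    simp only [zero_add]

end WienerHopf

/-! ## Generating series of functions of finite sets -/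

section SetSeries

open PowerSeries LaurentPolynomial

variable {V : Type} {R : Type} [CommRing R]

/-- The generating series of a function `F` of the subsets `U` of `V₀`. The variable `X` marks the
cardinality and `T` the weight `h + ∑ v ∈ U, s v`. -/
noncomputable def setSeries (x : V → R) (s : V → ℤ) (V₀ : Finset V) (h : ℤ) (F : Finset V → R) :
    R[T;T⁻¹]⟦X⟧ :=
  ∑ U ∈ V₀.powerset,
    monomial U.card (LaurentPolynomial.C (F U * ∏ v ∈ U, x v) * T (h + ∑ v ∈ U, s v))

variable {x : V → R} {s : V → ℤ} {V₀ : Finset V} {h h' : ℤ}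

lemma setSeries_congr {F G : Finset V → R} (hFG : ∀ U ⊆ V₀, F U = G U) :
    setSeries x s V₀ h F = setSeries x s V₀ h G :=
  Finset.sum_congr rfl fun U hU => by rw [hFG U (Finset.mem_powerset.1 hU)]

lemma setSeries_add (F G : Finset V → R) :
    setSeries x s V₀ h F + setSeries x s V₀ h G = setSeries x s V₀ h fun U => F U + G U := by
  unfold setSeries
  rw [← Finset.sum_add_distrib]
  refine Finset.sum_congr rfl fun U _ => ?_
  rw [add_mul, map_add, add_mul, map_add]

lemma LaurentPolynomial.coeff_C_mul_T (r : R) (n c : ℤ) :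
    (LaurentPolynomial.C r * T n).coeff c = if n = c then r else 0 := by
  rw [← single_eq_C_mul_T, AddMonoidAlgebra.coeff_single, Finsupp.single_apply]

lemma coeff_setSeries (F : Finset V → R) (n : ℕ) (c : ℤ) :
    (coeff n (setSeries x s V₀ h F)).coeff c = ∑ U ∈ V₀.powerset,
      if U.card = n ∧ h + ∑ v ∈ U, s v = c then F U * ∏ v ∈ U, x v else 0 := by
  rw [setSeries, map_sum, AddMonoidAlgebra.coeff_sum, Finsupp.finsetSum_apply]
  refine Finset.sum_congr rfl fun U _ => ?_
  rw [PowerSeries.coeff_monomial]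
  by_cases hn : U.card = n
  · rw [if_pos hn.symm, LaurentPolynomial.coeff_C_mul_T]
    simp [hn]
  · rw [if_neg (Ne.symm hn), if_neg fun h' => hn h'.1]
    simp

lemma LaurentSupportedIn.setSeries {S : Set ℤ} {F : Finset V → R}
    (hF : ∀ U, h + ∑ v ∈ U, s v ∉ S → F U = 0) :
    LaurentSupportedIn S (setSeries x s V₀ h F) := by
  intro n c hc
  rw [coeff_setSeries]
  refine Finset.sum_eq_zero fun U _ => ?_
  split_ifs with hU
  · rw [hF U (hU.2 ▸ hc), zero_mul]
  · rfl

lemma LaurentSupportedIn.eq_map {F : R[T;T⁻¹]⟦X⟧} (hF : LaurentSupportedIn {0} F) :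
    F = PowerSeries.map LaurentPolynomial.C (zeroPart F) := by
  ext n c
  rw [PowerSeries.coeff_map, LaurentPolynomial.C_apply, coeff_zeroPart]
  split_ifs with hc
  · rw [hc]
  · exact hF n c (by simpa using hc)

lemma constantCoeff_setSeries {F : Finset V → R} (hF : F ∅ = 0) :
    constantCoeff (setSeries x s V₀ h F) = 0 := by
  rw [← PowerSeries.coeff_zero_eq_constantCoeff_apply]
  ext c
  rw [coeff_setSeries]
  refine Finset.sum_eq_zero fun U _ => ?_
  split_ifs with hU
  · rw [Finset.card_eq_zero.1 hU.1, hF, zero_mul]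
  · rfl

lemma setSeries_card_eq_one : setSeries x s V₀ 0 (fun U => if U.card = 1 then 1 else 0) =
    X * PowerSeries.C (∑ v ∈ V₀, LaurentPolynomial.C (x v) * T (s v)) := by
  unfold setSeries
  have h1 : ∀ U ∈ V₀.powerset, monomial U.card (LaurentPolynomial.C
      ((if U.card = 1 then 1 else 0) * ∏ v ∈ U, x v) * T (0 + ∑ v ∈ U, s v)) =
      if U.card = 1 then monomial 1 (LaurentPolynomial.C (∏ v ∈ U, x v) * T (∑ v ∈ U, s v))
        else (0 : R[T;T⁻¹]⟦X⟧) := by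
    intro U _
    split_ifs with hU
    · rw [hU, one_mul, zero_add]
    · rw [zero_mul, map_zero, zero_mul, map_zero]
  rw [Finset.sum_congr rfl h1, ← Finset.sum_filter, map_sum, Finset.mul_sum]
  symm
  refine Finset.sum_bij (fun v _ => {v}) ?_ ?_ ?_ ?_
  · intro v hv
    simpa using hv
  · intro v _ w _ hvw
    exact Finset.singleton_injective hvw
  · intro U hU
    simp only [Finset.mem_filter, Finset.mem_powerset] at hU
    obtain ⟨v, rfl⟩ := Finset.card_eq_one.1 hU.2
    exact ⟨v, by simpa using hU.1, rfl⟩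
  · intro v _
    rw [Finset.prod_singleton, Finset.sum_singleton, PowerSeries.X_eq,
      ← PowerSeries.monomial_zero_eq_C_apply, PowerSeries.monomial_mul_monomial, one_mul]

lemma setSeries_trichotomy (F : Finset V → R) :
    setSeries x s V₀ h (fun U => if 0 < h + ∑ v ∈ U, s v then F U else 0) +
      setSeries x s V₀ h (fun U => if h + ∑ v ∈ U, s v = 0 then F U else 0) +
      setSeries x s V₀ h (fun U => if h + ∑ v ∈ U, s v < 0 then F U else 0) =
    setSeries x s V₀ h F := by
  rw [setSeries_add, setSeries_add]
  refine setSeries_congr fun U _ => ?_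
  rcases lt_trichotomy (h + ∑ v ∈ U, s v) 0 with hU | hU | hU
  · simp [hU, hU.not_gt, hU.ne]
  · simp [hU]
  · simp [hU, hU.not_gt, hU.ne']

variable [DecidableEq V]

lemma prod_mul_prod_eq_zero (hx : ∀ v, x v * x v = 0) {U₁ U₂ : Finset V} (h : ¬ Disjoint U₁ U₂) :
    (∏ v ∈ U₁, x v) * ∏ v ∈ U₂, x v = 0 := by
  obtain ⟨v, h₁, h₂⟩ := Finset.not_disjoint_iff.1 h
  rw [← Finset.mul_prod_erase _ _ h₁, ← Finset.mul_prod_erase _ _ h₂]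
  linear_combination (∏ v ∈ U₁.erase v, x v) * (∏ v ∈ U₂.erase v, x v) * hx v

/-- Because the `x v` have square zero, pairs of sets that overlap contribute nothing. What is left
is the sum over ordered decompositions into two disjoint sets. -/
lemma setSeries_mul (hx : ∀ v, x v * x v = 0) (F G : Finset V → R) :
    setSeries x s V₀ h F * setSeries x s V₀ h' G = setSeries x s V₀ (h + h')
      fun U => ∑ U₁ ∈ U.powerset, F U₁ * G (U \ U₁) := by
  unfold setSeries
  rw [Finset.sum_mul_sum, ← Finset.sum_product']
  have hR : ∀ U ∈ V₀.powerset,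
      monomial U.card (LaurentPolynomial.C ((∑ U₁ ∈ U.powerset, F U₁ * G (U \ U₁)) *
        ∏ v ∈ U, x v) * T (h + h' + ∑ v ∈ U, s v)) =
      ∑ U₁ ∈ U.powerset, monomial U.card (LaurentPolynomial.C (F U₁ * G (U \ U₁) *
        ∏ v ∈ U, x v) * T (h + h' + ∑ v ∈ U, s v)) := by
    intro U _
    rw [Finset.sum_mul, map_sum, Finset.sum_mul, map_sum]
  rw [Finset.sum_congr rfl hR, Finset.sum_sigma']
  rw [← Finset.sum_filter_of_ne (p := fun y : Finset V × Finset V => Disjoint y.1 y.2)]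
  · refine Finset.sum_bij' (fun y _ => ⟨y.1 ∪ y.2, y.1⟩) (fun z _ => (z.2, z.1 \ z.2)) ?_ ?_ ?_ ?_ ?_
    · intro y hy
      simp only [Finset.mem_filter, Finset.mem_product, Finset.mem_powerset] at hy
      simp only [Finset.mem_sigma, Finset.mem_powerset]
      exact ⟨Finset.union_subset hy.1.1 hy.1.2, Finset.subset_union_left⟩
    · intro z hz
      simp only [Finset.mem_sigma, Finset.mem_powerset] at hz
      simp only [Finset.mem_filter, Finset.mem_product, Finset.mem_powerset]
      exact ⟨⟨hz.2.trans hz.1, Finset.sdiff_subset.trans hz.1⟩, Finset.disjoint_sdiff⟩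
    · intro y hy
      simp only [Finset.mem_filter] at hy
      exact Prod.ext rfl (Finset.union_sdiff_cancel_left hy.2)
    · rintro ⟨U, U₁⟩ hz
      simp only [Finset.mem_sigma, Finset.mem_powerset] at hz
      simp [Finset.union_sdiff_of_subset hz.2]
    · intro y hy
      have hd := (Finset.mem_filter.1 hy).2
      rw [PowerSeries.monomial_mul_monomial]
      simp only
      rw [Finset.card_union_of_disjoint hd, Finset.union_sdiff_cancel_left hd,
        Finset.prod_union hd, Finset.sum_union hd,
        show h + h' + (∑ v ∈ y.1, s v + ∑ v ∈ y.2, s v) =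
          (h + ∑ v ∈ y.1, s v) + (h' + ∑ v ∈ y.2, s v) by ring,
        T_add (h + ∑ v ∈ y.1, s v)]
      congr 1
      simp only [map_mul]
      ring
  · intro y _ hne
    by_contra hd
    refine hne ?_
    rw [PowerSeries.monomial_mul_monomial, mul_mul_mul_comm, ← map_mul, mul_mul_mul_comm (F y.1),
      prod_mul_prod_eq_zero hx hd, mul_zero, map_zero, zero_mul, map_zero]

lemma setSeries_eq_empty : setSeries x s V₀ h (fun U => if U = ∅ then 1 else 0) =
    PowerSeries.C (T h) := by
  unfold setSeries
  rw [Finset.sum_eq_single_of_mem ∅ (Finset.empty_mem_powerset _)]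
  · simp
  · intro U _ hU
    simp only [if_neg hU]
    rw [zero_mul, map_zero, zero_mul, map_zero]

/-- Solution of the recursion for set functions that comes from cutting trees at an edge. The
function `A₁` counts the trees that contain an additional vertex of weight `h`. -/
theorem exists_lagrange_coeffs_of_recursion (hx : ∀ v, x v * x v = 0) {A₀ A₁ : Finset V → R}
    (hA₀ : ∀ U ⊆ V₀, A₀ U = (if U.card = 1 then 1 else 0) + ∑ U₁ ∈ U.powerset,
      if 0 < ∑ v ∈ U₁, s v ∧ ∑ v ∈ U \ U₁, s v < 0 then A₀ U₁ * A₀ (U \ U₁) else 0)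
    (hA₁ : ∀ U ⊆ V₀, A₁ U = (if U = ∅ then 1 else 0) +
      (∑ U₁ ∈ U.powerset,
        if 0 < h + ∑ v ∈ U₁, s v ∧ ∑ v ∈ U \ U₁, s v < 0 then A₁ U₁ * A₀ (U \ U₁) else 0) +
      ∑ U₁ ∈ U.powerset,
        if 0 < ∑ v ∈ U₁, s v ∧ h + ∑ v ∈ U \ U₁, s v < 0 then A₀ U₁ * A₁ (U \ U₁) else 0)
    (hV₀ : h + ∑ v ∈ V₀, s v = 0) :
    ∃ H : ℕ → R, H V₀.card = 1 ∧
      (∀ n ≤ V₀.card, (n : R) * H n = V₀.card * ∑ j ∈ Finset.range (V₀.card - n + 1),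
        ((∑ v ∈ V₀, LaurentPolynomial.C (x v) * T (s v)) ^ j).coeff 0 * H (n + j)) ∧
      A₁ V₀ * ∏ v ∈ V₀, x v = ∑ n ∈ Finset.range (V₀.card + 1),
        (T h * (∑ v ∈ V₀, LaurentPolynomial.C (x v) * T (s v)) ^ n).coeff 0 * H n := by
  -- `A₀` and `A₁` are split by the sign of the total weight; the conditions in the recursions then
  -- become the products p₀ n₀, p₁ n₀ and p₀ n₁.
  set p₀ := setSeries x s V₀ 0 (fun U => if 0 < 0 + ∑ v ∈ U, s v then A₀ U else 0) with hp₀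
  set z₀ := setSeries x s V₀ 0 (fun U => if 0 + ∑ v ∈ U, s v = 0 then A₀ U else 0) with hz₀
  set n₀ := setSeries x s V₀ 0 (fun U => if 0 + ∑ v ∈ U, s v < 0 then A₀ U else 0) with hn₀
  set p₁ := setSeries x s V₀ h (fun U => if 0 < h + ∑ v ∈ U, s v then A₁ U else 0) with hp₁
  set z₁ := setSeries x s V₀ h (fun U => if h + ∑ v ∈ U, s v = 0 then A₁ U else 0) with hz₁
  set n₁ := setSeries x s V₀ h (fun U => if h + ∑ v ∈ U, s v < 0 then A₁ U else 0) with hn₁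
  have sz₀ : z₀ = PowerSeries.map LaurentPolynomial.C (zeroPart z₀) :=
    (LaurentSupportedIn.setSeries fun U hU => if_neg hU).eq_map
  have sz₁ : z₁ = PowerSeries.map LaurentPolynomial.C (zeroPart z₁) :=
    (LaurentSupportedIn.setSeries fun U hU => if_neg hU).eq_map
  have h₀ : p₀ + PowerSeries.map LaurentPolynomial.C (zeroPart z₀) + n₀ =
      X * PowerSeries.C (∑ v ∈ V₀, LaurentPolynomial.C (x v) * T (s v)) + p₀ * n₀ := by
    rw [← sz₀, setSeries_trichotomy, ← setSeries_card_eq_one, setSeries_mul hx, add_zero,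
      setSeries_add]
    refine setSeries_congr fun U hU => ?_
    rw [hA₀ U hU]
    simp only [zero_add, ite_zero_mul_ite_zero]
  have h₁ : p₁ + PowerSeries.map LaurentPolynomial.C (zeroPart z₁) + n₁ =
      PowerSeries.C (T h) + p₁ * n₀ + p₀ * n₁ := by
    rw [← sz₁, setSeries_trichotomy, ← setSeries_eq_empty (x := x) (s := s) (V₀ := V₀),
      setSeries_mul hx, setSeries_mul hx, add_zero, zero_add, setSeries_add, setSeries_add]
    refine setSeries_congr fun U hU => ?_
    rw [hA₁ U hU]
    simp only [zero_add, ite_zero_mul_ite_zero]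
  have hA₀' : A₀ ∅ = 0 := by
    rw [hA₀ ∅ (Finset.empty_subset _)]
    simp
  obtain ⟨H, hH, hrec, hsum⟩ := exists_lagrange_coeffs
    (LaurentSupportedIn.setSeries fun U hU => if_neg hU)
    (LaurentSupportedIn.setSeries fun U hU => if_neg hU)
    (LaurentSupportedIn.setSeries fun U hU => if_neg hU)
    (LaurentSupportedIn.setSeries fun U hU => if_neg hU)
    (constantCoeff_setSeries (by simp)) (constantCoeff_setSeries (by simp))
    (by
      rw [← PowerSeries.coeff_zero_eq_constantCoeff_apply, coeff_zeroPart,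
        PowerSeries.coeff_zero_eq_constantCoeff_apply, constantCoeff_setSeries (by simp [hA₀'])]
      rfl) h₀ h₁ V₀.card
  refine ⟨H, hH, hrec, ?_⟩
  -- `V₀` is its only subset of full cardinality, so the coefficient of the top power of X isolates
  -- it.
  rw [← hsum, coeff_zeroPart, hz₁, coeff_setSeries,
    Finset.sum_eq_single_of_mem V₀ (Finset.mem_powerset_self _)]
  · rw [if_pos ⟨rfl, hV₀⟩, if_pos hV₀]
  · intro U hU hne
    rw [if_neg]
    rintro ⟨hc, -⟩
    exact hne (Finset.eq_of_subset_of_card_le (Finset.mem_powerset.1 hU) hc.ge)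

end SetSeries

/-! ## Evaluation of the sum over edge-rooted trees -/

section Evaluation

open LaurentPolynomial

/-- A ring generated by elements of square zero that have no other relations. -/
lemma exists_squareZero_generators (V : Type) :
    ∃ (R : Type) (_ : CommRing R) (_ : Algebra ℚ R) (x : V → R), (∀ v, x v * x v = 0) ∧
      ∀ (S : Finset V) (c : ℚ), algebraMap ℚ R c * ∏ v ∈ S, x v = 0 → c = 0 := by
  classical
  -- The ideal generated by the squares of the variables. As a monomial ideal it contains a monomial
  -- only if some exponent is at least two, so squarefree monomials survive in the quotient.
  let J : Ideal (MvPolynomial V ℚ) := Ideal.span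
    ((fun m => MvPolynomial.monomial m (1 : ℚ)) '' Set.range fun v : V => Finsupp.single v 2)
  refine ⟨MvPolynomial V ℚ ⧸ J, inferInstance, inferInstance,
    fun v => Ideal.Quotient.mk J (MvPolynomial.X v), fun v => ?_, fun S c h => ?_⟩
  · rw [← map_mul, Ideal.Quotient.eq_zero_iff_mem]
    refine Ideal.subset_span ⟨_, ⟨v, rfl⟩, ?_⟩
    simp only [MvPolynomial.X, MvPolynomial.monomial_mul, mul_one]
    rw [← Finsupp.single_add]
  · rw [← map_prod] at h
    have h1 : Ideal.Quotient.mk J (MvPolynomial.monomial (∑ v ∈ S, Finsupp.single v 1) c) = 0 := by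
      rw [← h, ← mul_one c, ← MvPolynomial.C_mul_monomial, map_mul, mul_one,
        MvPolynomial.monomial_sum_one]
      rfl
    rw [Ideal.Quotient.eq_zero_iff_mem, MvPolynomial.mem_ideal_span_monomial_image] at h1
    by_contra hc
    obtain ⟨_, ⟨v, rfl⟩, hv⟩ := h1 (∑ v ∈ S, Finsupp.single v 1) (by
      rw [MvPolynomial.mem_support_iff, MvPolynomial.coeff_monomial, if_pos rfl]
      exact hc)
    have h2 := hv v
    rw [Finsupp.single_eq_same, Finsupp.finsetSum_apply] at h2
    have h3 : ∑ w ∈ S, (Finsupp.single w 1 : V →₀ ℕ) v ≤ 1 := by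
      simp only [Finsupp.single_apply, Finset.sum_ite_eq']
      split_ifs <;> omega
    omega

/-- If a² = 0, then (a + b)^(n+1) = b^(n+1) + (n + 1) a b^n. The vanishing of the next power is what
removes the first summand in the induction. -/
lemma sum_pow_card_succ_eq_zero {V R : Type} [CommRing R] {x : V → R} (hx : ∀ v, x v * x v = 0)
    (S : Finset V) :
    (∑ v ∈ S, x v) ^ (S.card + 1) = 0 ∧ (∑ v ∈ S, x v) ^ S.card = S.card ! * ∏ v ∈ S, x v := by
  classical
  have expand : ∀ (a b : R) (n : ℕ), a * a = 0 → (a + b) ^ (n + 1) =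
      b ^ (n + 1) + (n + 1) * a * b ^ n := by
    intro a b n ha
    induction n with
    | zero => simp; ring
    | succ n ih =>
      rw [pow_succ, ih]
      push_cast
      linear_combination (n + 1) * b ^ n * ha
  induction S using Finset.induction_on with
  | empty => simp
  | insert a S ha ih =>
    rw [Finset.card_insert_of_notMem ha, Finset.sum_insert ha, Finset.prod_insert ha,
      expand _ _ _ (hx a), expand _ _ _ (hx a), pow_succ, ih.1, ih.2, Nat.factorial_succ]
    push_cast
    constructor <;> ring

lemma coeff_zero_T_mul_add_pow {R : Type} [CommRing R] (β ω : R) (a b h : ℤ) (n : ℕ) :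
    (T h * (LaurentPolynomial.C β * T a + LaurentPolynomial.C ω * T b) ^ n).coeff 0 =
      ∑ x ∈ Finset.HasAntidiagonal.antidiagonal n,
        if h + x.1 * a + x.2 * b = 0 then (n.choose x.1 : R) * (β ^ x.1 * ω ^ x.2) else 0 := by
  have h1 : T h * (LaurentPolynomial.C β * T a + LaurentPolynomial.C ω * T b) ^ n =
      ∑ x ∈ Finset.HasAntidiagonal.antidiagonal n,
        LaurentPolynomial.C ((n.choose x.1 : R) * (β ^ x.1 * ω ^ x.2)) *
          T (h + x.1 * a + x.2 * b) := by
    rw [(Commute.all _ _).add_pow', Finset.mul_sum]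
    refine Finset.sum_congr rfl fun x _ => ?_
    rw [T_add, T_add, ← T_pow, ← T_pow]
    simp only [map_mul, map_pow, map_natCast, nsmul_eq_mul]
    ring
  rw [h1, AddMonoidAlgebra.coeff_sum, Finsupp.finsetSum_apply]
  exact Finset.sum_congr rfl fun x _ => LaurentPolynomial.coeff_C_mul_T _ _ _

lemma sum_range_mul_eq {A : Type} [AddCommMonoid A] {m : ℕ} (hm : 0 < m) (j : ℕ) (F : ℕ → A)
    (hF : ∀ l, ¬ m ∣ l → F l = 0) :
    ∑ l ∈ Finset.range (j * m + 1), F l = ∑ i ∈ Finset.range (j + 1), F (i * m) := by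
  symm
  refine Finset.sum_of_injOn (fun i => i * m) ?_ ?_ ?_ ?_
  · intro a _ b _ hab
    exact Nat.eq_of_mul_eq_mul_right hm hab
  · intro i hi
    simp only [Finset.coe_range, Set.mem_Iio] at hi ⊢
    have := Nat.mul_le_mul_right m (Nat.lt_succ_iff.1 hi)
    omega
  · intro l hl hl'
    refine hF l ?_
    rintro ⟨i, rfl⟩
    refine hl' ⟨i, ?_, mul_comm _ _⟩
    simp only [Finset.coe_range, Set.mem_Iio, Finset.mem_range] at hl ⊢
    by_contra h
    have := Nat.mul_le_mul_right m (not_lt.1 h)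
    rw [mul_comm m i, add_mul] at *
    omega
  · intros; rfl

lemma mul_eq_mul_iff_of_coprime {g p' q' : ℕ} (hg : 0 < g) (hco : p'.Coprime q') (hp : 0 < p')
    {i k : ℕ} : g * q' * i = g * p' * k ↔ ∃ j, i = j * p' ∧ k = j * q' := by
  constructor
  · intro h
    rw [mul_assoc, mul_assoc] at h
    have h := Nat.eq_of_mul_eq_mul_left hg h
    obtain ⟨j, rfl⟩ : p' ∣ i := hco.dvd_of_dvd_mul_left ⟨k, h⟩
    refine ⟨j, mul_comm _ _, Nat.eq_of_mul_eq_mul_left hp ?_⟩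
    rw [← h]
    ring
  · rintro ⟨j, rfl, rfl⟩
    ring

variable {R : Type} [CommRing R] {β ω : R} {g p' q' : ℕ}

/-- By coprimality, i factors of weight g q' and k of weight -g p' balance only if (i, k) is a
multiple of (p', q'). Hence a single term of the binomial expansion has degree zero. -/
lemma coeff_zero_add_pow (hg : 0 < g) (hco : p'.Coprime q') (hp : 0 < p') (j : ℕ) :
    ((LaurentPolynomial.C β * T ((g * q' : ℕ) : ℤ) +
      LaurentPolynomial.C ω * T (-((g * p' : ℕ) : ℤ))) ^ (j * (p' + q'))).coeff 0 =
      ((j * (p' + q')).choose (j * p') : R) * (β ^ p' * ω ^ q') ^ j := by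
  have h := coeff_zero_T_mul_add_pow β ω ((g * q' : ℕ) : ℤ) (-((g * p' : ℕ) : ℤ)) 0
    (j * (p' + q'))
  rw [T_zero, one_mul] at h
  rw [h, Finset.sum_eq_single_of_mem (j * p', j * q')]
  · rw [if_pos]
    · rw [mul_pow, ← pow_mul, ← pow_mul, mul_comm p', mul_comm q']
    · push_cast; ring
  · rw [Finset.HasAntidiagonal.mem_antidiagonal]; ring
  · rintro ⟨i, k⟩ hik hne
    rw [Finset.HasAntidiagonal.mem_antidiagonal] at hik
    refine if_neg fun h0 => hne ?_
    simp only at hik h0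
    have h1 : g * q' * i = g * p' * k := by zify; push_cast at h0; linarith
    obtain ⟨j', rfl, rfl⟩ := (mul_eq_mul_iff_of_coprime hg hco hp).1 h1
    have : j' = j := by
      rw [← mul_add] at hik
      exact Nat.eq_of_mul_eq_mul_right (by omega) hik
    rw [this]

lemma coeff_zero_add_pow_of_not_dvd (hg : 0 < g) (hco : p'.Coprime q') (hp : 0 < p') {l : ℕ}
    (hl : ¬ p' + q' ∣ l) :
    ((LaurentPolynomial.C β * T ((g * q' : ℕ) : ℤ) +
      LaurentPolynomial.C ω * T (-((g * p' : ℕ) : ℤ))) ^ l).coeff 0 = 0 := by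
  have h := coeff_zero_T_mul_add_pow β ω ((g * q' : ℕ) : ℤ) (-((g * p' : ℕ) : ℤ)) 0 l
  rw [T_zero, one_mul] at h
  rw [h]
  refine Finset.sum_eq_zero fun x hx => if_neg fun h0 => hl ?_
  rw [Finset.HasAntidiagonal.mem_antidiagonal] at hx
  have h1 : g * q' * x.1 = g * p' * x.2 := by zify; push_cast at h0; linarith
  obtain ⟨j', h2, h3⟩ := (mul_eq_mul_iff_of_coprime hg hco hp).1 h1
  exact ⟨j', by rw [← hx, h2, h3]; ring⟩

/-- The recursion for the coefficients in Lagrange inversion, for two kinds of weights. -/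
lemma lagrange_coeffs_eq [Algebra ℚ R] (hg : 0 < g) (hco : p'.Coprime q') (hp : 0 < p')
    {M : ℕ} {H : ℕ → R} {c : ℕ → ℚ} (hc0 : c 0 = 1)
    (hc : ∀ j : ℕ, (j : ℚ) * (p' + q' : ℕ) * c j = -(M * ∑ i ∈ Finset.range j,
      (((i + 1) * (p' + q')).choose ((i + 1) * p') : ℚ) * c (j - (i + 1))))
    (hH : H M = 1)
    (hrec : ∀ n ≤ M, (n : R) * H n = M * ∑ l ∈ Finset.range (M - n + 1),
        ((LaurentPolynomial.C β * T ((g * q' : ℕ) : ℤ) +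
          LaurentPolynomial.C ω * T (-((g * p' : ℕ) : ℤ))) ^ l).coeff 0 * H (n + l))
    (j : ℕ) (hj : j * (p' + q') ≤ M) :
    H (M - j * (p' + q')) = algebraMap ℚ R (c j) * (β ^ p' * ω ^ q') ^ j := by
  induction j using Nat.strong_induction_on with
  | _ j ih =>
    rcases Nat.eq_zero_or_pos j with rfl | hj0
    · simp [hc0, hH]
    set m := p' + q' with hm
    have hm0 : 0 < m := by omega
    have h1 := hrec (M - j * m) (Nat.sub_le _ _)
    rw [Nat.sub_sub_self hj, sum_range_mul_eq hm0 j _ (fun l hl => by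
      rw [coeff_zero_add_pow_of_not_dvd hg hco hp hl, zero_mul]), Finset.sum_range_succ'] at h1
    have h2 : ∀ i ∈ Finset.range j, ((LaurentPolynomial.C β * T ((g * q' : ℕ) : ℤ) +
          LaurentPolynomial.C ω * T (-((g * p' : ℕ) : ℤ))) ^ ((i + 1) * m)).coeff 0 *
          H (M - j * m + (i + 1) * m) =
        algebraMap ℚ R ((((i + 1) * m).choose ((i + 1) * p') : ℚ) * c (j - (i + 1))) *
          (β ^ p' * ω ^ q') ^ j := by
      intro i hi
      have hi := Finset.mem_range.1 hi
      have hle : (j - (i + 1)) * m ≤ M :=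
        (Nat.mul_le_mul_right m (Nat.sub_le _ _)).trans hj
      have heq : M - j * m + (i + 1) * m = M - (j - (i + 1)) * m := by
        have h3 : (i + 1) * m ≤ j * m := Nat.mul_le_mul_right m hi
        rw [Nat.sub_mul]
        omega
      rw [heq, ih _ (by omega) hle, coeff_zero_add_pow hg hco hp, map_mul, map_natCast]
      conv_rhs => rw [show j = (i + 1) + (j - (i + 1)) by omega, pow_add]
      rw [Nat.add_sub_cancel_left]
      ring
    -- The term with exponent zero is H(M - j m) itself. Moved to the left side, it changes the
    -- factor M - j m into -j m, which can be inverted for j > 0.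
    have h4 : ((LaurentPolynomial.C β * T ((g * q' : ℕ) : ℤ) +
          LaurentPolynomial.C ω * T (-((g * p' : ℕ) : ℤ))) ^ (0 * m)).coeff 0 = 1 := by
      rw [coeff_zero_add_pow hg hco hp]
      simp
    rw [Finset.sum_congr rfl h2, h4, zero_mul, add_zero, ← Finset.sum_mul, ← map_sum,
      Nat.cast_sub hj] at h1
    have h5 := congrArg (algebraMap ℚ R) (hc j)
    simp only [map_mul, map_neg, map_natCast] at h5
    have h6 : algebraMap ℚ R ((j * m : ℕ) : ℚ) * H (M - j * m) =
        algebraMap ℚ R ((j * m : ℕ) : ℚ) *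
          (algebraMap ℚ R (c j) * (β ^ p' * ω ^ q') ^ j) := by
      rw [map_natCast]
      push_cast at h1 h5 ⊢
      linear_combination -h1 - (β ^ p' * ω ^ q') ^ j * h5
    have hne : ((j * m : ℕ) : ℚ) ≠ 0 := by
      have := Nat.mul_pos hj0 hm0
      exact_mod_cast this.ne'
    have h7 := congrArg (algebraMap ℚ R (((j * m : ℕ) : ℚ)⁻¹) * ·) h6
    simp only [← mul_assoc, ← map_mul] at h7
    rw [inv_mul_cancel₀ hne, map_one, one_mul, one_mul] at h7
    exact h7

/-- `hPQ` says that P and Q vertices of the two kinds balance h. Lowering the exponent by j(p' + q')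
while keeping the balance means removing j p' and j q' of them. -/
lemma coeff_zero_T_mul_add_pow_eq (hg : 0 < g) (hp : 0 < p')
    {h : ℤ} {P Q : ℕ} (hPQ : h + P * (g * q' : ℕ) - Q * (g * p' : ℕ) = 0) {j : ℕ}
    (hj : j * (p' + q') ≤ P + Q) :
    (T h * (LaurentPolynomial.C β * T ((g * q' : ℕ) : ℤ) +
      LaurentPolynomial.C ω * T (-((g * p' : ℕ) : ℤ))) ^ (P + Q - j * (p' + q'))).coeff 0 =
      if j * p' ≤ P ∧ j * q' ≤ Q then ((P + Q - j * (p' + q')).choose (P - j * p') : R) *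
        (β ^ (P - j * p') * ω ^ (Q - j * q')) else 0 := by
  rw [coeff_zero_T_mul_add_pow]
  -- The number of factors and the total weight are two linear equations for (i, k); they are
  -- independent because g (p' + q') ≠ 0.
  have key : ∀ i k : ℕ, i + k = P + Q - j * (p' + q') →
      h + i * ((g * q' : ℕ) : ℤ) + k * -((g * p' : ℕ) : ℤ) = 0 → i + j * p' = P ∧ k + j * q' = Q := by
    intro i k hik h0
    rw [mul_add] at hik hj
    have e1 : ((g * q' : ℕ) : ℤ) * (P - i) = (g * p' : ℕ) * (Q - k) := by linarith
    have e2 : (P - i : ℤ) + (Q - k) = j * p' + j * q' := by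
      have : ((i + k + (j * p' + j * q') : ℕ) : ℤ) = (P + Q : ℕ) := by congr 1; omega
      push_cast at this
      linarith
    have e3 : (p' + q' : ℤ) * (P - i - j * p') = 0 := by
      have hg' : (g : ℤ) ≠ 0 := by exact_mod_cast hg.ne'
      refine mul_left_cancel₀ hg' ?_
      push_cast at e1
      linear_combination e1 + g * p' * e2
    have hpq : (p' + q' : ℤ) ≠ 0 := by positivity
    have e4 := (mul_eq_zero.1 e3).resolve_left hpq
    constructor <;> zify <;> linarith
  split_ifs with hle
  · rw [Finset.sum_eq_single_of_mem (P - j * p', Q - j * q')]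
    · rw [if_pos]
      have e1 : ((P - j * p' : ℕ) : ℤ) = P - j * p' := by rw [Nat.cast_sub hle.1]; push_cast; ring
      have e2 : ((Q - j * q' : ℕ) : ℤ) = Q - j * q' := by rw [Nat.cast_sub hle.2]; push_cast; ring
      simp only [e1, e2]
      push_cast at hPQ ⊢
      linear_combination hPQ
    · rw [Finset.HasAntidiagonal.mem_antidiagonal]
      simp only [mul_add]
      omega
    · rintro ⟨i, k⟩ hik hne
      refine if_neg fun h0 => hne ?_
      obtain ⟨h1, h2⟩ := key i k (Finset.HasAntidiagonal.mem_antidiagonal.1 hik) h0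
      exact Prod.ext (by simp only; omega) (by simp only; omega)
  · refine Finset.sum_eq_zero fun x hx => if_neg fun h0 => hle ?_
    obtain ⟨h1, h2⟩ := key x.1 x.2 (Finset.HasAntidiagonal.mem_antidiagonal.1 hx) h0
    omega

/-- The numbers P - i and Q - k of omitted factors would be t p' and t q' for an integer t by
coprimality, so their sum l would be divisible by p' + q'. -/
lemma coeff_zero_T_mul_add_pow_eq_zero (hg : 0 < g) (hco : p'.Coprime q') (hp : 0 < p')
    {h : ℤ} {P Q : ℕ} (hPQ : h + P * (g * q' : ℕ) - Q * (g * p' : ℕ) = 0) {l : ℕ}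
    (hl : l ≤ P + Q) (hd : ¬ p' + q' ∣ l) :
    (T h * (LaurentPolynomial.C β * T ((g * q' : ℕ) : ℤ) +
      LaurentPolynomial.C ω * T (-((g * p' : ℕ) : ℤ))) ^ (P + Q - l)).coeff 0 = 0 := by
  rw [coeff_zero_T_mul_add_pow]
  refine Finset.sum_eq_zero fun x hx => if_neg fun h0 => hd ?_
  have hik := Finset.HasAntidiagonal.mem_antidiagonal.1 hx
  have e1 : (q' : ℤ) * (P - x.1) = p' * (Q - x.2) := by
    have hg' : (g : ℤ) ≠ 0 := by exact_mod_cast hg.ne'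
    refine mul_left_cancel₀ hg' ?_
    push_cast at hPQ h0
    linear_combination hPQ - h0
  have e2 : (P - x.1 : ℤ) + (Q - x.2) = l := by omega
  have hco' : IsCoprime (p' : ℤ) q' := Nat.isCoprime_iff_coprime.2 hco
  obtain ⟨t, ht⟩ : (p' : ℤ) ∣ P - x.1 := hco'.dvd_of_dvd_mul_left ⟨_, e1⟩
  have e3 : (Q - x.2 : ℤ) = q' * t := by
    have hp' : (p' : ℤ) ≠ 0 := by exact_mod_cast hp.ne'
    refine mul_left_cancel₀ hp' ?_
    rw [← e1, ht]
    ring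
  have : ((p' + q' : ℕ) : ℤ) ∣ (l : ℤ) := ⟨t, by rw [← e2, ht, e3]; push_cast; ring⟩
  exact_mod_cast this

/-- The sum over edge-rooted trees with one vertex of weight `h`, while `P` other vertices have
weight `g q'` and `Q` other vertices have weight `- g p'`. -/
theorem rootedSum_univ_eq {V : Type} [DecidableEq V] [Fintype V] {s : V → ℤ} (hs : ∀ v, s v ≠ 0)
    (star : V) {P Q J : ℕ} (hg : 0 < g) (hco : p'.Coprime q') (hp : 0 < p')
    (hP : ((Finset.univ.erase star).filter fun v => s v = ((g * q' : ℕ) : ℤ)).card = P)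
    (hQ : ((Finset.univ.erase star).filter fun v => ¬ s v = ((g * q' : ℕ) : ℤ)).card = Q)
    (hsv : ∀ v, v ≠ star → s v = ((g * q' : ℕ) : ℤ) ∨ s v = -((g * p' : ℕ) : ℤ))
    (hPQ : s star + P * (g * q' : ℕ) - Q * (g * p' : ℕ) = 0)
    (hJ : ∀ j, j * p' ≤ P ∧ j * q' ≤ Q ↔ j ≤ J) {c : ℕ → ℚ} (hc0 : c 0 = 1)
    (hc : ∀ j : ℕ, (j : ℚ) * (p' + q' : ℕ) * c j = -((P + Q : ℕ) * ∑ i ∈ Finset.range j,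
      (((i + 1) * (p' + q')).choose ((i + 1) * p') : ℚ) * c (j - (i + 1)))) :
    rootedSum s Finset.univ = P ! * Q ! * ∑ j ∈ Finset.range (J + 1),
      ((P + Q - j * (p' + q')).choose (P - j * p') : ℚ) * c j := by
  obtain ⟨R, _, _, x, hx, hxS⟩ := exists_squareZero_generators V
  set V₀ := Finset.univ.erase star with hV₀
  have hstar : ∀ U ⊆ V₀, star ∉ U := fun U hU h => Finset.notMem_erase _ _ (hU h)
  have hins : insert star V₀ = Finset.univ := Finset.insert_erase (Finset.mem_univ _)
  set VP := V₀.filter fun v => s v = ((g * q' : ℕ) : ℤ) with hVP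
  set VQ := V₀.filter fun v => ¬ s v = ((g * q' : ℕ) : ℤ) with hVQ
  have hsQ : ∀ v ∈ VQ, s v = -((g * p' : ℕ) : ℤ) := fun v hv =>
    (hsv v (Finset.ne_of_mem_erase (Finset.mem_filter.1 hv).1)).resolve_left
      (Finset.mem_filter.1 hv).2
  have hcard : V₀.card = P + Q := by
    rw [← hP, ← hQ, Finset.card_filter_add_card_filter_not]
  have hη : ∑ v ∈ V₀, LaurentPolynomial.C (x v) * T (s v) =
      LaurentPolynomial.C (∑ v ∈ VP, x v) * T ((g * q' : ℕ) : ℤ) +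
      LaurentPolynomial.C (∑ v ∈ VQ, x v) * T (-((g * p' : ℕ) : ℤ)) := by
    rw [← Finset.sum_filter_add_sum_filter_not V₀ (fun v => s v = ((g * q' : ℕ) : ℤ)), map_sum,
      map_sum, Finset.sum_mul, Finset.sum_mul]
    congr 1
    · exact Finset.sum_congr rfl fun v hv => by rw [(Finset.mem_filter.1 hv).2]
    · exact Finset.sum_congr rfl fun v hv => by rw [hsQ v hv]
  have hsum : s star + ∑ v ∈ V₀, s v = 0 := by
    rw [← Finset.sum_filter_add_sum_filter_not V₀ (fun v => s v = ((g * q' : ℕ) : ℤ)),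
      Finset.sum_congr rfl fun v hv => (Finset.mem_filter.1 hv).2,
      Finset.sum_congr (rfl : VQ = VQ) hsQ, Finset.sum_const, Finset.sum_const, hP, hQ]
    rw [← hPQ]
    simp only [nsmul_eq_mul]
    ring
  obtain ⟨H, hH, hrec, hfin⟩ := exists_lagrange_coeffs_of_recursion (s := s) (V₀ := V₀)
    (h := s star) hx (A₀ := fun U => algebraMap ℚ R (rootedSum s U))
    (A₁ := fun U => algebraMap ℚ R (rootedSum s (insert star U)))
    (by
      intro U _
      rw [rootedSum_eq hs U, map_add, map_sum]
      simp only [apply_ite (algebraMap ℚ R), map_one, map_zero, map_mul])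
    (by
      intro U hU
      have hsU := hstar U hU
      -- The decompositions are divided according to the side that contains the star; the two cases
      -- give the two sums in the recursion for `A₁`.
      rw [rootedSum_eq hs (insert star U), Finset.sum_powerset_insert hsU, map_add, map_add,
        map_sum, map_sum, Finset.card_insert_of_notMem hsU, add_comm (∑ t ∈ _, _) (∑ t ∈ _, _),
        ← add_assoc]
      congr 1
      · congr 1
        · simp [Finset.card_eq_zero, apply_ite (algebraMap ℚ R)]
        · refine Finset.sum_congr rfl fun t ht => ?_
          have hst : star ∉ t := fun h => hsU (Finset.mem_powerset.1 ht h)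
          rw [Finset.sum_insert hst, Finset.insert_sdiff_insert,
            Finset.sdiff_insert_of_notMem hsU]
          simp only [apply_ite (algebraMap ℚ R), map_zero, map_mul]
      · refine Finset.sum_congr rfl fun t ht => ?_
        have hst : star ∉ t := fun h => hsU (Finset.mem_powerset.1 ht h)
        rw [Finset.insert_sdiff_of_notMem _ hst,
          Finset.sum_insert fun h => hsU (Finset.mem_sdiff.1 h).1]
        simp only [apply_ite (algebraMap ℚ R), map_zero, map_mul])
    hsum
  rw [hη] at hrec hfin
  rw [hcard] at hrec hfin hH
  rw [hins] at hfin
  set β := ∑ v ∈ VP, x v with hβ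
  set ω := ∑ v ∈ VQ, x v with hω
  have hm : 0 < p' + q' := by omega
  have hterm : ∀ j, j * (p' + q') ≤ P + Q →
      (T (s star) * (LaurentPolynomial.C β * T ((g * q' : ℕ) : ℤ) +
        LaurentPolynomial.C ω * T (-((g * p' : ℕ) : ℤ))) ^ (P + Q - j * (p' + q'))).coeff 0 *
        H (P + Q - j * (p' + q')) =
      if j ≤ J then algebraMap ℚ R (((P + Q - j * (p' + q')).choose (P - j * p') : ℚ) * c j) *
        (β ^ P * ω ^ Q) else 0 := by
    intro j hj
    rw [coeff_zero_T_mul_add_pow_eq hg hp hPQ hj,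
      lagrange_coeffs_eq hg hco hp hc0 hc hH hrec j hj, ite_mul, zero_mul]
    simp only [hJ]
    split_ifs with hjJ
    · obtain ⟨h1, h2⟩ := (hJ j).2 hjJ
      have hpow : β ^ (P - j * p') * ω ^ (Q - j * q') * (β ^ p' * ω ^ q') ^ j = β ^ P * ω ^ Q := by
        rw [mul_pow, ← pow_mul, ← pow_mul, mul_mul_mul_comm, ← pow_add, ← pow_add, mul_comm p',
          mul_comm q', Nat.sub_add_cancel h1, Nat.sub_add_cancel h2]
      rw [← hpow, map_mul, map_natCast]
      ring
    · rfl
  have hJle : J * (p' + q') ≤ P + Q := by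
    have := (hJ J).2 le_rfl
    rw [mul_add]
    omega
  have hsum2 : ∑ n ∈ Finset.range (P + Q + 1),
      (T (s star) * (LaurentPolynomial.C β * T ((g * q' : ℕ) : ℤ) +
        LaurentPolynomial.C ω * T (-((g * p' : ℕ) : ℤ))) ^ n).coeff 0 * H n =
      ∑ j ∈ Finset.range (J + 1),
        algebraMap ℚ R (((P + Q - j * (p' + q')).choose (P - j * p') : ℚ) * c j) *
        (β ^ P * ω ^ Q) := by
    -- Put n = P + Q - l. Only multiples l = j(p' + q') contribute, and among them only those with j
    -- ≤ J.
    rw [← Finset.sum_range_reflect]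
    symm
    refine Finset.sum_of_injOn (fun j => j * (p' + q')) ?_ ?_ ?_ ?_
    · intro a _ b _ hab
      exact Nat.eq_of_mul_eq_mul_right hm hab
    · intro j hj
      simp only [Finset.coe_range, Set.mem_Iio] at hj ⊢
      have := Nat.mul_le_mul_right (p' + q') (Nat.lt_succ_iff.1 hj)
      omega
    · intro l hl hl'
      have hl := Finset.mem_range.1 hl
      rw [show P + Q + 1 - 1 - l = P + Q - l by omega]
      by_cases hd : p' + q' ∣ l
      · obtain ⟨j, rfl⟩ := hd
        rw [mul_comm (p' + q') j] at hl hl' ⊢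
        rw [hterm j (by omega), if_neg]
        intro hj
        exact hl' ⟨j, by simpa using Nat.lt_succ_of_le hj, rfl⟩
      · rw [coeff_zero_T_mul_add_pow_eq_zero hg hco hp hPQ (by omega) hd, zero_mul]
    · intro j hj
      have hj := Nat.lt_succ_iff.1 (Finset.mem_range.1 hj)
      have := Nat.mul_le_mul_right (p' + q') hj
      rw [show P + Q + 1 - 1 - j * (p' + q') = P + Q - j * (p' + q') by omega,
        hterm j (by omega), if_pos hj]
  have hβP : β ^ P = P ! * ∏ v ∈ VP, x v := by
    have := (sum_pow_card_succ_eq_zero hx VP).2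
    rwa [hP] at this
  have hωQ : ω ^ Q = Q ! * ∏ v ∈ VQ, x v := by
    have := (sum_pow_card_succ_eq_zero hx VQ).2
    rwa [hQ] at this
  rw [hsum2, ← Finset.sum_mul, ← map_sum, hβP, hωQ] at hfin
  -- Both sides are rational multiples of the squarefree monomial ∏ x_v over all vertices but the
  -- star, so their coefficients can be compared.
  rw [← sub_eq_zero]
  refine hxS V₀ _ ?_
  have hprod : ∏ v ∈ V₀, x v = (∏ v ∈ VP, x v) * ∏ v ∈ VQ, x v :=
    (Finset.prod_filter_mul_prod_filter_not V₀ _ _).symm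
  rw [map_sub, sub_mul, hfin, hprod, map_mul, map_mul, map_natCast, map_natCast]
  ring

end Evaluation

/-! ## Permutations with prescribed cycles -/

section Rotations

open Equiv.Perm

lemma card_sameCycle_all (α : Type) [Finite α] :
    Nat.card {τ : Equiv.Perm α // ∀ x y, τ.SameCycle x y} = (Nat.card α - 1)! := by
  classical
  have := Fintype.ofFinite α
  rw [Nat.card_eq_fintype_card (α := α)]
  -- A cycle type omits fixed points, so the count by cycle type does not cover sets with at most
  -- one element.
  rcases lt_or_ge (Fintype.card α) 2 with h | h
  · have hs : Subsingleton α := Fintype.card_le_one_iff_subsingleton.1 (by omega)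
    rw [show Fintype.card α - 1 = 0 by omega, Nat.factorial_zero, Nat.card_eq_one_iff_unique]
    refine ⟨⟨fun a b => Subtype.ext (Subsingleton.elim _ _)⟩, ⟨1, fun x y => ?_⟩⟩
    rw [Subsingleton.elim x y]
  · rw [Nat.card_eq_fintype_card, Fintype.card_subtype]
    have hc := card_of_cycleType_singleton (α := α) h le_rfl
    rw [Nat.choose_self, mul_one] at hc
    rw [← hc]
    congr 1
    ext τ
    simp only [Finset.mem_filter, Finset.mem_univ, true_and]
    have : Nontrivial α := Fintype.one_lt_card_iff_nontrivial.1 h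
    constructor
    · intro hτ
      have hne : ∀ x, τ x ≠ x := by
        intro x hx
        obtain ⟨y, hy⟩ := exists_ne x
        exact hy ((hτ x y).eq_of_left hx).symm
      obtain ⟨x⟩ : Nonempty α := inferInstance
      have hcyc : τ.IsCycle := ⟨x, hne x, fun y _ => hτ x y⟩
      rw [hcyc.cycleType, ← Finset.card_univ]
      congr 2
      exact Finset.eq_univ_of_forall fun x => mem_support.2 (hne x)
    · intro hτ x y
      have hcyc : τ.IsCycle := card_cycleType_eq_one.1 (by rw [hτ, Multiset.card_singleton])
      have hsup : τ.support = Finset.univ := by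
        rw [← Finset.card_eq_iff_eq_univ, ← sum_cycleType, hτ, Multiset.sum_singleton]
      have hmem : ∀ z, τ z ≠ z := fun z => mem_support.1 (hsup ▸ Finset.mem_univ z)
      exact hcyc.sameCycle (hmem x) (hmem y)

lemma apply_eq_of_sameCycle {E B : Type} {f : E → B} {τ : Equiv.Perm E} (h : ∀ e, f (τ e) = f e)
    {e e' : E} (he : τ.SameCycle e e') : f e = f e' := by
  obtain ⟨i, rfl⟩ := he
  have hsymm : ∀ e, f (τ⁻¹ e) = f e := fun e => by simpa using (h (τ⁻¹ e)).symm
  induction i using Int.induction_on with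
  | zero => rfl
  | succ n ih => rw [add_comm, zpow_add, zpow_one, Equiv.Perm.mul_apply, h, ← ih]
  | pred n ih =>
    rw [sub_eq_add_neg, add_comm, zpow_add, zpow_neg_one, Equiv.Perm.mul_apply, hsymm, ← ih]

/-- Permutations whose cycles are the fibers of `f` consist of a cyclic order on each fiber. -/
noncomputable def sameCycleFibersEquiv {E B : Type} (f : E → B) :
    {τ : Equiv.Perm E // ∀ e e', τ.SameCycle e e' ↔ f e = f e'} ≃
      ∀ b, {τ : Equiv.Perm {e // f e = b} // ∀ x y, τ.SameCycle x y} where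
  toFun τ b := ⟨τ.1.subtypePerm fun e => by
      rw [← (τ.2 e (τ.1 e)).1 (sameCycle_apply_right.2 (SameCycle.refl _ _))],
    fun x y => sameCycle_subtypePerm.2 ((τ.2 _ _).2 (x.2.trans y.2.symm))⟩
  invFun τ := ⟨DomMulAct.stabilizerEquiv_invFun_aux fun b => (τ b).1, by
    have hf : ∀ e, f (DomMulAct.stabilizerEquiv_invFun_aux (fun b => (τ b).1) e) = f e :=
      fun e => DomMulAct.comp_stabilizerEquiv_invFun (fun b => (τ b).1) e
    refine fun e e' => ⟨apply_eq_of_sameCycle hf, fun h => ?_⟩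
    have h1 : (DomMulAct.stabilizerEquiv_invFun_aux fun b => (τ b).1).subtypePerm
        (p := fun x => f x = f e') (fun x => by rw [hf]) = (τ (f e')).1 := by
      ext x
      exact DomMulAct.stabilizerEquiv_invFun_eq (fun b => (τ b).1) x.2
    have h2 := (τ (f e')).2 ⟨e, h⟩ ⟨e', rfl⟩
    rw [← h1, sameCycle_subtypePerm] at h2
    exact h2⟩
  left_inv τ := by
    ext e
    rfl
  right_inv τ := by
    ext b x
    exact DomMulAct.stabilizerEquiv_invFun_eq (fun b => (τ b).1) x.2

lemma card_sameCycle_fibers {E B : Type} [Finite E] [Fintype B] (f : E → B) :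
    Nat.card {τ : Equiv.Perm E // ∀ e e', τ.SameCycle e e' ↔ f e = f e'} =
      ∏ b, (Nat.card {e // f e = b} - 1)! := by
  rw [Nat.card_congr (sameCycleFibersEquiv f), Nat.card_pi]
  exact Finset.prod_congr rfl fun b _ => card_sameCycle_all _

end Rotations

/-! ## Bicolored graphs that are trees -/

section BicoloredTrees

variable {B W E : Type}

/-- The edge from the black to the white end. -/
def bicoloredEdge (src : E → B) (tgt : E → W) (e : E) : (B ⊕ W) × (B ⊕ W) :=
  (Sum.inl (src e), Sum.inr (tgt e))

lemma bicoloredEdge_injective {src : E → B} {tgt : E → W}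
    (h : Function.Injective fun e => (src e, tgt e)) :
    Function.Injective (bicoloredEdge src tgt) := by
  intro e e' hee
  simp only [bicoloredEdge, Prod.mk.injEq, Sum.inl.injEq, Sum.inr.injEq] at hee
  exact h (Prod.ext hee.1 hee.2)

lemma bicoloredGraph_adj {src : E → B} {tgt : E → W} {x y : B ⊕ W} :
    (bicoloredGraph src tgt).Adj x y ↔
      ∃ e, (x, y) = bicoloredEdge src tgt e ∨ (y, x) = bicoloredEdge src tgt e := by
  simp only [bicoloredGraph, SimpleGraph.fromRel_adj, bicoloredEdge, Prod.mk.injEq]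
  constructor
  · rintro ⟨-, ⟨e, he⟩ | ⟨e, he⟩⟩
    · exact ⟨e, .inl he⟩
    · exact ⟨e, .inr he⟩
  · rintro ⟨e, ⟨rfl, rfl⟩ | ⟨rfl, rfl⟩⟩
    · exact ⟨by simp, .inl ⟨e, rfl, rfl⟩⟩
    · exact ⟨by simp, .inr ⟨e, rfl, rfl⟩⟩

variable [Fintype E]

lemma card_edgeSet_bicoloredGraph {src : E → B} {tgt : E → W}
    (h : Function.Injective fun e => (src e, tgt e)) :
    Nat.card (bicoloredGraph src tgt).edgeSet = Fintype.card E := by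
  have h1 : (bicoloredGraph src tgt).edgeSet =
      Set.range fun e => s((Sum.inl (src e) : B ⊕ W), Sum.inr (tgt e)) := by
    ext x
    induction x using Sym2.ind with
    | _ x y =>
      rw [SimpleGraph.mem_edgeSet, bicoloredGraph_adj]
      refine exists_congr fun e => ?_
      simp only [bicoloredEdge, Sym2.eq_iff, Prod.mk.injEq]
      tauto
  rw [h1, Nat.card_range_of_injective, Nat.card_eq_fintype_card]
  intro e e' hee
  simp only [Sym2.eq_iff, Sum.inl.injEq, Sum.inr.injEq, reduceCtorEq, false_and, or_false] at hee
  exact h (Prod.ext hee.1 hee.2)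

variable [DecidableEq (B ⊕ W)]

/-- In a connected graph, a subtree with the largest number of vertices is spanning, since otherwise
a walk leaves it through an edge that could be added. A comparison of the numbers of edges and
vertices then shows that it contains all edges. Conversely, the set of vertices reachable from a
given one is closed under edges, and the edge count is that of a tree. -/
theorem bicoloredGraph_isTree_iff [Fintype B] [Fintype W] {src : E → B} {tgt : E → W}
    (h : Function.Injective fun e => (src e, tgt e)) :
    (bicoloredGraph src tgt).IsTree ↔
      TreeOn Finset.univ (Finset.univ.image (bicoloredEdge src tgt)) := by
  classical
  have hT : (Finset.univ.image (bicoloredEdge src tgt)).card = Fintype.card E := by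
    rw [Finset.card_image_of_injective _ (bicoloredEdge_injective h), Finset.card_univ]
  rw [SimpleGraph.isTree_iff_connected_and_card, card_edgeSet_bicoloredGraph h,
    Nat.card_eq_fintype_card]
  constructor
  · rintro ⟨hconn, hcard⟩
    obtain ⟨x₀⟩ := hconn.nonempty
    let trees : Finset (Finset (B ⊕ W) × Finset ((B ⊕ W) × (B ⊕ W))) := Finset.univ.filter
      fun y => TreeOn y.1 y.2 ∧ y.2 ⊆ Finset.univ.image (bicoloredEdge src tgt)
    obtain ⟨⟨U, T⟩, hUT, hmax⟩ := trees.exists_max_image (fun y => y.1.card)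
      ⟨({x₀}, ∅), Finset.mem_filter.2 ⟨Finset.mem_univ _, .single x₀, by simp⟩⟩
    obtain ⟨-, htree, hsub⟩ := Finset.mem_filter.1 hUT
    simp only at htree hsub
    have hU : U = Finset.univ := by
      by_contra hne
      obtain ⟨v, hv⟩ : ∃ v, v ∉ U := by
        by_contra! hall
        exact hne (Finset.eq_univ_of_forall hall)
      obtain ⟨u, hu⟩ := htree.nonempty
      obtain ⟨p⟩ := hconn.preconnected u v
      obtain ⟨d, -, hd₁, hd₂⟩ := p.exists_boundary_dart (U : Set (B ⊕ W)) hu hv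
      have hd₁ : d.fst ∈ U := hd₁
      have hd₂ : d.snd ∉ U := hd₂
      have hnew : ∃ T', (insert d.snd U, T') ∈ trees := by
        obtain ⟨e, he | he⟩ := bicoloredGraph_adj.1 d.adj
        · refine ⟨insert (d.fst, d.snd) (T ∪ ∅), Finset.mem_filter.2 ⟨Finset.mem_univ _, ?_, ?_⟩⟩
          · have := TreeOn.join htree (.single d.snd) (Finset.disjoint_singleton_right.2 hd₂) hd₁
              (Finset.mem_singleton_self _)
            rwa [Finset.union_singleton] at this
          · rw [Finset.union_empty, Finset.insert_subset_iff, he]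
            exact ⟨Finset.mem_image_of_mem _ (Finset.mem_univ _), hsub⟩
        · refine ⟨insert (d.snd, d.fst) (∅ ∪ T), Finset.mem_filter.2 ⟨Finset.mem_univ _, ?_, ?_⟩⟩
          · have := TreeOn.join (.single d.snd) htree (Finset.disjoint_singleton_left.2 hd₂)
              (Finset.mem_singleton_self _) hd₁
            rwa [Finset.singleton_union] at this
          · rw [Finset.empty_union, Finset.insert_subset_iff, he]
            exact ⟨Finset.mem_image_of_mem _ (Finset.mem_univ _), hsub⟩
      obtain ⟨T', hT'⟩ := hnew
      have := hmax _ hT'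
      simp only [Finset.card_insert_of_notMem hd₂] at this
      omega
    subst hU
    have hc := htree.card
    rw [Finset.card_univ, ← hcard] at hc
    rwa [Finset.eq_of_subset_of_card_le hsub (by omega)] at htree
  · intro htree
    have hc := htree.card
    rw [Finset.card_univ, hT] at hc
    obtain ⟨x₀, -⟩ := htree.nonempty
    have : Nonempty (B ⊕ W) := ⟨x₀⟩
    refine ⟨⟨fun u v => ?_⟩, hc⟩
    refine htree.subset_of_closed {v | (bicoloredGraph src tgt).Reachable u v} ?_
      (Finset.mem_univ u) (SimpleGraph.Reachable.refl u) v (Finset.mem_univ v)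
    intro x hx
    obtain ⟨e, -, rfl⟩ := Finset.mem_image.1 hx
    have hadj : (bicoloredGraph src tgt).Adj (bicoloredEdge src tgt e).1
        (bicoloredEdge src tgt e).2 := bicoloredGraph_adj.2 ⟨e, .inl rfl⟩
    exact ⟨fun h => h.trans hadj.reachable, fun h => h.trans hadj.reachable.symm⟩

lemma netFlow_inl {src : E → B} {tgt : E → W} (h : Function.Injective fun e => (src e, tgt e))
    (f : (B ⊕ W) × (B ⊕ W) → ℤ) (b : B) [DecidablePred fun e => src e = b] :
    netFlow (Finset.univ.image (bicoloredEdge src tgt)) f (Sum.inl b) =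
      ∑ e with src e = b, f (bicoloredEdge src tgt e) := by
  rw [netFlow, Finset.sum_image fun _ _ _ _ h' => bicoloredEdge_injective h h', Finset.sum_filter]
  refine Finset.sum_congr rfl fun e _ => ?_
  simp [bicoloredEdge]

lemma netFlow_inr {src : E → B} {tgt : E → W} (h : Function.Injective fun e => (src e, tgt e))
    (f : (B ⊕ W) × (B ⊕ W) → ℤ) (w : W) [DecidablePred fun e => tgt e = w] :
    netFlow (Finset.univ.image (bicoloredEdge src tgt)) f (Sum.inr w) =
      -∑ e with tgt e = w, f (bicoloredEdge src tgt e) := by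
  rw [netFlow, Finset.sum_image fun _ _ _ _ h' => bicoloredEdge_injective h h', Finset.sum_filter,
    ← Finset.sum_neg_distrib]
  refine Finset.sum_congr rfl fun e _ => ?_
  by_cases hw : tgt e = w <;> simp [bicoloredEdge, hw]

lemma edgeDeg_inl {src : E → B} {tgt : E → W} (h : Function.Injective fun e => (src e, tgt e))
    (b : B) : edgeDeg (Finset.univ.image (bicoloredEdge src tgt)) (Sum.inl b) =
      Nat.card {e // src e = b} := by
  classical
  rw [edgeDeg, Finset.filter_image, Finset.card_image_of_injective _ (bicoloredEdge_injective h),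
    Nat.card_eq_fintype_card, Fintype.card_subtype]
  simp [bicoloredEdge]

lemma edgeDeg_inr {src : E → B} {tgt : E → W} (h : Function.Injective fun e => (src e, tgt e))
    (w : W) : edgeDeg (Finset.univ.image (bicoloredEdge src tgt)) (Sum.inr w) =
      Nat.card {e // tgt e = w} := by
  classical
  rw [edgeDeg, Finset.filter_image, Finset.card_image_of_injective _ (bicoloredEdge_injective h),
    Nat.card_eq_fintype_card, Fintype.card_subtype]
  simp [bicoloredEdge]

end BicoloredTrees

/-! ## Plane trees with distinguishable vertices -/

section PlaneTrees

variable {S : Type}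

lemma LWBPTree.Iso.wtBlack_onB {X Y : LWBPTree S} (i : X.Iso Y) (b : X.B) :
    Y.wtBlack (i.onB b) = X.wtBlack b := by
  unfold WBPTree.wtBlack
  symm
  refine Finset.sum_equiv i.onE (fun e => ?_) fun e _ => (i.weight_onE e).symm
  simp [i.src_onE]

lemma LWBPTree.Iso.wtWhite_onW {X Y : LWBPTree S} (i : X.Iso Y) (w : X.W) :
    Y.wtWhite (i.onW w) = X.wtWhite w := by
  unfold WBPTree.wtWhite
  symm
  refine Finset.sum_equiv i.onE (fun e => ?_) fun e _ => (i.weight_onE e).symm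
  simp [i.tgt_onE]

lemma sameCycle_permCongr {α β : Type} (ε : α ≃ β) (ρ : Equiv.Perm α) (x y : β) :
    (ε.permCongr ρ).SameCycle x y ↔ ρ.SameCycle (ε.symm x) (ε.symm y) := by
  refine exists_congr fun i => ?_
  have h : (ε.permCongr ρ) ^ i = ε.permCongr (ρ ^ i) := (map_zpow ε.permCongrHom ρ i).symm
  rw [h, Equiv.permCongr_apply, Equiv.eq_symm_apply]

namespace LabeledPassport

/-- The elements of the black part, which are distinguishable vertices. -/
abbrev BlackVertex (Ξ : LabeledPassport S) : Type := {x // x ∈ Ξ.black}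

/-- The elements of the white part, which are distinguishable vertices. -/
abbrev WhiteVertex (Ξ : LabeledPassport S) : Type := {x // x ∈ Ξ.white}

/-- The vertices of all trees with a passport without multiplicities. -/
abbrev Vertex (Ξ : LabeledPassport S) : Type := Ξ.BlackVertex ⊕ Ξ.WhiteVertex

variable (Ξ : LabeledPassport S)

/-- The weight, counted negatively for white vertices. -/
def signedWeight : Ξ.Vertex → ℤ := Sum.elim (fun x => (x.1.1 : ℤ)) fun y => -(y.1.1 : ℤ)

lemma signedWeight_ne_zero (v : Ξ.Vertex) : Ξ.signedWeight v ≠ 0 := by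
  rcases v with x | y
  · have := Ξ.black_pos x.1 x.2
    simp only [signedWeight, Sum.elim_inl]
    omega
  · have := Ξ.white_pos y.1 y.2
    simp only [signedWeight, Sum.elim_inr]
    omega

lemma ends_injective (T : Finset (Ξ.BlackVertex × Ξ.WhiteVertex)) :
    Function.Injective fun e : T => (e.1.1, e.1.2) := fun _ _ h => Subtype.ext h

lemma map_val_univ {α : Type} {m : Multiset α} (hm : m.Nodup) [Fintype {x // x ∈ m}] :
    (Finset.univ : Finset {x // x ∈ m}).val.map Subtype.val = m := by
  refine (Multiset.Nodup.ext (Finset.univ.nodup.map Subtype.val_injective) hm).2 fun x => ?_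
  simp

lemma exists_equiv_of_map_univ_eq {α β : Type} [Fintype α] {m : Multiset β} (hm : m.Nodup) {f : α → β}
    (h : Finset.univ.val.map f = m) :
    ∃ ψ : α ≃ {x // x ∈ m}, ∀ a, (ψ a).1 = f a := by
  have hmem : ∀ a, f a ∈ m := fun a => h ▸ Multiset.mem_map_of_mem f (Finset.mem_univ a)
  refine ⟨Equiv.ofBijective (fun a => ⟨f a, hmem a⟩) ⟨fun a a' haa => ?_, fun x => ?_⟩,
    fun a => rfl⟩
  · subst h
    exact Multiset.inj_on_of_nodup_map hm a (Finset.mem_univ a) a' (Finset.mem_univ a')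
      (Subtype.ext_iff.1 haa)
  · obtain ⟨a, -, ha⟩ := Multiset.mem_map.1 (h.symm ▸ x.2 : x.1 ∈ Finset.univ.val.map f)
    exact ⟨a, Subtype.ext ha⟩

variable [DecidableEq S]

/-- Edges between black and white vertices as directed edges between vertices. -/
def directedEdges (T : Finset (Ξ.BlackVertex × Ξ.WhiteVertex)) : Finset (Ξ.Vertex × Ξ.Vertex) :=
  Finset.univ.image (bicoloredEdge (fun e : T => e.1.1) fun e : T => e.1.2)

/-- The edges in `T` form a tree with positive weights that give rise to the passport `Ξ`. -/
def IsWeightedTree (T : Finset (Ξ.BlackVertex × Ξ.WhiteVertex)) : Prop :=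
  TreeOn Finset.univ (Ξ.directedEdges T) ∧ HasFlow Finset.univ (Ξ.directedEdges T) Ξ.signedWeight

/-- A tree on the vertices given by the passport with cyclic orders at the vertices. -/
abbrev PlaneTree : Type :=
  Σ T : {T : Finset (Ξ.BlackVertex × Ξ.WhiteVertex) // Ξ.IsWeightedTree T},
    {ρ : Equiv.Perm T.1 // ∀ e e', ρ.SameCycle e e' ↔ e.1.1 = e'.1.1} ×
    {ρ : Equiv.Perm T.1 // ∀ e e', ρ.SameCycle e e' ↔ e.1.2 = e'.1.2}

variable {Ξ}

namespace PlaneTree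

/-- The flow that gives the weights of the edges. -/
noncomputable def flow (D : Ξ.PlaneTree) : Ξ.Vertex × Ξ.Vertex → ℤ := D.1.2.2.choose

lemma flow_pos (D : Ξ.PlaneTree) : ∀ e ∈ Ξ.directedEdges D.1.1, 0 < D.flow e :=
  D.1.2.2.choose_spec.1

lemma netFlow_flow (D : Ξ.PlaneTree) (v : Ξ.Vertex) :
    netFlow (Ξ.directedEdges D.1.1) D.flow v = Ξ.signedWeight v :=
  D.1.2.2.choose_spec.2 v (Finset.mem_univ v)

lemma flow_edge_pos (D : Ξ.PlaneTree) (e : D.1.1) :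
    0 < D.flow (bicoloredEdge (fun e : D.1.1 => e.1.1) (fun e : D.1.1 => e.1.2) e) :=
  D.flow_pos _ (Finset.mem_image_of_mem _ (Finset.mem_univ e))

/-- The labeled weighted bi-colored plane tree. -/
noncomputable def toLWBPTree (D : Ξ.PlaneTree) : LWBPTree S where
  B := Ξ.BlackVertex
  W := Ξ.WhiteVertex
  E := D.1.1
  src e := e.1.1
  tgt e := e.1.2
  ends_injective := Ξ.ends_injective D.1.1
  isTree := (bicoloredGraph_isTree_iff (Ξ.ends_injective D.1.1)).2 D.1.2.1
  rotBlack := D.2.1.1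
  rotWhite := D.2.2.1
  rotBlack_sameCycle := D.2.1.2
  rotWhite_sameCycle := D.2.2.2
  weight e := (D.flow (bicoloredEdge (fun e : D.1.1 => e.1.1) (fun e : D.1.1 => e.1.2) e)).toNat
  weight_pos e := by
    have := D.flow_edge_pos e
    omega
  labBlack x := x.1.2
  labWhite y := y.1.2

lemma wtBlack_toLWBPTree (D : Ξ.PlaneTree) (x : Ξ.BlackVertex) :
    D.toLWBPTree.wtBlack x = x.1.1 := by
  classical
  have h := D.netFlow_flow (Sum.inl x)
  rw [directedEdges, netFlow_inl (Ξ.ends_injective D.1.1)] at h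
  have h2 : ((D.toLWBPTree.wtBlack x : ℕ) : ℤ) = (x.1.1 : ℕ) := by
    refine Eq.trans ?_ h
    simp only [WBPTree.wtBlack]
    refine (Nat.cast_sum _ _).trans ?_
    refine Finset.sum_congr ?_ fun e _ => Int.toNat_of_nonneg (D.flow_edge_pos e).le
    exact Finset.ext fun e : D.1.1 => Finset.mem_filter.trans (Finset.mem_filter :
      e ∈ Finset.univ.filter (fun e : D.1.1 => e.1.1 = x) ↔ _).symm
  exact_mod_cast h2

lemma wtWhite_toLWBPTree (D : Ξ.PlaneTree) (y : Ξ.WhiteVertex) :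
    D.toLWBPTree.wtWhite y = y.1.1 := by
  classical
  have h := D.netFlow_flow (Sum.inr y)
  rw [directedEdges, netFlow_inr (Ξ.ends_injective D.1.1)] at h
  have h2 : -((D.toLWBPTree.wtWhite y : ℕ) : ℤ) = -(y.1.1 : ℕ) := by
    refine Eq.trans ?_ h
    simp only [WBPTree.wtWhite]
    refine congrArg Neg.neg ((Nat.cast_sum _ _).trans ?_)
    refine Finset.sum_congr ?_ fun e _ => Int.toNat_of_nonneg (D.flow_edge_pos e).le
    exact Finset.ext fun e : D.1.1 => Finset.mem_filter.trans (Finset.mem_filter :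
      e ∈ Finset.univ.filter (fun e : D.1.1 => e.1.2 = y) ↔ _).symm
  exact_mod_cast neg_inj.1 h2

end PlaneTree

lemma PlaneTree.hasPassport (hb : Ξ.black.Nodup) (hw : Ξ.white.Nodup) (D : Ξ.PlaneTree) :
    D.toLWBPTree.HasPassport Ξ := by
  constructor
  · refine Eq.trans ?_ (map_val_univ hb)
    exact Multiset.map_congr rfl fun x _ => Prod.ext (D.wtBlack_toLWBPTree x) rfl
  · refine Eq.trans ?_ (map_val_univ hw)
    exact Multiset.map_congr rfl fun x _ => Prod.ext (D.wtWhite_toLWBPTree x) rfl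

/-- The isomorphism class of a plane tree. -/
noncomputable def PlaneTree.toTreesWith (hb : Ξ.black.Nodup) (hw : Ξ.white.Nodup)
    (D : Ξ.PlaneTree) : TreesWith Ξ :=
  Quotient.mk (sameTree Ξ) ⟨D.toLWBPTree, D.hasPassport hb hw⟩

/-- An isomorphism preserves weights and labels, and here a vertex is its pair of weight and label.
So an isomorphism is the identity on vertices, hence on edges, and the cyclic orders agree. -/
lemma PlaneTree.toTreesWith_injective (hb : Ξ.black.Nodup) (hw : Ξ.white.Nodup) :
    Function.Injective (PlaneTree.toTreesWith hb hw) := by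
  intro D D' h
  obtain ⟨i⟩ : Nonempty (D.toLWBPTree.Iso D'.toLWBPTree) := Quotient.exact h
  have hB : ∀ x, i.onB x = x := fun x => by
    have h1 : D'.toLWBPTree.wtBlack (i.onB x) = _ := i.wtBlack_onB x
    exact Subtype.ext (Prod.ext ((D'.wtBlack_toLWBPTree (i.onB x)).symm.trans
      (h1.trans (D.wtBlack_toLWBPTree x))) (i.labBlack_onB x))
  have hW : ∀ y, i.onW y = y := fun y => by
    have h1 : D'.toLWBPTree.wtWhite (i.onW y) = _ := i.wtWhite_onW y
    exact Subtype.ext (Prod.ext ((D'.wtWhite_toLWBPTree (i.onW y)).symm.trans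
      (h1.trans (D.wtWhite_toLWBPTree y))) (i.labWhite_onW y))
  have hE : ∀ e : D.1.1, (i.onE e).1 = e.1 := fun e =>
    Prod.ext ((i.src_onE e).trans (hB _)) ((i.tgt_onE e).trans (hW _))
  have hT : D.1.1 = D'.1.1 := by
    refine Finset.Subset.antisymm (fun e he => ?_) fun e he => ?_
    · have h1 : (i.onE ⟨e, he⟩).1 = e := hE ⟨e, he⟩
      have h2 : (i.onE ⟨e, he⟩).1 ∈ D'.1.1 := (i.onE ⟨e, he⟩).2
      rwa [h1] at h2
    · have h1 : e = (i.onE.symm ⟨e, he⟩).1 :=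
        (congrArg Subtype.val (i.onE.apply_symm_apply ⟨e, he⟩)).symm.trans
          (hE (i.onE.symm ⟨e, he⟩))
      have h2 : (i.onE.symm ⟨e, he⟩).1 ∈ D.1.1 := (i.onE.symm ⟨e, he⟩).2
      rwa [← h1] at h2
  obtain ⟨⟨T, hT₁⟩, ρ, τ⟩ := D
  obtain ⟨⟨T', hT₁'⟩, ρ', τ'⟩ := D'
  obtain rfl : T = T' := hT
  have hE' : ∀ e : T, i.onE e = e := fun e => Subtype.ext (hE e)
  have hρ : ρ = ρ' := by
    refine Subtype.ext (Equiv.ext fun e => ?_)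
    have h1 : ρ'.1 (i.onE e) = i.onE (ρ.1 e) := i.rotBlack_onE e
    rw [hE', hE'] at h1
    exact h1.symm
  have hτ : τ = τ' := by
    refine Subtype.ext (Equiv.ext fun e => ?_)
    have h1 : τ'.1 (i.onE e) = i.onE (τ.1 e) := i.rotWhite_onE e
    rw [hE', hE'] at h1
    exact h1.symm
  rw [hρ, hτ]

/-- Without multiplicities, each vertex of a tree is identified with an entry of the passport.
Edges, cyclic orders and weights are transported along this identification. -/
lemma PlaneTree.toTreesWith_surjective (hb : Ξ.black.Nodup) (hw : Ξ.white.Nodup) :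
    Function.Surjective (PlaneTree.toTreesWith hb hw) := by
  classical
  intro q
  induction q using Quotient.inductionOn with
  | _ X =>
  obtain ⟨X, hX⟩ := X
  obtain ⟨β, hβ⟩ := exists_equiv_of_map_univ_eq hb hX.1
  obtain ⟨ω, hω⟩ := exists_equiv_of_map_univ_eq hw hX.2
  let src : X.E → Ξ.BlackVertex := fun e => β (X.src e)
  let tgt : X.E → Ξ.WhiteVertex := fun e => ω (X.tgt e)
  have hinj : Function.Injective fun e => (src e, tgt e) := by
    intro e e' h
    simp only [Prod.mk.injEq, src, tgt, EmbeddingLike.apply_eq_iff_eq] at h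
    exact X.ends_injective (Prod.ext h.1 h.2)
  let T : Finset (Ξ.BlackVertex × Ξ.WhiteVertex) := Finset.univ.image fun e => (src e, tgt e)
  let ε : X.E ≃ T := Equiv.ofBijective
    (fun e => ⟨(src e, tgt e), Finset.mem_image_of_mem _ (Finset.mem_univ e)⟩)
    ⟨fun e e' h => hinj (Subtype.ext_iff.1 h), fun y => by
      obtain ⟨e, -, he⟩ := Finset.mem_image.1 y.2
      exact ⟨e, Subtype.ext he⟩⟩
  have hε₁ : ∀ y : T, y.1.1 = src (ε.symm y) := fun y => by
    conv_lhs => rw [← ε.apply_symm_apply y]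
    rfl
  have hε₂ : ∀ y : T, y.1.2 = tgt (ε.symm y) := fun y => by
    conv_lhs => rw [← ε.apply_symm_apply y]
    rfl
  have hedges : Ξ.directedEdges T = Finset.univ.image (bicoloredEdge src tgt) := by
    ext x
    simp only [directedEdges, Finset.mem_image, Finset.mem_univ, true_and]
    constructor
    · rintro ⟨y, rfl⟩
      exact ⟨ε.symm y, by simp only [bicoloredEdge, hε₁, hε₂]⟩
    · rintro ⟨e, rfl⟩
      exact ⟨ε e, rfl⟩
  have htree : TreeOn Finset.univ (Ξ.directedEdges T) := by
    rw [hedges, ← bicoloredGraph_isTree_iff hinj]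
    refine (SimpleGraph.Iso.isTree_iff (⟨Equiv.sumCongr β ω, ?_⟩ :
      bicoloredGraph X.src X.tgt ≃g bicoloredGraph src tgt)).1 X.isTree
    rintro (x | x) (y | y) <;>
      simp [bicoloredGraph_adj, bicoloredEdge, src, tgt]
  let f : Ξ.Vertex × Ξ.Vertex → ℤ :=
    Function.extend (bicoloredEdge src tgt) (fun e => (X.weight e : ℤ)) 0
  have hf : ∀ e, f (bicoloredEdge src tgt e) = X.weight e := fun e =>
    (bicoloredEdge_injective hinj).extend_apply _ _ e
  have hnet : ∀ v, netFlow (Ξ.directedEdges T) f v = Ξ.signedWeight v := by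
    rintro (x | y)
    · rw [hedges, netFlow_inl hinj, Finset.sum_congr rfl fun e _ => hf e, ← Nat.cast_sum]
      obtain ⟨b, rfl⟩ := β.surjective x
      simp only [signedWeight, Sum.elim_inl, hβ, WBPTree.wtBlack]
      congr 1
      refine Finset.sum_congr ?_ fun _ _ => rfl
      ext e
      simp [src]
    · rw [hedges, netFlow_inr hinj, Finset.sum_congr rfl fun e _ => hf e, ← Nat.cast_sum]
      obtain ⟨w, rfl⟩ := ω.surjective y
      simp only [signedWeight, Sum.elim_inr, hω, WBPTree.wtWhite]
      congr 2
      refine Finset.sum_congr ?_ fun _ _ => rfl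
      ext e
      simp [tgt]
  have hflow : HasFlow Finset.univ (Ξ.directedEdges T) Ξ.signedWeight := by
    refine ⟨f, fun x hx => ?_, fun v _ => hnet v⟩
    rw [hedges] at hx
    obtain ⟨e, -, rfl⟩ := Finset.mem_image.1 hx
    rw [hf]
    exact_mod_cast X.weight_pos e
  let D : Ξ.PlaneTree := ⟨⟨T, htree, hflow⟩,
    ⟨ε.permCongr X.rotBlack, fun y y' => by
      rw [sameCycle_permCongr, X.rotBlack_sameCycle, hε₁, hε₁]
      exact β.injective.eq_iff.symm⟩,
    ⟨ε.permCongr X.rotWhite, fun y y' => by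
      rw [sameCycle_permCongr, X.rotWhite_sameCycle, hε₂, hε₂]
      exact ω.injective.eq_iff.symm⟩⟩
  refine ⟨D, Quotient.sound ⟨LWBPTree.Iso.symm ?_⟩⟩
  refine ⟨β, ω, ε, fun e => rfl, fun e => rfl, fun e => ?_, fun e => ?_, fun e => ?_,
    fun b => (Prod.ext_iff.1 (hβ b)).2, fun w => (Prod.ext_iff.1 (hω w)).2⟩
  · exact congrArg (fun e' => ε (X.rotBlack e')) (ε.symm_apply_apply e)
  · exact congrArg (fun e' => ε (X.rotWhite e')) (ε.symm_apply_apply e)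
  -- The chosen flow of `D` and the transported weights have the same net outflows, so they agree on
  -- the tree.
  · have h1 := htree.flow_unique (f := D.flow) (f' := f)
      (fun v _ => (D.netFlow_flow v).trans (hnet v).symm) (bicoloredEdge src tgt e)
      (hedges ▸ Finset.mem_image_of_mem _ (Finset.mem_univ e))
    rw [hf] at h1
    have h2 : D.toLWBPTree.weight (ε e) = (D.flow (bicoloredEdge src tgt e)).toNat := rfl
    exact h2.trans (by rw [h1, Int.toNat_natCast])

variable (Ξ) in
lemma directedEdges_injective : Function.Injective Ξ.directedEdges := by
  have key : ∀ (T : Finset (Ξ.BlackVertex × Ξ.WhiteVertex)) (x : Ξ.BlackVertex × Ξ.WhiteVertex),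
      x ∈ T ↔ ((Sum.inl x.1, Sum.inr x.2) : Ξ.Vertex × Ξ.Vertex) ∈ Ξ.directedEdges T := by
    intro T x
    simp only [directedEdges, Finset.mem_image, Finset.mem_univ, true_and, bicoloredEdge,
      Prod.mk.injEq, Sum.inl.injEq, Sum.inr.injEq]
    constructor
    · exact fun hx => ⟨⟨x, hx⟩, rfl, rfl⟩
    · rintro ⟨y, h1, h2⟩
      have h3 : y.1 = x := Prod.ext h1 h2
      exact h3 ▸ y.2
  intro T T' h
  ext x
  rw [key, h, ← key]

variable (Ξ) in
-- The sign of the signed weight is the color, so the edges in `T'` lead from black to white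
-- vertices.
lemma exists_directedEdges_eq {T' : Finset (Ξ.Vertex × Ξ.Vertex)}
    (h : Colored Ξ.signedWeight T') : ∃ T, Ξ.directedEdges T = T' := by
  classical
  have hsome : ∀ x ∈ T', ∃ b w, x = (Sum.inl b, Sum.inr w) := by
    rintro ⟨x | x, y | y⟩ hx
    · have := (h _ hx).2
      simp only [signedWeight, Sum.elim_inl] at this
      omega
    · exact ⟨x, y, rfl⟩
    · have := (h _ hx).1
      simp only [signedWeight, Sum.elim_inr] at this
      omega
    · have := (h _ hx).1
      simp only [signedWeight, Sum.elim_inr] at this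
      omega
  refine ⟨Finset.univ.filter fun x => (Sum.inl x.1, Sum.inr x.2) ∈ T', ?_⟩
  ext x
  simp only [directedEdges, Finset.mem_image, Finset.mem_univ, true_and, bicoloredEdge]
  constructor
  · rintro ⟨y, rfl⟩
    exact (Finset.mem_filter.1 y.2).2
  · intro hx
    obtain ⟨b, w, rfl⟩ := hsome x hx
    exact ⟨⟨(b, w), Finset.mem_filter.2 ⟨Finset.mem_univ _, hx⟩⟩, rfl⟩

variable (Ξ) in
lemma colored_directedEdges (T : Finset (Ξ.BlackVertex × Ξ.WhiteVertex)) :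
    Colored Ξ.signedWeight (Ξ.directedEdges T) := by
  intro x hx
  obtain ⟨e, -, rfl⟩ := Finset.mem_image.1 hx
  have h1 := Ξ.black_pos _ e.1.1.2
  have h2 := Ξ.white_pos _ e.1.2.2
  simp only [bicoloredEdge, signedWeight, Sum.elim_inl, Sum.elim_inr]
  omega

theorem finite_treesWith (hb : Ξ.black.Nodup) (hw : Ξ.white.Nodup) : Finite (TreesWith Ξ) :=
  Finite.of_surjective _ (PlaneTree.toTreesWith_surjective hb hw)

/-- The number of trees with a passport without multiplicities. -/
theorem card_treesWith (hb : Ξ.black.Nodup) (hw : Ξ.white.Nodup) :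
    Nat.card (TreesWith Ξ) = planeTreeSum Ξ.signedWeight := by
  classical
  rw [← Nat.card_congr (Equiv.ofBijective _ ⟨PlaneTree.toTreesWith_injective hb hw,
    PlaneTree.toTreesWith_surjective hb hw⟩), Nat.card_sigma, planeTreeSum]
  refine Finset.sum_bij (fun T _ => Ξ.directedEdges T.1) ?_ ?_ ?_ ?_
  · intro T _
    exact Finset.mem_filter.2
      ⟨Finset.mem_univ _, T.2.1, Ξ.colored_directedEdges T.1, T.2.2⟩
  · intro T _ T' _ h
    exact Subtype.ext (Ξ.directedEdges_injective h)
  · intro T' hT'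
    obtain ⟨-, h1, h2, h3⟩ := Finset.mem_filter.1 hT'
    obtain ⟨T, rfl⟩ := Ξ.exists_directedEdges_eq h2
    exact ⟨⟨T, h1, h3⟩, Finset.mem_univ _, rfl⟩
  · intro T _
    rw [Nat.card_prod, card_sameCycle_fibers (fun e : T.1 => e.1.1),
      card_sameCycle_fibers (fun e : T.1 => e.1.2), Fintype.prod_sum_type]
    congr 1
    · refine Finset.prod_congr rfl fun b _ => ?_
      rw [directedEdges, edgeDeg_inl (Ξ.ends_injective T.1)]
    · refine Finset.prod_congr rfl fun w _ => ?_
      rw [directedEdges, edgeDeg_inr (Ξ.ends_injective T.1)]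

end LabeledPassport

end PlaneTrees

/-! ## Fillings -/

section Fillings

variable {S : Type}

lemma fillMultiset_nodup (A : Multiset (ℕ × S)) : (fillMultiset A).Nodup := by
  classical
  refine Multiset.Nodup.map ?_ (Finset.nodup _)
  rintro ⟨⟨K, k⟩, i⟩ ⟨⟨K', k'⟩, i'⟩ h
  simp only [Prod.mk.injEq, add_left_inj] at h
  obtain ⟨rfl, rfl, rfl⟩ := h
  rfl

lemma map_fillMultiset (A : Multiset (ℕ × S)) :
    ((fillMultiset A).map fun y => (y.1, y.2.1)) = A := by
  classical
  rw [fillMultiset, Multiset.map_map]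
  exact A.map_toEnumFinset_fst

namespace LabeledPassport

variable {α : Type*} [AddCommMonoid α]

/-- Forgetting the counters that the filling adds recovers the original multisets. Cardinalities and
sums over the filled vertices can therefore be computed in Ξ. -/
lemma sum_vertex_fill [DecidableEq S] (Ξ : LabeledPassport S) (F G : ℕ × S → α) :
    ∑ v : Ξ.fill.Vertex, Sum.elim (fun x => F (x.1.1, x.1.2.1)) (fun y => G (y.1.1, y.1.2.1)) v =
      (Ξ.black.map F).sum + (Ξ.white.map G).sum := by
  rw [Fintype.sum_sum_type]
  have hB : (Finset.univ : Finset Ξ.fill.BlackVertex).val.map (fun x => (x.1.1, x.1.2.1)) =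
      Ξ.black := by
    refine Eq.trans ?_ (map_fillMultiset Ξ.black)
    conv_rhs => rw [← map_val_univ (m := fillMultiset Ξ.black) (fillMultiset_nodup Ξ.black),
      Multiset.map_map]
    rfl
  have hW : (Finset.univ : Finset Ξ.fill.WhiteVertex).val.map (fun x => (x.1.1, x.1.2.1)) =
      Ξ.white := by
    refine Eq.trans ?_ (map_fillMultiset Ξ.white)
    conv_rhs => rw [← map_val_univ (m := fillMultiset Ξ.white) (fillMultiset_nodup Ξ.white),
      Multiset.map_map]
    rfl
  conv_rhs => rw [← hB, ← hW, Multiset.map_map, Multiset.map_map]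
  rfl

/-- The vertices of a passport with a single vertex labeled by the star. -/
theorem exists_star_vertex [DecidableEq S] (Ξ : LabeledPassport (Option S))
    {B W : Multiset (ℕ × Option S)} {P Q a b : ℕ} {k : S}
    (hB : Ξ.black = B + Multiset.replicate P (a, some k))
    (hW : Ξ.white = W + Multiset.replicate Q (b, some k))
    (hBn : ∀ x ∈ B, x.2 = none) (hWn : ∀ x ∈ W, x.2 = none) (hcard : B.card + W.card = 1) :
    ∃ star : Ξ.fill.Vertex,
      (∀ v, v ≠ star → Ξ.fill.signedWeight v = a ∨ Ξ.fill.signedWeight v = -(b : ℤ)) ∧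
      ((Finset.univ.erase star).filter fun v => Ξ.fill.signedWeight v = a).card = P ∧
      ((Finset.univ.erase star).filter fun v => ¬ Ξ.fill.signedWeight v = a).card = Q ∧
      Fintype.card Ξ.fill.Vertex = P + Q + 1 := by
  have hmemB : ∀ x : Ξ.fill.BlackVertex, (x.1.1, x.1.2.1) ∈ Ξ.black := fun x => by
    have h := Multiset.mem_map_of_mem (fun y : ℕ × (Option S × ℕ) => (y.1, y.2.1)) x.2
    exact map_fillMultiset Ξ.black ▸ h
  have hmemW : ∀ x : Ξ.fill.WhiteVertex, (x.1.1, x.1.2.1) ∈ Ξ.white := fun x => by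
    have h := Multiset.mem_map_of_mem (fun y : ℕ × (Option S × ℕ) => (y.1, y.2.1)) x.2
    exact map_fillMultiset Ξ.white ▸ h
  let lab : Ξ.fill.Vertex → Option S := Sum.elim (fun x => x.1.2.1) fun y => y.1.2.1
  have hnone : (Finset.univ.filter fun v => lab v = none).card = 1 := by
    rw [Finset.card_filter]
    refine Eq.trans (Finset.sum_congr rfl ?_) ((Ξ.sum_vertex_fill
      (fun x => if x.2 = none then 1 else 0) fun x => if x.2 = none then 1 else 0).trans ?_)
    · rintro (x | y) _ <;> rfl
    · rw [hB, hW, Multiset.map_add, Multiset.map_add, Multiset.sum_add, Multiset.sum_add,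
        Multiset.map_congr rfl fun x hx => if_pos (hBn x hx),
        Multiset.map_congr rfl fun x hx => if_pos (hWn x hx)]
      simpa using hcard
  have hblack : (Finset.univ.filter fun v : Ξ.fill.Vertex => v.isLeft ∧ lab v ≠ none).card = P := by
    rw [Finset.card_filter]
    refine Eq.trans (Finset.sum_congr rfl ?_) ((Ξ.sum_vertex_fill
      (fun x => if x.2 = none then 0 else 1) fun x => 0).trans ?_)
    · rintro (x | y) _ <;> simp [lab]
    · rw [hB, Multiset.map_add, Multiset.sum_add,
        Multiset.map_congr rfl fun x hx => if_pos (hBn x hx)]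
      simp
  have htotal : Fintype.card Ξ.fill.Vertex = P + Q + 1 := by
    rw [Fintype.card_eq_sum_ones]
    refine Eq.trans (Finset.sum_congr rfl ?_) ((Ξ.sum_vertex_fill
      (fun x => 1) fun x => 1).trans ?_)
    · rintro (x | y) _ <;> rfl
    · rw [hB, hW]
      simp
      omega
  obtain ⟨star, hstar⟩ := Finset.card_eq_one.1 hnone
  have hstar' : ∀ v, lab v = none ↔ v = star := fun v => by
    refine Iff.trans ?_ (Finset.mem_singleton (a := star))
    rw [← hstar, Finset.mem_filter]
    exact (and_iff_right (Finset.mem_univ v)).symm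
  have hother : ∀ v, v ≠ star → lab v ≠ none := fun v hv => mt (hstar' v).1 hv
  have hvB : ∀ x : Ξ.fill.BlackVertex, lab (Sum.inl x) ≠ none → x.1.1 = a := fun x hx => by
    have h1 := hmemB x
    rw [hB, Multiset.mem_add] at h1
    rcases h1 with h1 | h1
    · exact (hx (hBn _ h1)).elim
    · exact congrArg Prod.fst (Multiset.eq_of_mem_replicate h1)
  have hvW : ∀ x : Ξ.fill.WhiteVertex, lab (Sum.inr x) ≠ none → x.1.1 = b := fun x hx => by
    have h1 := hmemW x
    rw [hW, Multiset.mem_add] at h1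
    rcases h1 with h1 | h1
    · exact (hx (hWn _ h1)).elim
    · exact congrArg Prod.fst (Multiset.eq_of_mem_replicate h1)
  have hP : ((Finset.univ.erase star).filter fun v => Ξ.fill.signedWeight v = a).card = P := by
    rw [← hblack]
    congr 1
    ext v
    simp only [Finset.mem_filter, Finset.mem_erase, Finset.mem_univ, and_true, true_and,
      ← hstar', ne_eq]
    rcases v with x | y
    · simp only [signedWeight, Sum.elim_inl, Sum.isLeft_inl, true_and, Nat.cast_inj]
      exact ⟨fun h => h.1, fun h => ⟨h, hvB x h⟩⟩
    -- The signed weight of a white vertex is negative, whereas a is a natural number.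
    · have := Ξ.fill.white_pos y.1 y.2
      simp only [signedWeight, Sum.elim_inr, Sum.isLeft_inr, Bool.false_eq_true, false_and, iff_false]
      omega
  refine ⟨star, fun v hv => ?_, hP, ?_, htotal⟩
  · rcases v with x | y
    · exact .inl (congrArg Nat.cast (hvB x (hother _ hv)))
    · exact .inr (congrArg (fun n : ℕ => -(n : ℤ)) (hvW y (hother _ hv)))
  · have h1 := Finset.card_filter_add_card_filter_not (s := Finset.univ.erase star)
      (fun v => Ξ.fill.signedWeight v = a)
    rw [hP, Finset.card_erase_of_mem (Finset.mem_univ _), Finset.card_univ, htotal] at h1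
    omega

end LabeledPassport

end Fillings

/-! ## Coefficients of the exponential of a polynomial -/

section ExpCoeff

/-- The coefficients of `exp (∑ i, w i * X ^ (i + 1))`, given by their recursion. -/
noncomputable def expCoeff (w : ℕ → ℚ) : ℕ → ℚ
  | 0 => 1
  | j + 1 => (∑ i : Fin (j + 1), ((i : ℕ) + 1 : ℚ) * w i * expCoeff w (j - i)) / (j + 1)
decreasing_by omega

lemma expCoeff_zero (w : ℕ → ℚ) : expCoeff w 0 = 1 := by
  rw [expCoeff]

lemma mul_expCoeff (w : ℕ → ℚ) (j : ℕ) :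
    (j : ℚ) * expCoeff w j =
      ∑ i ∈ Finset.range j, ((i : ℚ) + 1) * w i * expCoeff w (j - (i + 1)) := by
  cases j with
  | zero => simp
  | succ j =>
    have h : ((j : ℚ) + 1) ≠ 0 := by positivity
    rw [expCoeff, Nat.cast_succ, mul_div_cancel₀ _ h,
      Fin.sum_univ_eq_sum_range (fun i => ((i : ℚ) + 1) * w i * expCoeff w (j - i))]
    simp only [Nat.add_sub_add_right]

/-- The partitions of `j` into parts of size at most `g`, given by the multiplicities `n i` of the
parts `i + 1`. -/
def partMults (g j : ℕ) : Finset (Fin g → ℕ) :=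
  (Fintype.piFinset fun _ => Finset.range (j + 1)).filter
    fun n => ∑ i : Fin g, ((i : ℕ) + 1) * n i = j

lemma mem_partMults {g j : ℕ} {n : Fin g → ℕ} :
    n ∈ partMults g j ↔ ∑ i : Fin g, ((i : ℕ) + 1) * n i = j := by
  simp only [partMults, Finset.mem_filter, Fintype.mem_piFinset, Finset.mem_range,
    and_iff_right_iff_imp]
  intro h i
  have h1 : ((i : ℕ) + 1) * n i ≤ ∑ i : Fin g, ((i : ℕ) + 1) * n i :=
    Finset.single_le_sum (f := fun i : Fin g => ((i : ℕ) + 1) * n i)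
      (fun _ _ => Nat.zero_le _) (Finset.mem_univ i)
  have h2 : n i ≤ ((i : ℕ) + 1) * n i := Nat.le_mul_of_pos_left _ (Nat.succ_pos _)
  omega

/-- The product of the coefficients `w ^ n / n !` of exponential series. -/
def expTerm {g : ℕ} (w : ℕ → ℚ) (n : Fin g → ℕ) : ℚ := ∏ i : Fin g, w i ^ n i / (n i)!

lemma expTerm_add_single {g : ℕ} (w : ℕ → ℚ) (n : Fin g → ℕ) (i : Fin g) :
    ((n i : ℚ) + 1) * expTerm w (n + Pi.single i 1) = w i * expTerm w n := by
  unfold expTerm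
  rw [← Finset.mul_prod_erase _ _ (Finset.mem_univ i),
    ← Finset.mul_prod_erase (a := i) _ (fun k : Fin g => w k ^ n k / ((n k)! : ℚ))
      (Finset.mem_univ i)]
  have h : ∏ k ∈ Finset.univ.erase i, w k ^ (n + Pi.single i 1 : Fin g → ℕ) k /
      (((n + Pi.single i 1 : Fin g → ℕ) k)! : ℚ) =
      ∏ k ∈ Finset.univ.erase i, w k ^ n k / ((n k)! : ℚ) :=
    Finset.prod_congr rfl fun k hk => by
      rw [Pi.add_apply, Pi.single_eq_of_ne (Finset.ne_of_mem_erase hk), add_zero]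
  rw [h, Pi.add_apply, Pi.single_eq_same, Nat.factorial_succ]
  have h1 : ((n i : ℚ) + 1) ≠ 0 := by positivity
  push_cast
  field_simp
  ring

/-- Removing one part of size i + 1 is a bijection onto the partitions of j, apart from partitions
without such a part, which the factor n i annihilates. -/
lemma sum_partMults_mul {g j : ℕ} (w : ℕ → ℚ) (i : Fin g) :
    ∑ n ∈ partMults g (j + (i + 1)), (n i : ℚ) * expTerm w n =
      w i * ∑ n ∈ partMults g j, expTerm w n := by
  have hsum : ∀ n : Fin g → ℕ, ∑ k : Fin g, ((k : ℕ) + 1) * (n + Pi.single i 1 : Fin g → ℕ) k =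
      (∑ k : Fin g, ((k : ℕ) + 1) * n k) + (i + 1) := fun n => by
    simp [mul_add, Finset.sum_add_distrib, Pi.single_apply]
  rw [Finset.mul_sum]
  symm
  refine Finset.sum_bij_ne_zero (fun n _ _ => n + Pi.single i 1) ?_ ?_ ?_ ?_
  · intro n hn _
    rw [mem_partMults] at hn ⊢
    rw [hsum, hn]
  · intro n _ _ n' _ _ h
    exact add_right_cancel h
  · intro n hn h0
    have hpos : n i ≠ 0 := fun h => h0 (by rw [h, Nat.cast_zero, zero_mul])
    have hn' : n - Pi.single i 1 + Pi.single i 1 = n := by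
      ext k
      rcases eq_or_ne k i with rfl | hk
      · simp only [Pi.add_apply, Pi.sub_apply, Pi.single_eq_same]
        omega
      · simp [hk]
    have hmem : n - Pi.single i 1 ∈ partMults g j := by
      rw [mem_partMults] at hn ⊢
      rw [← hn', hsum] at hn
      omega
    refine ⟨n - Pi.single i 1, hmem, ?_, hn'⟩
    rw [← expTerm_add_single, hn']
    intro h
    rcases mul_eq_zero.1 h with h | h
    · norm_cast at h
    · exact h0 (by rw [h, mul_zero])
  · intro n _ _
    rw [← expTerm_add_single, Pi.add_apply, Pi.single_eq_same, Nat.cast_succ]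

/-- For a partition of j one has j = ∑ (i + 1) n i. Multiplying by j thus turns the right side into
the recursion that defines `expCoeff`, as for F' = W' F with F = exp W. The bound j ≤ g ensures that
all part sizes up to j are available. -/
theorem expCoeff_eq_sum_partMults (w : ℕ → ℚ) {g j : ℕ} (hj : j ≤ g) :
    expCoeff w j = ∑ n ∈ partMults g j, expTerm w n := by
  induction j using Nat.strong_induction_on with
  | _ j ih =>
  rcases Nat.eq_zero_or_pos j with rfl | hpos
  · have h : partMults g 0 = {0} := by
      ext n
      rw [mem_partMults, Finset.mem_singleton]
      simp [funext_iff]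
    rw [expCoeff_zero, h, Finset.sum_singleton]
    simp [expTerm]
  · have hj0 : (j : ℚ) ≠ 0 := by positivity
    refine mul_left_cancel₀ hj0 ?_
    have h1 : ∀ n ∈ partMults g j, (j : ℚ) * expTerm w n =
        ∑ i : Fin g, ((i : ℚ) + 1) * ((n i : ℚ) * expTerm w n) := fun n hn => by
      rw [mem_partMults] at hn
      conv_lhs => rw [← hn]
      push_cast
      rw [Finset.sum_mul]
      exact Finset.sum_congr rfl fun i _ => mul_assoc _ _ _
    have h2 : ∀ i : Fin g, ∑ n ∈ partMults g j, ((i : ℚ) + 1) * ((n i : ℚ) * expTerm w n) =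
        if (i : ℕ) ∈ Finset.range j then ((i : ℚ) + 1) * w i * expCoeff w (j - (i + 1)) else 0 := by
      intro i
      rw [← Finset.mul_sum]
      split_ifs with hi
      · obtain ⟨k, rfl⟩ := Nat.exists_eq_add_of_le' (Nat.succ_le_of_lt (Finset.mem_range.1 hi))
        rw [sum_partMults_mul, mul_assoc, Nat.add_sub_cancel, ih k (by omega) (by omega)]
      · refine mul_eq_zero_of_right _ (Finset.sum_eq_zero fun n hn => ?_)
        rw [mem_partMults] at hn
        have h3 : ((i : ℕ) + 1) * n i ≤ ∑ i : Fin g, ((i : ℕ) + 1) * n i :=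
          Finset.single_le_sum (f := fun i : Fin g => ((i : ℕ) + 1) * n i)
            (fun _ _ => Nat.zero_le _) (Finset.mem_univ i)
        have h4 : n i = 0 := by
          by_contra h
          have h5 := Nat.le_mul_of_pos_right ((i : ℕ) + 1) (Nat.pos_of_ne_zero h)
          rw [Finset.mem_range] at hi
          omega
        rw [h4, Nat.cast_zero, zero_mul]
    rw [mul_expCoeff, Finset.mul_sum, Finset.sum_congr rfl h1, Finset.sum_comm,
      Finset.sum_congr rfl fun i _ => h2 i, Fin.sum_univ_eq_sum_range (fun i =>
        if i ∈ Finset.range j then ((i : ℚ) + 1) * w i * expCoeff w (j - (i + 1)) else 0),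
      Finset.sum_ite_mem, Finset.inter_eq_right.2 (Finset.range_subset_range.2 hj)]

end ExpCoeff

/-! ### The number of trees with one star and two other weights -/

section Count

/-- The weight of a block with `j` units in the formula for the number of trees. -/
noncomputable def blockCoeff (p' q' : ℕ) (j : ℕ) : ℚ :=
  ((j * (p' + q') - 1)! : ℚ) / ((j * p')! * (j * q')!)

/-- The factor j (p' + q') makes the Lagrange recursion, which involves binomial coefficients, the
recursion for the exponential of a series with block coefficients. -/
lemma choose_eq_mul_blockCoeff {p' q' j : ℕ} (hp : 0 < p') (hj : 0 < j) :
    ((j * (p' + q')).choose (j * p') : ℚ) = j * (p' + q') * blockCoeff p' q' j := by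
  have h1 := Nat.add_choose_mul_factorial_mul_factorial (j * p') (j * q')
  have h2 : j * p' + j * q' ≠ 0 := by positivity
  rw [← Nat.choose_symm_add, ← Nat.mul_factorial_pred h2, ← mul_add] at h1
  have h3 : ((j * p')! : ℚ) ≠ 0 := by positivity
  have h4 : ((j * q')! : ℚ) ≠ 0 := by positivity
  rw [blockCoeff, mul_div_assoc', eq_div_iff (mul_ne_zero h3 h4), ← mul_assoc]
  exact_mod_cast h1

namespace LabeledPassport

variable {S : Type} [DecidableEq S]

/-- The number of trees with a passport with a single vertex labeled by the star, two other labeled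
weights, and total weight zero. -/
theorem card_FTree_of_star (Ξ : LabeledPassport (Option S)) {B W : Multiset (ℕ × Option S)}
    {P Q g p' q' J : ℕ} {k : S}
    (hB : Ξ.black = B + Multiset.replicate P (g * q', some k))
    (hW : Ξ.white = W + Multiset.replicate Q (g * p', some k))
    (hBn : ∀ x ∈ B, x.2 = none) (hWn : ∀ x ∈ W, x.2 = none) (hcard : B.card + W.card = 1)
    (hsum : (B.map Prod.fst).sum + P * (g * q') = (W.map Prod.fst).sum + Q * (g * p'))
    (hg : 0 < g) (hco : p'.Coprime q') (hp : 0 < p') (hPQ : 0 < P + Q)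
    (hJ : ∀ j, j * p' ≤ P ∧ j * q' ≤ Q ↔ j ≤ J) :
    ((P + Q : ℕ) : ℚ) * Nat.card (FTree Ξ) = P ! * Q ! * ∑ j ∈ Finset.range (J + 1),
      ((P + Q - j * (p' + q')).choose (P - j * p') : ℚ) *
        expCoeff (fun i => -((P + Q : ℕ) : ℚ) * blockCoeff p' q' (i + 1)) j := by
  obtain ⟨star, hsv, hP, hQ, htotal⟩ := Ξ.exists_star_vertex hB hW hBn hWn hcard
  have hs0 : ∑ v, Ξ.fill.signedWeight v = 0 := by
    refine Eq.trans (Finset.sum_congr rfl ?_) ((Ξ.sum_vertex_fill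
      (fun x => (x.1 : ℤ)) fun x => -(x.1 : ℤ)).trans ?_)
    · rintro (x | y) _ <;> rfl
    · have h1 : ∀ A : Multiset (ℕ × Option S),
          (A.map fun x => (x.1 : ℤ)).sum = ((A.map Prod.fst).sum : ℕ) := fun A => by
        rw [Nat.cast_multiset_sum, Multiset.map_map]
        rfl
      rw [Multiset.sum_map_neg, h1, h1, hB, hW]
      simp only [Multiset.map_add, Multiset.sum_add, Multiset.map_replicate,
        Multiset.sum_replicate, smul_eq_mul, hsum, add_neg_cancel]
  have hstar : Ξ.fill.signedWeight star + P * (g * q' : ℕ) - Q * (g * p' : ℕ) = 0 := by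
    rw [← Finset.add_sum_erase _ _ (Finset.mem_univ star), ← Finset.sum_filter_add_sum_filter_not
      (Finset.univ.erase star) (fun v => Ξ.fill.signedWeight v = (g * q' : ℕ)),
      Finset.sum_congr rfl fun v hv => (Finset.mem_filter.1 hv).2, Finset.sum_const, hP,
      Finset.sum_congr rfl (g := fun _ => -((g * p' : ℕ) : ℤ)) fun v hv => ?_,
      Finset.sum_const, hQ] at hs0
    · rw [← hs0]
      simp only [nsmul_eq_mul]
      ring
    · obtain ⟨h1, h2⟩ := Finset.mem_filter.1 hv
      exact (hsv v (Finset.ne_of_mem_erase h1)).resolve_left h2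
  have hmain := rootedSum_univ_eq Ξ.fill.signedWeight_ne_zero star hg hco hp hP hQ hsv hstar hJ
    (expCoeff_zero fun i => -((P + Q : ℕ) : ℚ) * blockCoeff p' q' (i + 1)) fun j => by
      rw [mul_right_comm, mul_expCoeff, Finset.sum_mul, Finset.mul_sum, ← Finset.sum_neg_distrib]
      refine Finset.sum_congr rfl fun i _ => ?_
      rw [choose_eq_mul_blockCoeff hp (Nat.succ_pos i)]
      push_cast
      ring
  -- There are P + Q + 1 vertices, so the number of possible root edges is P + Q.
  rw [← hmain, rootedSum, if_neg (by rw [Finset.card_univ]; omega), zero_add,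
    edgeRootedSum_univ hs0, htotal, FTree,
    card_treesWith (fillMultiset_nodup Ξ.black) (fillMultiset_nodup Ξ.white)]
  push_cast
  ring

end LabeledPassport

end Count

/-! ## The divided passports of `(q ^ p, p ^ q)` -/

section Divided

lemma divMult_replicate {α : Type} (d n : ℕ) (x : α) :
    divMult d (Multiset.replicate n x) = Multiset.replicate (n / d) x := by
  classical
  rcases Nat.eq_zero_or_pos n with rfl | hn
  · simp [divMult]
  · rw [divMult]
    have h : (Multiset.replicate n x).toFinset = {x} := by
      ext y
      simp [hn.ne']
    rw [Finset.sum_congr (s₂ := {x}) (by convert h) fun _ _ => rfl, Finset.sum_singleton]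
    rw [Multiset.nsmul_singleton]
    congr 2
    convert Multiset.count_replicate_self x n

lemma plainPart_replicate {S : Type} (d n : ℕ) (x : ℕ × S) :
    plainPart d (Multiset.replicate n x) = Multiset.replicate (n / d) (addStar x) := by
  rw [plainPart, divMult_replicate, Multiset.map_replicate]

lemma centerPart_replicate {S : Type} (d n : ℕ) (x : ℕ × S) :
    centerPart d (Multiset.replicate n x) x =
      {(x.1 / d, none)} + Multiset.replicate ((n - 1) / d) (addStar x) := by
  classical
  have h : (Multiset.replicate n x).erase x = Multiset.replicate (n - 1) x := by
    cases n with
    | zero => simp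
    | succ n => rw [Multiset.replicate_succ, Multiset.erase_cons_head, Nat.add_sub_cancel]
  rw [centerPart, Multiset.singleton_add]
  congr 1
  rw [← Multiset.map_replicate, ← divMult_replicate]
  exact congrArg (fun A => (divMult d A).map addStar) (by convert h)

/-- `B` is empty or a single star, whose multiplicity contributes the factor 1! = 1. -/
lemma prod_factorial_count_add_replicate {α : Type} {_ : DecidableEq α} {B : Multiset α} {x : α}
    (hB : B.card ≤ 1) (hx : x ∉ B) (n : ℕ) :
    ∏ y ∈ (B + Multiset.replicate n x).toFinset, ((B + Multiset.replicate n x).count y)! = n ! := by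
  have hsub : (B + Multiset.replicate n x).toFinset ⊆ insert x B.toFinset := by
    intro y hy
    rw [Multiset.mem_toFinset, Multiset.mem_add] at hy
    rcases hy with hy | hy
    · exact Finset.mem_insert_of_mem (Multiset.mem_toFinset.2 hy)
    · exact Finset.mem_insert.2 (.inl (Multiset.eq_of_mem_replicate hy))
  rw [Finset.prod_subset hsub fun y _ hy => by
      rw [Multiset.count_eq_zero_of_notMem (mt Multiset.mem_toFinset.2 hy), Nat.factorial_zero],
    Finset.prod_insert (mt Multiset.mem_toFinset.1 hx), Multiset.count_add,
    Multiset.count_eq_zero_of_notMem hx, Multiset.count_replicate_self, zero_add,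
    Finset.prod_eq_one, mul_one]
  intro y hy
  rw [Multiset.mem_toFinset] at hy
  have hne : x ≠ y := fun h => hx (h ▸ hy)
  rw [Multiset.count_add, Multiset.count_replicate, if_neg hne, add_zero, Nat.factorial_eq_one]
  exact (Multiset.count_le_card y B).trans hB

lemma LabeledPassport.multFactorial_of_star {S : Type} (Ξ : LabeledPassport (Option S))
    {B W : Multiset (ℕ × Option S)} {P Q a b : ℕ} {k : S}
    (hB : Ξ.black = B + Multiset.replicate P (a, some k))
    (hW : Ξ.white = W + Multiset.replicate Q (b, some k))
    (hBn : ∀ x ∈ B, x.2 = none) (hWn : ∀ x ∈ W, x.2 = none) (hcard : B.card + W.card = 1) :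
    Ξ.multFactorial = P ! * Q ! := by
  rw [multFactorial, hB, hW]
  exact congrArg₂ (· * ·)
    (prod_factorial_count_add_replicate (by omega)
      (fun h => absurd (hBn _ h) (Option.some_ne_none k)) P)
    (prod_factorial_count_add_replicate (by omega)
      (fun h => absurd (hWn _ h) (Option.some_ne_none k)) Q)

end Divided

/-! ## The terms of the formula -/

section Terms

/-- The number s is determined by the partition: if the n_j describe a partition of j, then s =
⌊g/d⌋ - j. -/
lemma sum_typeSet (p q d : ℕ) (F : ℕ → (Fin (p.gcd q) → ℕ) → ℚ) :
    ∑ t ∈ typeSet p q d, F t.1 t.2 = ∑ j ∈ Finset.range (p.gcd q / d + 1),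
      ∑ n ∈ partMults (p.gcd q) j, F (p.gcd q / d - j) n := by
  rw [Finset.sum_sigma']
  refine Finset.sum_nbij' (fun t => ⟨∑ i : Fin (p.gcd q), ((i : ℕ) + 1) * t.2 i, t.2⟩)
    (fun x => (p.gcd q / d - x.1, x.2)) ?_ ?_ ?_ ?_ ?_
  · intro t ht
    rw [mem_typeSet] at ht
    simp only [Finset.mem_sigma, Finset.mem_range, mem_partMults, and_true]
    omega
  · rintro ⟨j, n⟩ hx
    simp only [Finset.mem_sigma, Finset.mem_range, mem_partMults] at hx
    rw [mem_typeSet]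
    simp only [hx.2]
    omega
  · rintro ⟨s, n⟩ ht
    rw [mem_typeSet] at ht
    simp only at ht ⊢
    rw [← ht, Nat.add_sub_cancel]
  · rintro ⟨j, n⟩ hx
    simp only [Finset.mem_sigma, Finset.mem_range, mem_partMults] at hx
    obtain ⟨-, rfl⟩ := hx
    rfl
  · rintro ⟨s, n⟩ ht
    rw [mem_typeSet] at ht
    simp only at ht ⊢
    rw [← ht, Nat.add_sub_cancel]

variable {p q d p' q' : ℕ}

/-- Since p + q - 1 = d M, the prefactor is (-M)^(n-1) / (p + q - 1), and n - 1 is the number of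
blocks without the center. Each such block thus receives a factor -M. -/
lemma prefactor_mul_blockProd (hp : p = p.gcd q * p') (hq : q = p.gcd q * q')
    (hg : 0 < p.gcd q) (hd : 0 < d) {M : ℕ} (hM : (d : ℚ) * M = p + q - 1) (hM0 : 0 < M)
    (n : Fin (p.gcd q) → ℕ) :
    prefactor p q d (numBlocks n) * blockProd p q n =
      expTerm (fun i => -(M : ℚ) * blockCoeff p' q' (i + 1)) n / (p + q - 1) := by
  have hdiv : ∀ k a a' : ℕ, a = p.gcd q * a' → k * a / p.gcd q = k * a' := fun k a a' h =>
    Nat.div_eq_of_eq_mul_left hg (by rw [h]; ring)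
  have hblock : blockProd p q n =
      ∏ i : Fin (p.gcd q), blockCoeff p' q' (i + 1) ^ n i / ((n i)! : ℚ) := by
    refine Finset.prod_congr rfl fun i _ => ?_
    rw [hdiv _ _ _ hp, hdiv _ _ _ hq, hdiv _ _ (p' + q') (by rw [mul_add, ← hp, ← hq]),
      blockCoeff, one_div, inv_mul_eq_div]
  have hd' : (d : ℚ) ≠ 0 := by positivity
  have hM' : (M : ℚ) ≠ 0 := by positivity
  rw [prefactor, numBlocks, Nat.add_sub_cancel_left, hblock, expTerm, ← hM]
  simp only [mul_pow, mul_div_assoc]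
  rw [Finset.prod_mul_distrib, Finset.prod_pow_eq_pow_sum]
  -- The exponent n - 2 is -1 if there is only the block with the center, hence the integral power.
  have h4 : ((1 + ∑ i, n i : ℕ) : ℤ) - 2 = (∑ i, n i : ℕ) - 1 := by push_cast; ring
  rw [h4, zpow_sub_one₀ (mul_ne_zero hd' hM'), zpow_natCast, mul_pow, neg_pow (M : ℚ)]
  field_simp

/-- For s = ⌊g/d⌋ - j, the shifted number s + {g/d} is g/d - j. Hence the upper entry is (p + q -
1)/d - j(p' + q') and the lower one is r/d - j r'. -/
lemma centerBinom_eq (hp : p = p.gcd q * p') (hq : q = p.gcd q * q')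
    (hg : 0 < p.gcd q) (hd : 0 < d) {M : ℕ} (hM : (d : ℚ) * M = p + q - 1) {r r' R : ℕ}
    (hr : r = p.gcd q * r') (hR : r = d * R) {j : ℕ} (hj : j ≤ p.gcd q / d)
    (hjM : j * (p' + q') ≤ M) (hjR : j * r' ≤ R) :
    centerBinom p q d (p.gcd q / d - j) r = (M - j * (p' + q')).choose (R - j * r') := by
  have hd' : (d : ℚ) ≠ 0 := by positivity
  have hg' : (p.gcd q : ℚ) ≠ 0 := by positivity
  have hs : shifted p q d (p.gcd q / d - j) = (p.gcd q : ℚ) / d - j := by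
    have h1 : Int.fract ((p.gcd q : ℚ) / d) = (p.gcd q : ℚ) / d - (p.gcd q / d : ℕ) := by
      rw [Int.fract, Rat.floor_natCast_div_natCast]
      norm_cast
    rw [shifted, h1, Nat.cast_sub hj]
    ring
  have hpQ : (p : ℚ) = p.gcd q * p' := by exact_mod_cast hp
  have hqQ : (q : ℚ) = p.gcd q * q' := by exact_mod_cast hq
  have hrQ : (r : ℚ) = p.gcd q * r' := by exact_mod_cast hr
  have hRQ : (r : ℚ) = d * R := by exact_mod_cast hR
  have h1 : ((p.gcd q : ℚ) / d - j) * ((p + q : ℚ) / p.gcd q) - 1 / d =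
      ((M - j * (p' + q') : ℕ) : ℚ) := by
    have h2 : (p + q : ℚ) / p.gcd q = p' + q' := by
      rw [div_eq_iff hg', hpQ, hqQ]
      ring
    have h3 : (M : ℚ) = (p.gcd q * (p' + q') - 1) / d := by
      rw [eq_div_iff hd', mul_comm, hM, hpQ, hqQ]
      ring
    rw [h2, Nat.cast_sub hjM, h3]
    push_cast
    ring
  have h2 : ((p.gcd q : ℚ) / d - j) * ((r : ℚ) / p.gcd q) = ((R - j * r' : ℕ) : ℚ) := by
    have h3 : (r : ℚ) / p.gcd q = r' := by
      rw [div_eq_iff hg', hrQ]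
      ring
    have h4 : (R : ℚ) = p.gcd q * r' / d := by
      rw [eq_div_iff hd', mul_comm, ← hRQ, hrQ]
    rw [h3, Nat.cast_sub hjR, h4]
    push_cast
    ring
  rw [centerBinom, hs, h1, h2, Nat.floor_natCast, Nat.floor_natCast]

end Terms

/-! ### The formula for the two kinds of divided passports -/

section Main

variable {p q d p' q' P Q : ℕ}

/-- The formula for a divided passport whose star is given by `B` and `W`. -/
theorem finite_and_treeG_eq {Ξ : LabeledPassport Unit} {Ξ' : LabeledPassport (Option Unit)}
    {B W : Multiset (ℕ × Option Unit)} (hdiv : Ξ.divided d = Ξ')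
    (hB : Ξ'.black = B + Multiset.replicate P (q, some ()))
    (hW : Ξ'.white = W + Multiset.replicate Q (p, some ()))
    (hBn : ∀ x ∈ B, x.2 = none) (hWn : ∀ x ∈ W, x.2 = none) (hcard : B.card + W.card = 1)
    (hsum : (B.map Prod.fst).sum + P * q = (W.map Prod.fst).sum + Q * p)
    (hp : p = p.gcd q * p') (hq : q = p.gcd q * q') (hg : 0 < p.gcd q) (hp0 : 0 < p)
    (hd : 0 < d) (hM : p + q = d * (P + Q) + 1) (hM0 : 0 < P + Q)
    (hJ : ∀ j, j * p' ≤ P ∧ j * q' ≤ Q ↔ j ≤ p.gcd q / d)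
    (hterm : ∀ j ≤ p.gcd q / d, ∀ n, termC p q d (p.gcd q / d - j) n =
      prefactor p q d (numBlocks n) * (P + Q - j * (p' + q')).choose (P - j * p') *
        blockProd p q n) :
    Finite (FTree (Ξ.divided d)) ∧
      treeG Ξ d = ∑ t ∈ typeSet p q d, termC p q d t.1 t.2 := by
  have hco : p'.Coprime q' := by
    refine Nat.eq_of_mul_eq_mul_left hg ?_
    rw [← Nat.gcd_mul_left, ← hp, ← hq, mul_one]
  have hp'0 : 0 < p' := Nat.pos_of_ne_zero fun h => by
    rw [h, mul_zero] at hp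
    omega
  have hMQ : (d : ℚ) * (P + Q : ℕ) = p + q - 1 := by
    rw [eq_sub_iff_add_eq]
    exact_mod_cast hM.symm
  refine ⟨?_, ?_⟩
  · exact LabeledPassport.finite_treesWith (fillMultiset_nodup _) (fillMultiset_nodup _)
  have hd' : (d : ℚ) ≠ 0 := by positivity
  have hM' : ((P + Q : ℕ) : ℚ) ≠ 0 := by positivity
  have hf : ((P ! * Q ! : ℕ) : ℚ) ≠ 0 := by positivity
  have hcount := Ξ'.card_FTree_of_star (g := p.gcd q) (J := p.gcd q / d)
    (hB.trans (by rw [← hq])) (hW.trans (by rw [← hp])) hBn hWn hcard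
    (by rw [← hp, ← hq, hsum]) hg hco hp'0 hM0 hJ
  rw [sum_typeSet p q d (fun s n => termC p q d s n), treeG, hdiv,
    Ξ'.multFactorial_of_star hB hW hBn hWn hcard,
    div_eq_iff (mul_ne_zero hd' hf)]
  -- The factor P + Q is the number of choices of a root edge in `card_FTree_of_star`.
  refine mul_left_cancel₀ hM' (hcount.trans ?_)
  rw [Finset.sum_mul, Finset.mul_sum, Finset.mul_sum]
  refine Finset.sum_congr rfl fun j hj => ?_
  have hj : j ≤ p.gcd q / d := Nat.lt_succ_iff.1 (Finset.mem_range.1 hj)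
  rw [expCoeff_eq_sum_partMults _ (hj.trans (Nat.div_le_self _ _)), Finset.mul_sum,
    Finset.mul_sum, Finset.sum_mul, Finset.mul_sum]
  refine Finset.sum_congr rfl fun n _ => ?_
  rw [hterm j hj n, mul_right_comm (prefactor _ _ _ _),
    prefactor_mul_blockProd hp hq hg hd hMQ hM0, ← hMQ]
  push_cast
  have hM'' : (P : ℚ) + Q ≠ 0 := by exact_mod_cast hM'
  field_simp

lemma mul_le_iff_of_eq_mul {a g a' d A : ℕ} (ha : 0 < a') (hd : 0 < d) (h : a = g * a')
    (hA : a = d * A) (j : ℕ) : j * a' ≤ A ↔ j * d ≤ g := by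
  rw [← Nat.mul_le_mul_left_iff hd, ← hA, h, mul_left_comm, ← mul_assoc,
    Nat.mul_le_mul_right_iff ha]

/-- Here A is a rounded down quotient a/d, and the remainder 1 makes the inequality strict. In the
main proof, d does not divide g, so strict and weak inequality agree there. -/
lemma mul_le_iff_of_eq_mul_add_one {a g a' d A : ℕ} (ha : 0 < a') (hd : 0 < d) (h : a = g * a')
    (hA : a = d * A + 1) (j : ℕ) : j * a' ≤ A ↔ j * d < g := by
  rw [← Nat.mul_le_mul_left_iff hd, ← Nat.lt_succ_iff, Nat.succ_eq_add_one, ← hA, h,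
    mul_left_comm, ← mul_assoc, Nat.mul_lt_mul_right ha]

end Main

theorem proposition4p9 (p q d : ℕ) (hq : 1 ≤ q) (hpq : q < p) (hd : 1 < d)
    (hdiv : (pqPassport p q (hq.trans hpq.le) hq).HasDivided d) :
    Finite (FTree ((pqPassport p q (hq.trans hpq.le) hq).divided d)) ∧
      treeG (pqPassport p q (hq.trans hpq.le) hq) d =
        ∑ t ∈ typeSet p q d, termC p q d t.1 t.2 := by
  classical
  have hp0 : 0 < p := hq.trans hpq.le
  have hg : 0 < p.gcd q := Nat.gcd_pos_of_pos_left _ hp0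
  obtain ⟨p', hp'⟩ := Nat.gcd_dvd_left p q
  obtain ⟨q', hq'⟩ := Nat.gcd_dvd_right p q
  have hp'0 : 0 < p' := Nat.pos_of_ne_zero fun h => by rw [h, mul_zero] at hp'; omega
  have hq'0 : 0 < q' := Nat.pos_of_ne_zero fun h => by rw [h, mul_zero] at hq'; omega
  have hd0 : 0 < d := by omega
  obtain ⟨Ξ', hΞ⟩ := hdiv
  have heq := hΞ.divided_eq
  rcases hΞ with ⟨h, -⟩ | ⟨-, x, ⟨hx, hdx, hcx, -, hother⟩, hB, hW⟩ |
    ⟨-, x, ⟨hx, hdx, hcx, -, hother⟩, hB, hW⟩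
  · omega
  · obtain rfl : x = (q, ()) := Multiset.eq_of_mem_replicate hx
    have hc1 : Multiset.count (q, ()) (Multiset.replicate p (q, ())) = p :=
      Multiset.count_replicate_self _ _
    have hdp : d ∣ p - 1 := by
      convert hcx
      convert hc1.symm
      rfl
    obtain ⟨Q, hQ⟩ : d ∣ q := hdx
    obtain ⟨P, hP⟩ := hdp
    have hPd : (p - 1) / d = P := Nat.div_eq_of_eq_mul_right hd0 hP
    have hQd : q / d = Q := Nat.div_eq_of_eq_mul_right hd0 hQ
    have hM : p + q = d * (P + Q) + 1 := by rw [mul_add, ← hP, ← hQ]; omega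
    have hp1 : p = d * P + 1 := by omega
    have hM0 : 0 < P + Q := by
      by_contra h
      rw [Nat.eq_zero_of_not_pos h] at hM
      omega
    have hMQ : (d : ℚ) * (P + Q : ℕ) = p + q - 1 := by
      rw [eq_sub_iff_add_eq]
      exact_mod_cast hM.symm
    -- A common divisor of gcd(p, q) and p - 1 divides 1.
    have hne : ∀ j, j * d ≠ p.gcd q := fun j h => by
      have h1 : d ∣ p.gcd q := ⟨j, by rw [← h, mul_comm]⟩
      have h2 : d ∣ 1 := (Nat.dvd_add_right (Dvd.intro P rfl)).1 (hp1 ▸ h1.trans (Nat.gcd_dvd_left p q))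
      exact absurd (Nat.le_of_dvd one_pos h2) (by omega)
    have hJ : ∀ j, j * p' ≤ P ∧ j * q' ≤ Q ↔ j ≤ p.gcd q / d := fun j => by
      rw [mul_le_iff_of_eq_mul_add_one hp'0 hd0 hp' hp1, mul_le_iff_of_eq_mul hq'0 hd0 hq' hQ,
        Nat.le_div_iff_mul_le hd0]
      exact ⟨fun h => h.2, fun h => ⟨lt_of_le_of_ne h (hne j), h⟩⟩
    refine finite_and_treeG_eq (B := {(Q, none)}) (W := 0) heq
      (hB.trans ?_) (hW.trans ?_) (by simp) (by simp) (by simp) ?_ hp' hq' hg hp0 hd0 hM hM0 hJ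
      fun j hj n => ?_
    · exact (centerPart_replicate d p (q, ())).trans (by rw [← hPd, ← hQd]; rfl)
    · exact (plainPart_replicate d q (p, ())).trans (by rw [← hQd, zero_add]; rfl)
    · simp only [Multiset.map_singleton, Multiset.sum_singleton, Multiset.map_zero,
        Multiset.sum_zero]
      -- The star of weight Q = q/d balances the total weights: Q + P q = Q (1 + d P) = Q p.
      linear_combination P * hQ - Q * hp1
    · obtain ⟨h1, h2⟩ := (hJ j).2 hj
      -- The formula takes the lower entry on the side of q, whereas the count takes it on the side
      -- of p; the two entries are complementary.
      rw [termC, if_pos (Nat.dvd_gcd ⟨P, hP⟩ ⟨Q, hQ⟩), centerBinom_eq hp' hq' hg hd0 hMQ hq' hQ hj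
        (by rw [mul_add]; omega) h2, Nat.choose_symm_of_eq_add (b := P - j * p')
        (by rw [mul_add]; omega)]
  · obtain rfl : x = (p, ()) := Multiset.eq_of_mem_replicate hx
    have hc1 : Multiset.count (p, ()) (Multiset.replicate q (p, ())) = q :=
      Multiset.count_replicate_self _ _
    have hdq : d ∣ q - 1 := by
      convert hcx
      convert hc1.symm
      rfl
    obtain ⟨P, hP⟩ : d ∣ p := hdx
    obtain ⟨Q, hQ⟩ := hdq
    have hPd : p / d = P := Nat.div_eq_of_eq_mul_right hd0 hP
    have hQd : (q - 1) / d = Q := Nat.div_eq_of_eq_mul_right hd0 hQ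
    have hM : p + q = d * (P + Q) + 1 := by rw [mul_add, ← hP, ← hQ]; omega
    have hq1 : q = d * Q + 1 := by omega
    have hM0 : 0 < P + Q := by
      by_contra h
      rw [Nat.eq_zero_of_not_pos h] at hM
      omega
    have hMQ : (d : ℚ) * (P + Q : ℕ) = p + q - 1 := by
      rw [eq_sub_iff_add_eq]
      exact_mod_cast hM.symm
    -- A common divisor of gcd(p, q) and q - 1 divides 1.
    have hne : ∀ j, j * d ≠ p.gcd q := fun j h => by
      have h1 : d ∣ p.gcd q := ⟨j, by rw [← h, mul_comm]⟩
      have h2 : d ∣ 1 := (Nat.dvd_add_right (Dvd.intro Q rfl)).1 (hq1 ▸ h1.trans (Nat.gcd_dvd_right p q))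
      exact absurd (Nat.le_of_dvd one_pos h2) (by omega)
    have hJ : ∀ j, j * p' ≤ P ∧ j * q' ≤ Q ↔ j ≤ p.gcd q / d := fun j => by
      rw [mul_le_iff_of_eq_mul hp'0 hd0 hp' hP, mul_le_iff_of_eq_mul_add_one hq'0 hd0 hq' hq1,
        Nat.le_div_iff_mul_le hd0]
      exact ⟨fun h => h.1, fun h => ⟨h, lt_of_le_of_ne h (hne j)⟩⟩
    refine finite_and_treeG_eq (B := 0) (W := {(P, none)}) heq
      (hB.trans ?_) (hW.trans ?_) (by simp) (by simp) (by simp) ?_ hp' hq' hg hp0 hd0 hM hM0 hJ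
      fun j hj n => ?_
    · exact (plainPart_replicate d p (q, ())).trans (by rw [← hPd, zero_add]; rfl)
    · exact (centerPart_replicate d q (p, ())).trans (by rw [← hPd, ← hQd]; rfl)
    · simp only [Multiset.map_singleton, Multiset.sum_singleton, Multiset.map_zero,
        Multiset.sum_zero]
      linear_combination P * hq1 - Q * hP
    · obtain ⟨h1, h2⟩ := (hJ j).2 hj
      -- As d divides q - 1, it cannot divide q, so the second case in the definition of `termC`
      -- applies.
      have hnot : ¬ d ∣ (p - 1).gcd q := fun h => by
        have h3 : d ∣ 1 := (Nat.dvd_add_right (Dvd.intro Q rfl)).1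
          (hq1 ▸ h.trans (Nat.gcd_dvd_right _ _))
        exact absurd (Nat.le_of_dvd one_pos h3) (by omega)
      rw [termC, if_neg hnot, if_pos (Nat.dvd_gcd ⟨P, hP⟩ ⟨Q, hQ⟩),
        centerBinom_eq hp' hq' hg hd0 hMQ hp' hP hj (by rw [mul_add]; omega) h1]
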